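/- Let $b>0$ and $\rho>0$. On $L^2(\mathbb R^3)$ consider the Landau operator $\mathbf L_{\mathbf A}=\sum_{j=1}^3(-\mathrm i\partial_j+a_j)^2$ with $\mathbf A(\mathbf x)=(a_1,a_2,a_3)(\mathbf x)=(0,bx_1,0)$, i.e. with magnetic field $(0,0,b)$, and the magnetic translations $(\mathfrak m_{\mathbf R}f)(\mathbf x)=\mathrm e^{-\mathrm i bR_1x_2}f(\mathbf x-\mathbf R)$, $\mathbf R\in\mathbb R^3$. For a nonnegative self-adjoint operator $T$ on $L^2(\mathbb R^3)$ let $\underline{\mathrm{Tr}}_3(T)=\lim_{L\to\infty}L^{-3}\,\mathrm{Tr}(\mathbf 1_{\Gamma_L}T\mathbf 1_{\Gamma_L})\in[0,\infty]$, $\Gamma_L=[-\tfrac L2,\tfrac L2]^3$, be the trace per unit volume (when the limit exists), and for a bounded operator $\gamma\ge 0$ let $\underline{\mathrm{Tr}}_3(\mathbf L_{\mathbf A}\gamma):=\underline{\mathrm{Tr}}_3(\gamma^{1/2}\mathbf L_{\mathbf A}\gamma^{1/2})$, understood through the quadratic form $f\mapsto\sum_{j=1}^3\|(-\mathrm i\partial_j+a_j)\gamma^{1/2}f\|^2\in[0,\infty]$.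 Define the kinetic energy density of the three-dimensional homogeneous electron gas of density $\rho$ by $$\omega^{3d}(b,\rho)=\inf\Big\{\tfrac12\underline{\mathrm{Tr}}_3(\mathbf L_{\mathbf A}\gamma)\;:\;\gamma=\gamma^*\text{ bounded on }L^2(\mathbb R^3),\ 0\le\gamma\le1,\ \gamma\,\mathfrak m_{\mathbf R}=\mathfrak m_{\mathbf R}\,\gamma\ \ \forall\,\mathbf R\in\mathbb R^3,\ \underline{\mathrm{Tr}}_3(\gamma)=\rho\Big\}.$$ Let $\epsilon_n=b(2n+1)$, $n=0,1,2,\dots$, be the Landau levels. Then there is a unique real number $\delta$ (the Fermi level) such that $$\sum_{n\ge0}(\delta-\epsilon_n)_+^{1/2}=\frac{2\pi^2\rho}{b},$$ it satisfies $\delta>0$, and $$\omega^{3d}(b,\rho)=\frac{\delta\rho}{6}+\frac{b}{6\pi^2}\sum_{n\ge0}\epsilon_n\,(\delta-\epsilon_n)_+^{1/2}.$$ -/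

import Mathlib

open MeasureTheory Filter Topology
open scoped ENNReal NNReal ContDiff ComplexConjugate

/-- Euclidean space `ℝ³`; the coordinates `x₁, x₂, x₃` are `x 0, x 1, x 2`. -/
abbrev R3 : Type := EuclideanSpace ℝ (Fin 3)

/-- The complex Hilbert space `L²(ℝ³)`. -/
abbrev L2R3 : Type := Lp ℂ 2 (volume : Measure R3)

noncomputable section

/-! ### The Landau operator -/

/-- The vector potential `A(x) = (0, b x₁, 0)` of the constant magnetic field `(0, 0, b)`. -/
def vectorPotential (b : ℝ) (x : R3) : Fin 3 → ℝ := ![0, b * x 0, 0]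

/-- `(p_j + a_j) φ = -i ∂_j φ + a_j φ` for a smooth function `φ`. -/
def magMomentum (b : ℝ) (j : Fin 3) (φ : R3 → ℂ) (x : R3) : ℂ :=
  -Complex.I * fderiv ℝ φ x (EuclideanSpace.single j 1) + (vectorPotential b x j : ℂ) * φ x

/-- `(p_j + a_j) ψ = g` in the sense of distributions, for `ψ, g ∈ L²(ℝ³)`:
`⟨(p_j + a_j) φ, ψ⟩ = ⟨φ, g⟩` for every smooth compactly supported `φ`. -/
def IsWeakMagMomentum (b : ℝ) (j : Fin 3) (ψ g : L2R3) : Prop :=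
  ∀ φ : R3 → ℂ, ContDiff ℝ ∞ φ → HasCompactSupport φ →
    ∫ x, conj (magMomentum b j φ x) * ψ x = ∫ x, conj (φ x) * g x

/-- `‖(p_j + a_j) ψ‖²`, which is `∞` if the distribution `(p_j + a_j) ψ` is not in `L²(ℝ³)`. -/
def magMomentumNormSq (b : ℝ) (j : Fin 3) (ψ : L2R3) : ℝ≥0∞ :=
  ⨅ (g : L2R3) (_ : IsWeakMagMomentum b j ψ g), ‖g‖ₑ ^ 2

/-- The closed quadratic form `⟨ψ, L_A ψ⟩ = ∑_j ‖(p_j + a_j) ψ‖² ∈ [0, ∞]` of the Landau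
operator `L_A = ∑_j (p_j + a_j)²`, with the value `∞` outside the form domain. -/
def landauForm (b : ℝ) (ψ : L2R3) : ℝ≥0∞ := ∑ j : Fin 3, magMomentumNormSq b j ψ

/-! ### Magnetic translations -/

theorem memLp_magTranslation (b : ℝ) (R : R3) (f : L2R3) :
    MemLp (fun x : R3 => Complex.exp (-Complex.I * (b * R 0 * x 1 : ℝ)) * f (x - R)) 2 volume := by
  have h1 : MemLp (fun x : R3 => f (x - R)) 2 volume :=
    (Lp.memLp f).comp_measurePreserving (measurePreserving_sub_right volume R)
  refine h1.of_le (AEStronglyMeasurable.mul ?_ h1.1) (Eventually.of_forall fun x => ?_)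
  · exact (by fun_prop : Continuous fun x : R3 =>
      Complex.exp (-Complex.I * (b * R 0 * x 1 : ℝ))).aestronglyMeasurable
  · rw [norm_mul, Complex.norm_exp]
    simp

/-- The magnetic translation `(m_R f)(x) = exp(-i b R₁ x₂) f(x - R)`, `R ∈ ℝ³`, on `L²(ℝ³)`. -/
def magTranslation (b : ℝ) (R : R3) (f : L2R3) : L2R3 :=
  (memLp_magTranslation b R f).toLp _

/-! ### Trace per unit volume -/

/-- The cube `Γ_L = [-L/2, L/2]³`. -/
def cube (L : ℝ) : Set R3 := {x | ∀ i, x i ∈ Set.Icc (-(L / 2)) (L / 2)}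

theorem measurableSet_cube (L : ℝ) : MeasurableSet (cube L) := by
  have : cube L = ⋂ i, (fun x : R3 => x i) ⁻¹' Set.Icc (-(L / 2)) (L / 2) := by
    ext x; simp [cube]
  rw [this]
  exact MeasurableSet.iInter fun i => (by fun_prop : Continuous fun x : R3 => x i).measurable
    measurableSet_Icc

/-- Multiplication by the indicator function of `Γ_L` on `L²(ℝ³)`. -/
def cubeProj (L : ℝ) (f : L2R3) : L2R3 :=
  ((Lp.memLp f).indicator (measurableSet_cube L)).toLp ((cube L).indicator f)

/-- `Tr(1_{Γ_L} T 1_{Γ_L}) ∈ [0, ∞]` for a nonnegative self-adjoint operator `T` on `L²(ℝ³)` with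
quadratic form `q(f) = ⟨f, T f⟩` (`∞` outside the form domain): the supremum of the partial
traces `∑ ⟨1_{Γ_L} e_i, T 1_{Γ_L} e_i⟩` over the finite orthonormal families. -/
def cubeTrace (q : L2R3 → ℝ≥0∞) (L : ℝ) : ℝ≥0∞ :=
  ⨆ (n : ℕ) (e : Fin n → L2R3) (_ : Orthonormal ℂ e), ∑ i, q (cubeProj L (e i))

/-- The trace per unit volume `lim_{L → ∞} L⁻³ Tr(1_{Γ_L} T 1_{Γ_L})` of the nonnegative operator
with quadratic form `q` exists in `[0, ∞]` and equals `t`. -/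
def HasTracePerVolume (q : L2R3 → ℝ≥0∞) (t : ℝ≥0∞) : Prop :=
  Tendsto (fun L : ℝ => cubeTrace q L / ENNReal.ofReal (L ^ 3)) atTop (𝓝 t)

/-- The quadratic form `⟨f, γ f⟩` of a nonnegative bounded operator `γ`. -/
def densityForm (γ : L2R3 →L[ℂ] L2R3) (f : L2R3) : ℝ≥0∞ :=
  ENNReal.ofReal (RCLike.re (inner ℂ f (γ f)))

/-- The nonnegative square root `γ^{1/2}` of a nonnegative bounded operator on a Hilbert space. -/
def opSqrt {H : Type*} [NormedAddCommGroup H] [InnerProductSpace ℂ H] [CompleteSpace H]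
    (γ : H →L[ℂ] H) : H →L[ℂ] H :=
  CFC.sqrt γ

/-- The quadratic form `⟨γ^{1/2} f, L_A γ^{1/2} f⟩` of the nonnegative operator
`γ^{1/2} L_A γ^{1/2}`, whose trace per unit volume is the one of `L_A γ`. -/
def kineticForm (b : ℝ) (γ : L2R3 →L[ℂ] L2R3) (f : L2R3) : ℝ≥0∞ :=
  landauForm b (opSqrt γ f)

/-! ### The kinetic energy density -/

/-- The states of the homogeneous gas of density `ρ`: bounded self-adjoint operators
`0 ≤ γ ≤ 1` on `L²(ℝ³)` that commute with all magnetic translations and have trace per unit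
volume `ρ`. -/
structure IsHomogeneousState (b ρ : ℝ) (γ : L2R3 →L[ℂ] L2R3) : Prop where
  isSelfAdjoint : IsSelfAdjoint γ
  nonneg : 0 ≤ γ
  le_one : γ ≤ 1
  commute : ∀ (R : R3) (f : L2R3), γ (magTranslation b R f) = magTranslation b R (γ f)
  trace : HasTracePerVolume (densityForm γ) (ENNReal.ofReal ρ)

/-- The kinetic energy density `ω^{3d}(b, ρ) ∈ [0, ∞]`: the infimum, over all states of the
homogeneous gas, of one half of the trace per unit volume of `L_A γ`. -/
def kineticEnergyDensity (b ρ : ℝ) : ℝ≥0∞ :=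
  sInf {E | ∃ (γ : L2R3 →L[ℂ] L2R3) (t : ℝ≥0∞), IsHomogeneousState b ρ γ ∧
    HasTracePerVolume (kineticForm b γ) t ∧ E = t / 2}

/-- The Landau levels `ε_n = b (2n + 1)`. -/
def landauLevel (b : ℝ) (n : ℕ) : ℝ := b * (2 * n + 1)

end

/-! In Fourier variables ξ the first momentum is multiplication by 2πξ₁, and the second is 2πξ₂ +
(ib/2π)∂ in the variable ξ₁. A phase with exponent proportional to ξ₁ξ₂ removes the term 2πξ₂, so
these two momenta become the position and momentum of a harmonic oscillator in ξ₁, diagonalised by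
rescaled Hermite functions. Hence L²(ℝ³) is an orthogonal sum of copies of L²(ℝ²), with embeddings
`landauS` and coefficients `landauC`, on which the Landau operator H is multiplication by εₙ +
4π²k², where k is the third frequency.

Magnetic translations act alike on all copies, by phases and shifts of the second frequency, so they
commute with every operator `landauOp` of multipliers mₙ(k). Such an operator, restricted to a cube,
has squared Hilbert–Schmidt norm exactly L³ (b/2π) ∑ₙ ∫ mₙ² (`hsSq_landauOp_cubeOp`); the factor
b/2π is the degeneracy of a Landau level per unit area.

Upper bound: the spectral projection onto energies at most δ has density ρ by the choice of δ, and
its energy is the claimed value. Lower bound (`mul_trace_le`): take the trace of δ ≤ H + (δ - H)₊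
against γ. The trace per unit volume is cyclic for operators commuting with magnetic translations
(`hsSq_comp_cubeOp_eq_adjoint`), and γ ≤ 1, so (δ - H)₊ contributes at most its own trace. This
gives Tr(Hγ) ≥ δρ - Tr (δ - H)₊, which is the energy of the Fermi projection. Only finitely many
levels lie below δ, so all the sums over n that matter are finite. -/

/-! ### Tools: Hilbert–Schmidt norms, L² multipliers and tensors, Fourier transform, Hermite
functions. -/

noncomputable section

/-! ### Hilbert–Schmidt norms -/

section HilbertSchmidt

variable {H K : Type*} [NormedAddCommGroup H] [InnerProductSpace ℂ H]
  [NormedAddCommGroup K] [InnerProductSpace ℂ K]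

/-- The squared Hilbert–Schmidt norm `‖A‖₂² ∈ [0, ∞]` of a bounded operator. -/
def hsSq (A : H →L[ℂ] K) : ℝ≥0∞ :=
  ⨆ (n : ℕ) (e : Fin n → H) (_ : Orthonormal ℂ e), ∑ i, ‖A (e i)‖ₑ ^ 2

theorem HilbertBasis.tsum_enorm_inner_sq {ι : Type*} (b : HilbertBasis ι ℂ H) (x : H) :
    ∑' i, ‖inner ℂ (b i) x‖ₑ ^ 2 = ‖x‖ₑ ^ 2 := by
  have h := b.hasSum_inner_mul_inner x x
  have h2 : HasSum (fun i => ‖inner ℂ (b i) x‖ ^ 2) (‖x‖ ^ 2) := by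
    have := Complex.hasSum_re h
    rw [inner_self_eq_norm_sq_to_K] at this
    convert this using 1
    · ext i
      rw [← inner_conj_symm x (b i), Complex.conj_mul']
      norm_cast
    · norm_cast
  have h3 : ∀ z : ℂ, ‖z‖ₑ ^ 2 = ENNReal.ofReal (‖z‖ ^ 2) := fun z => by
    rw [ENNReal.ofReal_pow (norm_nonneg _), ofReal_norm]
  simp_rw [h3]
  rw [← ENNReal.ofReal_tsum_of_nonneg (fun _ => by positivity) h2.summable, h2.tsum_eq,
    ENNReal.ofReal_pow (norm_nonneg _), ofReal_norm]

theorem Orthonormal.sum_enorm_inner_sq_le {ι : Type*} {e : ι → H} (he : Orthonormal ℂ e)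
    (s : Finset ι) (x : H) : ∑ i ∈ s, ‖inner ℂ (e i) x‖ₑ ^ 2 ≤ ‖x‖ₑ ^ 2 := by
  have h := he.sum_inner_products_le (s := s) x
  have h3 : ∀ z : ℂ, ‖z‖ₑ ^ 2 = ENNReal.ofReal (‖z‖ ^ 2) := fun z => by
    rw [ENNReal.ofReal_pow (norm_nonneg _), ofReal_norm]
  simp_rw [h3]
  rw [← ENNReal.ofReal_sum_of_nonneg (fun _ _ => by positivity), ← ofReal_norm x,
    ← ENNReal.ofReal_pow (norm_nonneg _)]
  exact ENNReal.ofReal_le_ofReal h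

theorem tsum_le_hsSq (A : H →L[ℂ] K) {ι : Type*} {b : ι → H} (hb : Orthonormal ℂ b) :
    ∑' j, ‖A (b j)‖ₑ ^ 2 ≤ hsSq A := by
  rw [ENNReal.tsum_eq_iSup_sum]
  refine iSup_le fun s => ?_
  have e := s.equivFin.symm
  refine le_trans (le_of_eq ?_) (le_iSup_of_le s.card (le_iSup_of_le (fun i => b (e i))
    (le_iSup_of_le (hb.comp _ (Subtype.val_injective.comp e.injective)) le_rfl)))
  rw [← Finset.sum_coe_sort s, ← e.sum_comp]

theorem hsSq_comp_le (B : K →L[ℂ] K) (hB : ∀ x, ‖B x‖ ≤ ‖x‖) (A : H →L[ℂ] K) :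
    hsSq (B ∘L A) ≤ hsSq A := by
  refine iSup_mono fun n => iSup_mono fun e => iSup_mono fun _ => Finset.sum_le_sum fun i _ => ?_
  have := enorm_le_iff_norm_le.2 (hB (A (e i)))
  exact pow_le_pow_left' this 2

variable [CompleteSpace H] [CompleteSpace K]

/-- Parseval in the basis of `K`, exchange of the two sums, then Bessel for the orthonormal family
in `H`. Adjoint invariance and independence of the basis both follow from this bound. -/
theorem hsSq_le_tsum_adjoint (A : H →L[ℂ] K) {ι : Type*} (b : HilbertBasis ι ℂ K) :
    hsSq A ≤ ∑' j, ‖A.adjoint (b j)‖ₑ ^ 2 := by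
  refine iSup_le fun n => iSup_le fun e => iSup_le fun he => ?_
  calc ∑ i, ‖A (e i)‖ₑ ^ 2 = ∑ i, ∑' j, ‖inner ℂ (b j) (A (e i))‖ₑ ^ 2 := by
        simp_rw [b.tsum_enorm_inner_sq]
    _ = ∑' j, ∑ i, ‖inner ℂ (b j) (A (e i))‖ₑ ^ 2 :=
        (Summable.tsum_finsetSum fun _ _ => ENNReal.summable).symm
    _ ≤ ∑' j, ‖A.adjoint (b j)‖ₑ ^ 2 := by
        refine ENNReal.tsum_le_tsum fun j => ?_
        refine le_trans (le_of_eq ?_) (he.sum_enorm_inner_sq_le Finset.univ (A.adjoint (b j)))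
        refine Finset.sum_congr rfl fun i _ => ?_
        rw [← ContinuousLinearMap.adjoint_inner_left, ← inner_conj_symm]
        congr 1
        exact RCLike.enorm_conj _

theorem hsSq_adjoint_le (A : H →L[ℂ] K) : hsSq A.adjoint ≤ hsSq A := by
  obtain ⟨w, b, hb⟩ := exists_hilbertBasis ℂ H
  refine (hsSq_le_tsum_adjoint A.adjoint b).trans ?_
  rw [ContinuousLinearMap.adjoint_adjoint]
  exact tsum_le_hsSq A b.orthonormal

theorem hsSq_adjoint (A : H →L[ℂ] K) : hsSq A.adjoint = hsSq A := by
  refine le_antisymm (hsSq_adjoint_le A) ?_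
  simpa using hsSq_adjoint_le A.adjoint

theorem hsSq_eq_tsum (A : H →L[ℂ] K) {ι : Type*} (b : HilbertBasis ι ℂ H) :
    hsSq A = ∑' j, ‖A (b j)‖ₑ ^ 2 := by
  refine le_antisymm ?_ (tsum_le_hsSq A b.orthonormal)
  rw [← hsSq_adjoint]
  simpa using hsSq_le_tsum_adjoint A.adjoint b

/-- Countability is needed to exchange the sum over a basis with integrals and with
almost-everywhere statements. -/
theorem exists_countable_hilbertBasis [SecondCountableTopology H] :
    ∃ (w : Set H) (_ : HilbertBasis w ℂ H), Countable w := by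
  obtain ⟨w, b, hb⟩ := exists_hilbertBasis ℂ H
  refine ⟨w, b, ?_⟩
  have h1 : Orthonormal ℂ ((↑) : w → H) := hb ▸ b.orthonormal
  have : DiscreteTopology w := by
    refine discreteTopology_iff_isOpen_singleton.2 fun x => ?_
    rw [Metric.isOpen_singleton_iff]
    refine ⟨1, one_pos, fun y hy => ?_⟩
    by_contra hne
    -- Distinct orthonormal vectors are at distance √2, so unit balls isolate the basis vectors, and
    -- a discrete subset of a separable space is countable.
    have h2 : ‖(y : H) - x‖ ^ 2 = 2 := by
      rw [@norm_sub_sq ℂ, h1.2 hne, h1.1, h1.1]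
      norm_num
    rw [Subtype.dist_eq, dist_eq_norm] at hy
    nlinarith [norm_nonneg ((y : H) - x)]
  exact TopologicalSpace.separableSpace_iff_countable.1 inferInstance

end HilbertSchmidt

/-! ### Multiplication operators and tensor products on `L²` -/

section L2

variable {X Y : Type*} [MeasurableSpace X] [MeasurableSpace Y] {μ : Measure X} {ν : Measure Y}

theorem Lp.enorm_sq_eq_lintegral (f : Lp ℂ 2 μ) : ‖f‖ₑ ^ 2 = ∫⁻ x, ‖f x‖ₑ ^ 2 ∂μ := by
  rw [Lp.enorm_def, eLpNorm_eq_lintegral_rpow_enorm_toReal (by simp) (by simp)]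
  simp only [ENNReal.toReal_ofNat, ENNReal.rpow_ofNat, one_div]
  rw [← ENNReal.rpow_natCast, ← ENNReal.rpow_mul]
  simp

/-- Bounded measurable functions. -/
structure BddMeas (m : X → ℂ) : Prop where
  measurable : Measurable m
  bound : ∃ C : ℝ, ∀ x, ‖m x‖ ≤ C

theorem BddMeas.memLp {m : X → ℂ} (hm : BddMeas m) (f : Lp ℂ 2 μ) :
    MemLp (fun x => m x * f x) 2 μ := by
  obtain ⟨C, hC⟩ := hm.bound
  refine (Lp.memLp f).of_le_mul (c := C)
    (hm.measurable.aestronglyMeasurable.mul (Lp.aestronglyMeasurable f))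
    (Eventually.of_forall fun x => ?_)
  rw [norm_mul]
  gcongr
  exact hC x

/-- Multiplication by a bounded measurable function on `L²`. -/
def mulOp (μ : Measure X) (m : X → ℂ) (hm : BddMeas m) : Lp ℂ 2 μ →L[ℂ] Lp ℂ 2 μ :=
  LinearMap.mkContinuous
    { toFun := fun f => (hm.memLp f).toLp _
      map_add' := fun f g => by
        rw [← MemLp.toLp_add]
        refine MemLp.toLp_congr _ _ ?_
        filter_upwards [Lp.coeFn_add f g] with x hx
        simp only [hx, Pi.add_apply, mul_add]
      map_smul' := fun c f => by
        rw [RingHom.id_apply, ← MemLp.toLp_const_smul]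
        refine MemLp.toLp_congr _ _ ?_
        filter_upwards [Lp.coeFn_smul c f] with x hx
        simp [hx, mul_left_comm] } (max hm.bound.choose 0) (by
  intro f
  simp only [LinearMap.coe_mk, AddHom.coe_mk]
  refine Lp.norm_le_mul_norm_of_ae_le_mul ?_
  filter_upwards [(hm.memLp f).coeFn_toLp] with x hx
  rw [hx, norm_mul]
  gcongr
  exact (hm.bound.choose_spec x).trans (le_max_left _ _))

theorem coeFn_mulOp {m : X → ℂ} (hm : BddMeas m) (f : Lp ℂ 2 μ) :
    mulOp μ m hm f =ᵐ[μ] fun x => m x * f x :=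
  (hm.memLp f).coeFn_toLp

theorem enorm_sq_mulOp {m : X → ℂ} (hm : BddMeas m) (f : Lp ℂ 2 μ) :
    ‖mulOp μ m hm f‖ₑ ^ 2 = ∫⁻ x, ‖m x‖ₑ ^ 2 * ‖f x‖ₑ ^ 2 ∂μ := by
  rw [Lp.enorm_sq_eq_lintegral]
  refine lintegral_congr_ae ?_
  filter_upwards [coeFn_mulOp hm f] with x hx
  rw [hx, enorm_mul, mul_pow]

theorem mulOp_mulOp {m m' m'' : X → ℂ} (hm : BddMeas m) (hm' : BddMeas m') (hm'' : BddMeas m'')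
    (h : ∀ x, m x * m' x = m'' x) (f : Lp ℂ 2 μ) :
    mulOp μ m hm (mulOp μ m' hm' f) = mulOp μ m'' hm'' f := by
  refine Lp.ext ?_
  filter_upwards [coeFn_mulOp hm (mulOp μ m' hm' f), coeFn_mulOp hm' f, coeFn_mulOp hm'' f]
    with x h1 h2 h3
  rw [h1, h2, h3, ← h, mul_assoc]

theorem inner_mulOp_left {m m' : X → ℂ} (hm : BddMeas m) (hm' : BddMeas m')
    (h : ∀ x, m' x = conj (m x)) (f g : Lp ℂ 2 μ) :
    inner ℂ (mulOp μ m hm f) g = inner ℂ f (mulOp μ m' hm' g) := by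
  rw [L2.inner_def, L2.inner_def]
  refine integral_congr_ae ?_
  filter_upwards [coeFn_mulOp hm f, coeFn_mulOp hm' g] with x h1 h2
  simp only [h1, h2, h, RCLike.inner_apply, map_mul]
  ring

theorem memLp_tensor [SFinite ν] [SFinite μ] (f : Lp ℂ 2 μ) (g : Lp ℂ 2 ν) :
    MemLp (fun p : X × Y => f p.1 * g p.2) 2 (μ.prod ν) := by
  have hm : AEStronglyMeasurable (fun p : X × Y => f p.1 * g p.2) (μ.prod ν) :=
    (Lp.aestronglyMeasurable f).comp_fst.mul (Lp.aestronglyMeasurable g).comp_snd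
  refine (memLp_two_iff_integrable_sq_norm hm).2 ?_
  have h1 := (memLp_two_iff_integrable_sq_norm (Lp.aestronglyMeasurable f)).1 (Lp.memLp f)
  have h2 := (memLp_two_iff_integrable_sq_norm (Lp.aestronglyMeasurable g)).1 (Lp.memLp g)
  refine (h1.mul_prod h2).congr (Eventually.of_forall fun p => ?_)
  simp [mul_pow]

theorem enorm_sq_tensor [SFinite ν] [SFinite μ] (f : Lp ℂ 2 μ) (g : Lp ℂ 2 ν) :
    ‖(memLp_tensor f g).toLp _‖ₑ ^ 2 = ‖f‖ₑ ^ 2 * ‖g‖ₑ ^ 2 := by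
  simp_rw [Lp.enorm_sq_eq_lintegral]
  rw [← lintegral_prod_mul]
  · refine lintegral_congr_ae ?_
    filter_upwards [(memLp_tensor f g).coeFn_toLp] with p hp
    rw [hp, enorm_mul, mul_pow]
  · exact (Lp.aestronglyMeasurable f).enorm.pow_const 2
  · exact (Lp.aestronglyMeasurable g).enorm.pow_const 2

theorem norm_tensor [SFinite ν] [SFinite μ] (f : Lp ℂ 2 μ) (g : Lp ℂ 2 ν) :
    ‖(memLp_tensor f g).toLp _‖ = ‖f‖ * ‖g‖ := by
  have h := enorm_sq_tensor f g
  rw [← mul_pow] at h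
  have h2 := (ENNReal.pow_right_strictMono two_ne_zero).injective h
  simpa using congrArg ENNReal.toReal h2

variable (μ ν) in
/-- The tensor product `f ⊗ g` of `L²` functions. -/
def tensor [SFinite ν] [SFinite μ] : Lp ℂ 2 μ →L[ℂ] Lp ℂ 2 ν →L[ℂ] Lp ℂ 2 (μ.prod ν) :=
  LinearMap.mkContinuous₂ (LinearMap.mk₂ ℂ (fun f g => (memLp_tensor f g).toLp _)
    (fun f f' g => by
      rw [← MemLp.toLp_add]
      refine MemLp.toLp_congr _ _ ?_
      filter_upwards [Measure.quasiMeasurePreserving_fst.ae (Lp.coeFn_add f f')] with x hx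
      simp only [hx, Pi.add_apply, add_mul])
    (fun c f g => by
      rw [← MemLp.toLp_const_smul]
      refine MemLp.toLp_congr _ _ ?_
      filter_upwards [Measure.quasiMeasurePreserving_fst.ae (Lp.coeFn_smul c f)] with x hx
      simp [hx, mul_assoc])
    (fun f g g' => by
      rw [← MemLp.toLp_add]
      refine MemLp.toLp_congr _ _ ?_
      filter_upwards [Measure.quasiMeasurePreserving_snd.ae (Lp.coeFn_add g g')] with x hx
      simp only [hx, Pi.add_apply, mul_add])
    (fun c f g => by
      rw [← MemLp.toLp_const_smul]
      refine MemLp.toLp_congr _ _ ?_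
      filter_upwards [Measure.quasiMeasurePreserving_snd.ae (Lp.coeFn_smul c g)] with x hx
      simp [hx, mul_left_comm])) 1 (fun f g => by
        simp only [LinearMap.mk₂_apply]
        rw [norm_tensor, one_mul])

theorem coeFn_tensor [SFinite ν] [SFinite μ] (f : Lp ℂ 2 μ) (g : Lp ℂ 2 ν) :
    tensor μ ν f g =ᵐ[μ.prod ν] fun p => f p.1 * g p.2 :=
  (memLp_tensor f g).coeFn_toLp

theorem inner_tensor [SFinite ν] [SFinite μ] (f f' : Lp ℂ 2 μ) (g g' : Lp ℂ 2 ν) :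
    inner ℂ (tensor μ ν f g) (tensor μ ν f' g') = inner ℂ f f' * inner ℂ g g' := by
  simp_rw [L2.inner_def]
  rw [← integral_prod_mul]
  refine integral_congr_ae ?_
  filter_upwards [coeFn_tensor f g, coeFn_tensor f' g'] with p h1 h2
  simp only [h1, h2, RCLike.inner_apply, map_mul]
  ring

end L2

end

noncomputable section

/-! ### The Fourier transform on `L¹ ∩ L²` -/

section Fourier

open scoped FourierTransform SchwartzMap

variable {E : Type*} [NormedAddCommGroup E] [InnerProductSpace ℝ E] [FiniteDimensional ℝ E]
  [MeasurableSpace E] [BorelSpace E]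

theorem integral_mul_fourier_eq {f g : E → ℂ} (hf : Integrable f) (hg : Integrable g) :
    ∫ ξ, g ξ * 𝓕 f ξ = ∫ x, 𝓕 g x * f x := by
  simpa using! (VectorFourier.integral_fourierIntegral_smul_eq_flip (L := innerₗ E)
    Real.continuous_fourierChar continuous_inner hg hf).symm

/-- A smooth compactly supported real function as a complex Schwartz function. -/
def schwartzOfReal {F : Type*} [NormedAddCommGroup F] [NormedSpace ℝ F] (g : F → ℝ)
    (hg : ContDiff ℝ ∞ g) (hs : HasCompactSupport g) : 𝓢(F, ℂ) :=
  HasCompactSupport.toSchwartzMap (f := fun x => (g x : ℂ)) (hs.comp_left Complex.ofReal_zero)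
    (Complex.ofRealCLM.contDiff.comp hg)

@[simp] theorem schwartzOfReal_apply {F : Type*} [NormedAddCommGroup F] [NormedSpace ℝ F]
    (g : F → ℝ) (hg : ContDiff ℝ ∞ g) (hs : HasCompactSupport g) (x : F) :
    schwartzOfReal g hg hs x = g x := rfl

/-- A test function g is the Fourier transform of a Schwartz function s, so ∫ g f = ∫ s 𝓕f = 0. -/
theorem ae_eq_zero_of_fourier_eq_zero {f : E → ℂ} (hf : Integrable f) (h : ∀ ξ, 𝓕 f ξ = 0) :
    f =ᵐ[volume] 0 := by
  refine ae_eq_zero_of_integral_contDiff_smul_eq_zero hf.locallyIntegrable fun g hg hs => ?_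
  set s : 𝓢(E, ℂ) := 𝓕⁻ (schwartzOfReal g hg hs)
  have h1 : 𝓕 (s : E → ℂ) = fun x => (g x : ℂ) := by
    rw [← SchwartzMap.fourier_coe, FourierTransform.fourier_fourierInv_eq]
    rfl
  have h2 := integral_mul_fourier_eq hf s.integrable
  simp only [h, mul_zero, integral_zero, h1] at h2
  simpa using h2.symm

/-- Links the L² transform to the integral formula. Both sides are tested against smooth compactly
supported functions: Plancherel moves the L² transform onto the test function, and the L¹ duality
formula moves it back. -/
theorem Lp.fourier_ae_eq (f : Lp ℂ 2 (volume : Measure E)) (hf : Integrable f) :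
    ⇑(𝓕 f : Lp ℂ 2 (volume : Measure E)) =ᵐ[volume] 𝓕 (f : E → ℂ) := by
  have hc : Continuous (𝓕 (f : E → ℂ)) :=
    VectorFourier.fourierIntegral_continuous Real.continuous_fourierChar continuous_inner hf
  refine ae_eq_of_integral_contDiff_smul_eq
    ((Lp.memLp _).locallyIntegrable (by norm_num)) hc.locallyIntegrable fun g hg hs => ?_
  set s : 𝓢(E, ℂ) := schwartzOfReal g hg hs
  have h0 := Lp.inner_fourier_eq ((𝓕⁻ s).toLp 2) f
  rw [SchwartzMap.toLp_fourier_eq, FourierTransform.fourier_fourierInv_eq, L2.inner_def,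
    L2.inner_def] at h0
  have h1 : ∫ x, g x • (𝓕 f : Lp ℂ 2 (volume : Measure E)) x
      = ∫ x, inner ℂ ((s.toLp 2 : Lp ℂ 2 (volume : Measure E)) x)
        ((𝓕 f : Lp ℂ 2 (volume : Measure E)) x) := by
    refine integral_congr_ae ?_
    filter_upwards [s.coeFn_toLp 2] with x hx
    simp [hx, s, RCLike.inner_apply, mul_comm]
  have h2 : ∫ x, inner ℂ (((𝓕⁻ s).toLp 2 : Lp ℂ 2 (volume : Measure E)) x) (f x)
      = ∫ x, 𝓕 (s : E → ℂ) x * f x := by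
    refine integral_congr_ae ?_
    filter_upwards [(𝓕⁻ s).coeFn_toLp 2] with x hx
    rw [hx, RCLike.inner_apply, mul_comm, SchwartzMap.fourierInv_coe, Real.fourierInv_eq',
      Real.fourier_eq', ← integral_conj]
    congr 2
    ext y
    have h2 : conj (2 : ℂ) = 2 := map_ofNat _ 2
    simp [s, ← Complex.exp_conj, h2]
  rw [h1, h0, h2, ← integral_mul_fourier_eq hf s.integrable]
  simp [s]

end Fourier

/-! ### Cutoffs -/

section Cutoff

/-- Dominated convergence for the squared distance, with majorant (2C)²|f|². -/
theorem tendsto_mulOp {X : Type*} [MeasurableSpace X] {μ : Measure X} {m : ℕ → X → ℂ} {w : X → ℂ}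
    {C : ℝ} (hm : ∀ k, BddMeas (m k)) (hw : BddMeas w) (hC : ∀ k x, ‖m k x‖ ≤ C)
    (hlim : ∀ x, Tendsto (fun k => m k x) atTop (𝓝 (w x))) (f : Lp ℂ 2 μ) :
    Tendsto (fun k => mulOp μ (m k) (hm k) f) atTop (𝓝 (mulOp μ w hw f)) := by
  rw [tendsto_iff_edist_tendsto_0]
  have hwC : ∀ x, ‖w x‖ ≤ C := fun x => le_of_tendsto (hlim x).norm (Eventually.of_forall (hC · x))
  have h0 : ∀ k, edist (mulOp μ (m k) (hm k) f) (mulOp μ w hw f) ^ 2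
      = ∫⁻ x, ‖m k x - w x‖ₑ ^ 2 * ‖f x‖ₑ ^ 2 ∂μ := fun k => by
    rw [edist_eq_enorm_sub, Lp.enorm_sq_eq_lintegral]
    refine lintegral_congr_ae ?_
    filter_upwards [coeFn_mulOp (hm k) f, coeFn_mulOp hw f,
      Lp.coeFn_sub (mulOp μ (m k) (hm k) f) (mulOp μ w hw f)] with x h1 h2 h3
    rw [h3, Pi.sub_apply, h1, h2, ← sub_mul, enorm_mul, mul_pow]
  have h1 : Tendsto (fun k => ∫⁻ x, ‖m k x - w x‖ₑ ^ 2 * ‖f x‖ₑ ^ 2 ∂μ) atTop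
      (𝓝 (∫⁻ _, 0 ∂μ)) := by
    refine tendsto_lintegral_of_dominated_convergence'
      (fun x => ENNReal.ofReal (C + C) ^ 2 * ‖f x‖ₑ ^ 2) (fun k => ?_)
      (fun k => Eventually.of_forall fun x => ?_) ?_ (Eventually.of_forall fun x => ?_)
    · exact (((hm k).measurable.sub hw.measurable).enorm.pow_const 2).aemeasurable.mul
        ((Lp.aestronglyMeasurable f).enorm.pow_const 2)
    · dsimp only
      gcongr
      rw [← ofReal_norm]
      exact ENNReal.ofReal_le_ofReal ((norm_sub_le _ _).trans (add_le_add (hC k x) (hwC x)))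
    · rw [lintegral_const_mul' _ _ (by finiteness), ← Lp.enorm_sq_eq_lintegral]
      finiteness
    · have : Tendsto (fun k => ‖m k x - w x‖ₑ ^ 2 * ‖f x‖ₑ ^ 2) atTop
          (𝓝 (‖w x - w x‖ₑ ^ 2 * ‖f x‖ₑ ^ 2)) := by
        refine ENNReal.Tendsto.mul_const ?_ (Or.inr (by finiteness))
        exact (ENNReal.continuous_pow 2).continuousAt.tendsto.comp
          (continuous_enorm.continuousAt.tendsto.comp ((hlim x).sub_const (w x)))
      simpa using this
  simp_rw [← h0, lintegral_zero] at h1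
  have h2 := (ENNReal.continuous_rpow_const (y := 1 / 2)).continuousAt.tendsto.comp h1
  rw [ENNReal.zero_rpow_of_pos (by norm_num)] at h2
  refine h2.congr fun k => ?_
  simp only [Function.comp_apply]
  rw [← ENNReal.rpow_natCast, ← ENNReal.rpow_mul]
  norm_num

theorem bddMeas_const {X : Type*} [MeasurableSpace X] (c : ℂ) : BddMeas fun _ : X => c :=
  ⟨measurable_const, ‖c‖, fun _ => le_rfl⟩

theorem mulOp_const {X : Type*} [MeasurableSpace X] {μ : Measure X} (c : ℂ) (f : Lp ℂ 2 μ) :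
    mulOp μ _ (bddMeas_const c) f = c • f := by
  refine Lp.ext ?_
  filter_upwards [coeFn_mulOp (bddMeas_const c) f, Lp.coeFn_smul c f] with x h1 h2
  rw [h1, h2, Pi.smul_apply, smul_eq_mul]

theorem tendsto_scale {E : Type*} [NormedAddCommGroup E] [NormedSpace ℝ E] (x : E) :
    Tendsto (fun k : ℕ => (1 / ((k : ℝ) + 1)) • x) atTop (𝓝 0) := by
  simpa using (tendsto_one_div_add_atTop_nhds_zero_nat (𝕜 := ℝ)).smul_const x

variable (E : Type*) [NormedAddCommGroup E] [InnerProductSpace ℝ E] [FiniteDimensional ℝ E]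

/-- A smooth compactly supported function which is `1` near the origin. -/
def bump : ContDiffBump (0 : E) := ⟨1, 2, one_pos, one_lt_two⟩

/-- The rescaled cutoff functions `x ↦ bump (x / (k + 1))`. -/
def cutoff (k : ℕ) (x : E) : ℝ := bump E ((1 / ((k : ℝ) + 1)) • x)

theorem contDiff_cutoff (k : ℕ) : ContDiff ℝ ∞ (cutoff E k) :=
  (bump E).contDiff.comp (contDiff_const_smul _)

theorem hasCompactSupport_cutoff (k : ℕ) : HasCompactSupport (cutoff E k) :=
  (bump E).hasCompactSupport.comp_smul (by positivity)

theorem norm_cutoff_le (k : ℕ) (x : E) : ‖cutoff E k x‖ ≤ 1 := by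
  rw [cutoff, Real.norm_of_nonneg (bump E).nonneg]
  exact (bump E).le_one

theorem tendsto_cutoff (x : E) : Tendsto (fun k => cutoff E k x) atTop (𝓝 1) := by
  have h := (bump E).continuous.continuousAt.tendsto.comp (tendsto_scale x)
  rwa [(bump E).one_of_mem_closedBall (by simp [bump])] at h

/-- The factor 1/(k + 1) is what makes every commutator with a cutoff disappear in the limit. -/
theorem fderiv_cutoff (k : ℕ) (x v : E) :
    fderiv ℝ (cutoff E k) x v
      = 1 / ((k : ℝ) + 1) * fderiv ℝ (bump E) ((1 / ((k : ℝ) + 1)) • x) v := by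
  have h := ((bump E).contDiff (n := 1)).differentiable one_ne_zero
    ((1 / ((k : ℝ) + 1)) • x)
  have h2 := h.hasFDerivAt.comp x ((hasFDerivAt_id x).const_smul (1 / ((k : ℝ) + 1)))
  have h3 : fderiv ℝ (cutoff E k) x = _ := h2.fderiv
  rw [h3]
  simp

theorem exists_norm_fderiv_bump_le (v : E) : ∃ C : ℝ, 0 ≤ C ∧ ∀ x, ‖fderiv ℝ (bump E) x v‖ ≤ C := by
  have hc : Continuous fun x => fderiv ℝ (bump E) x v :=
    (((bump E).contDiff (n := 1)).continuous_fderiv one_ne_zero).clm_apply continuous_const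
  have hs : HasCompactSupport fun x => fderiv ℝ (bump E) x v :=
    ((bump E).hasCompactSupport.fderiv ℝ).comp_left (g := fun L : E →L[ℝ] ℝ => L v) rfl
  obtain ⟨C, hC⟩ := hs.exists_bound_of_continuous hc
  exact ⟨C, (norm_nonneg _).trans (hC 0), hC⟩

theorem exists_norm_fderiv_cutoff_le (v : E) :
    ∃ C : ℝ, ∀ k x, ‖fderiv ℝ (cutoff E k) x v‖ ≤ C := by
  obtain ⟨C, h0, hC⟩ := exists_norm_fderiv_bump_le E v
  refine ⟨C, fun k x => ?_⟩
  rw [fderiv_cutoff, norm_mul]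
  have h1 : ‖1 / ((k : ℝ) + 1)‖ ≤ 1 := by
    rw [Real.norm_of_nonneg (by positivity), div_le_one (by positivity)]
    linarith [(Nat.cast_nonneg k : (0 : ℝ) ≤ k)]
  exact (mul_le_of_le_one_left (norm_nonneg _) h1).trans (hC _)

theorem tendsto_fderiv_cutoff (x v : E) :
    Tendsto (fun k => fderiv ℝ (cutoff E k) x v) atTop (𝓝 0) := by
  obtain ⟨C, h0, hC⟩ := exists_norm_fderiv_bump_le E v
  simp_rw [fderiv_cutoff]
  have h1 := (tendsto_one_div_add_atTop_nhds_zero_nat (𝕜 := ℝ)).mul_const C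
  rw [zero_mul] at h1
  refine squeeze_zero_norm (fun k => ?_) h1
  rw [norm_mul, Real.norm_of_nonneg (by positivity : (0 : ℝ) ≤ 1 / ((k : ℝ) + 1))]
  gcongr
  exact hC _

theorem bddMeas_cutoff [MeasurableSpace E] [BorelSpace E] (k : ℕ) :
    BddMeas fun x => (cutoff E k x : ℂ) :=
  ⟨(Complex.continuous_ofReal.comp (contDiff_cutoff E k).continuous).measurable, 1, fun x => by
    simpa using norm_cutoff_le E k x⟩

theorem bddMeas_fderiv_cutoff [MeasurableSpace E] [BorelSpace E] (k : ℕ) (v : E) :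
    BddMeas fun x => (fderiv ℝ (cutoff E k) x v : ℂ) :=
  ⟨(Complex.continuous_ofReal.comp
    (((contDiff_cutoff E k).continuous_fderiv (by simp)).clm_apply continuous_const)).measurable,
    (exists_norm_fderiv_cutoff_le E v).choose, fun x => by
    simpa using (exists_norm_fderiv_cutoff_le E v).choose_spec k x⟩

theorem tendsto_mulOp_cutoff [MeasurableSpace E] [BorelSpace E] {μ : Measure E} (f : Lp ℂ 2 μ) :
    Tendsto (fun k => mulOp μ _ (bddMeas_cutoff E k) f) atTop (𝓝 f) := by
  have := tendsto_mulOp (C := 1) (bddMeas_cutoff E) (bddMeas_const 1)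
    (fun k x => by simpa using norm_cutoff_le E k x)
    (fun x => by exact_mod_cast (Complex.continuous_ofReal.tendsto _).comp (tendsto_cutoff E x)) f
  simpa [mulOp_const] using this

theorem tendsto_mulOp_fderiv_cutoff [MeasurableSpace E] [BorelSpace E] {μ : Measure E} (v : E)
    (f : Lp ℂ 2 μ) :
    Tendsto (fun k => mulOp μ _ (bddMeas_fderiv_cutoff E k v) f) atTop (𝓝 0) := by
  obtain ⟨C, hC⟩ := exists_norm_fderiv_cutoff_le E v
  have := tendsto_mulOp (C := C) (fun k => bddMeas_fderiv_cutoff E k v) (bddMeas_const 0)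
    (fun k x => by simpa using hC k x)
    (fun x => by
      exact_mod_cast (Complex.continuous_ofReal.tendsto _).comp (tendsto_fderiv_cutoff E x v)) f
  simpa [mulOp_const] using this

end Cutoff

end

noncomputable section

/-! ### Hermite functions -/

section Hermite

open Polynomial

/-- The Hermite polynomials, normalized for the weight `exp (-y²)`. -/
def hermPoly : ℕ → ℝ[X]
  | 0 => C (√(√Real.pi))⁻¹
  | n + 1 => C (√(2 * (n + 1)))⁻¹ * (2 * X * hermPoly n - derivative (hermPoly n))

theorem sqrt_two_mul_succ_pos (n : ℕ) : 0 < √(2 * ((n : ℝ) + 1)) := by positivity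

/-- This is Hₙ₊₁' = 2(n + 1)Hₙ in the chosen normalisation. It is equivalent to the same identity
for the unnormalised bracket in the recursion (`key`), which is proved by induction. -/
theorem derivative_hermPoly_succ (n : ℕ) :
    derivative (hermPoly (n + 1)) = C √(2 * (n + 1)) * hermPoly n := by
  have key : ∀ n : ℕ, derivative (2 * X * hermPoly n - derivative (hermPoly n))
      = C (2 * ((n : ℝ) + 1)) * hermPoly n → derivative (hermPoly (n + 1))
      = C √(2 * (n + 1)) * hermPoly n := fun n h => by
    rw [hermPoly, derivative_C_mul, h, ← mul_assoc, ← C_mul]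
    congr 2
    rw [inv_mul_eq_div, Real.div_sqrt]
  induction n with
  | zero =>
    refine key 0 ?_
    simp [hermPoly]
    rw [show (2 : ℝ[X]) = C 2 from rfl]
    simp
  | succ n ih =>
    refine key (n + 1) ?_
    have h2 : 2 * X * hermPoly n - derivative (hermPoly n)
        = C √(2 * (n + 1)) * hermPoly (n + 1) := by
      rw [hermPoly, ← mul_assoc, ← C_mul, mul_inv_cancel₀ (sqrt_two_mul_succ_pos n).ne', C_1,
        one_mul]
    have h3 : derivative (derivative (hermPoly (n + 1)))
        = C √(2 * (n + 1)) * derivative (hermPoly n) := by rw [ih, derivative_C_mul]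
    have h4 : C (√(2 * ((n : ℝ) + 1))) * C (√(2 * ((n : ℝ) + 1))) = C (2 * ((n : ℝ) + 1)) := by
      rw [← C_mul, Real.mul_self_sqrt (by positivity)]
    have h5 : C (2 * (((n + 1 : ℕ) : ℝ) + 1)) = C (2 * ((n : ℝ) + 1)) + 2 := by
      rw [show (2 : ℝ[X]) = C 2 from rfl, ← C_add]
      congr 1
      push_cast
      ring
    rw [derivative_sub, derivative_mul, h3, ih, h5, ← h4]
    have h6 : derivative (2 * X : ℝ[X]) = 2 := by
      rw [show (2 : ℝ[X]) = C 2 from rfl]; simp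
    rw [h6]
    linear_combination C √(2 * ((n : ℝ) + 1)) * h2

/-- The Hermite functions on `ℝ`, orthonormal eigenfunctions of `(c t)² - c⁻² ∂ₜ²`. -/
def hermFn (c : ℝ) (n : ℕ) (t : ℝ) : ℝ :=
  √c * (hermPoly n).eval (c * t) * Real.exp (-(c * t) ^ 2 / 2)

variable {c : ℝ}

theorem contDiff_hermFn (c : ℝ) (n : ℕ) : ContDiff ℝ ∞ (hermFn c n) := by
  have h : ContDiff ℝ ∞ fun t : ℝ => (hermPoly n).eval t := by
    simpa using (hermPoly n).contDiff_aeval (R := ℝ) (𝕜 := ℝ) ∞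
  unfold hermFn
  have h2 : ContDiff ℝ ∞ fun t : ℝ => (hermPoly n).eval (c * t) :=
    h.comp (contDiff_const.mul contDiff_id)
  fun_prop

theorem continuous_hermFn (c : ℝ) (n : ℕ) : Continuous (hermFn c n) :=
  (contDiff_hermFn c n).continuous

theorem hasDerivAt_hermFn (c : ℝ) (n : ℕ) (t : ℝ) :
    HasDerivAt (hermFn c n) (c * (√c * ((derivative (hermPoly n)).eval (c * t)
      - c * t * (hermPoly n).eval (c * t)) * Real.exp (-(c * t) ^ 2 / 2))) t := by
  have h0 : HasDerivAt (fun t : ℝ => c * t) c t := by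
    simpa using (hasDerivAt_id t).const_mul c
  have h1 : HasDerivAt (fun t : ℝ => (hermPoly n).eval (c * t))
      ((derivative (hermPoly n)).eval (c * t) * c) t :=
    ((hermPoly n).hasDerivAt (c * t)).comp t h0
  have h2 : HasDerivAt (fun t : ℝ => -(c * t) ^ 2 / 2) (-(2 * (c * t) * c) / 2) t := by
    simpa using ((h0.pow 2).neg).div_const 2
  refine ((h1.const_mul √c).mul h2.exp).congr_deriv ?_
  ring

theorem deriv_hermFn (c : ℝ) (n : ℕ) (t : ℝ) :
    deriv (hermFn c n) t = c * (√c * ((derivative (hermPoly n)).eval (c * t)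
      - c * t * (hermPoly n).eval (c * t)) * Real.exp (-(c * t) ^ 2 / 2)) :=
  (hasDerivAt_hermFn c n t).deriv

theorem hermFn_creation (hc : 0 < c) (n : ℕ) (t : ℝ) :
    √(2 * (n + 1)) * hermFn c (n + 1) t = c * t * hermFn c n t - deriv (hermFn c n) t / c := by
  rw [deriv_hermFn, mul_div_cancel_left₀ _ hc.ne', hermFn, hermFn, hermPoly]
  have h : √(2 * ((n : ℝ) + 1)) * (√(2 * ((n : ℝ) + 1)))⁻¹ = 1 :=
    mul_inv_cancel₀ (sqrt_two_mul_succ_pos n).ne'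
  simp only [eval_mul, eval_C, eval_sub, eval_ofNat, eval_X]
  linear_combination (√c * (2 * (c * t) * (hermPoly n).eval (c * t)
    - (derivative (hermPoly n)).eval (c * t)) * Real.exp (-(c * t) ^ 2 / 2)) * h

/-- At n = 0 the index `n - 1` is 0, which is harmless because its coefficient √(2n) vanishes; the
same convention is used in every ladder relation below. -/
theorem hermFn_annihilation (hc : 0 < c) (n : ℕ) (t : ℝ) :
    √(2 * n) * hermFn c (n - 1) t = c * t * hermFn c n t + deriv (hermFn c n) t / c := by
  rw [deriv_hermFn, mul_div_cancel_left₀ _ hc.ne']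
  cases n with
  | zero => simp [hermFn, hermPoly]; ring
  | succ n =>
    rw [derivative_hermPoly_succ]
    simp only [hermFn, eval_mul, eval_C, Nat.add_sub_cancel]
    push_cast
    ring

theorem mul_hermFn (hc : 0 < c) (n : ℕ) (t : ℝ) :
    c * t * hermFn c n t
      = (√(2 * n) * hermFn c (n - 1) t + √(2 * (n + 1)) * hermFn c (n + 1) t) / 2 := by
  rw [hermFn_creation hc, hermFn_annihilation hc]
  ring

theorem deriv_hermFn_eq (hc : 0 < c) (n : ℕ) (t : ℝ) :
    deriv (hermFn c n) t
      = c * (√(2 * n) * hermFn c (n - 1) t - √(2 * (n + 1)) * hermFn c (n + 1) t) / 2 := by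
  rw [hermFn_creation hc, hermFn_annihilation hc]
  field_simp
  ring

theorem integrable_eval_mul_gaussian (p : ℝ[X]) {a : ℝ} (ha : 0 < a) :
    Integrable fun t : ℝ => p.eval t * Real.exp (-a * t ^ 2) := by
  induction p using Polynomial.induction_on' with
  | add p q hp hq =>
    refine (hp.add hq).congr (Eventually.of_forall fun t => ?_)
    simp [add_mul]
  | monomial n r =>
    have h := (integrable_rpow_mul_exp_neg_mul_sq ha
      (s := n) (by linarith [(Nat.cast_nonneg n : (0 : ℝ) ≤ n)])).const_mul r
    refine h.congr (Eventually.of_forall fun t => ?_)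
    simp [mul_assoc]

theorem integrable_hermFn (hc : 0 < c) (n : ℕ) : Integrable (hermFn c n) := by
  refine ((integrable_eval_mul_gaussian ((hermPoly n).comp (C c * X))
    (a := c ^ 2 / 2) (by positivity)).const_mul √c).congr (Eventually.of_forall fun t => ?_)
  simp only [eval_comp, eval_mul, eval_C, eval_X, hermFn]
  rw [mul_assoc]
  congr 3
  ring

theorem integrable_hermFn_mul_hermFn (hc : 0 < c) (m n : ℕ) :
    Integrable fun t => hermFn c m t * hermFn c n t := by
  refine ((integrable_eval_mul_gaussian ((hermPoly m).comp (C c * X) * (hermPoly n).comp (C c * X))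
    (a := c ^ 2) (by positivity)).const_mul c).congr (Eventually.of_forall fun t => ?_)
  simp only [eval_comp, eval_mul, eval_C, eval_X, hermFn]
  rw [show -c ^ 2 * t ^ 2 = -(c * t) ^ 2 / 2 + -(c * t) ^ 2 / 2 by ring, Real.exp_add]
  nth_rw 1 [← Real.mul_self_sqrt hc.le]
  ring

theorem integral_hermFn_zero_sq (hc : 0 < c) : ∫ t, hermFn c 0 t * hermFn c 0 t = 1 := by
  have h : ∀ t, hermFn c 0 t * hermFn c 0 t = c * (√Real.pi)⁻¹ * Real.exp (-c ^ 2 * t ^ 2) := by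
    intro t
    simp only [hermFn, hermPoly, eval_C]
    rw [show -c ^ 2 * t ^ 2 = -(c * t) ^ 2 / 2 + -(c * t) ^ 2 / 2 by ring, Real.exp_add]
    have h1 := Real.mul_self_sqrt hc.le
    have h2 : (√√Real.pi)⁻¹ * (√√Real.pi)⁻¹ = (√Real.pi)⁻¹ := by
      rw [← mul_inv, Real.mul_self_sqrt (Real.sqrt_nonneg _)]
    rw [← h2]
    linear_combination ((√√Real.pi)⁻¹ ^ 2 * Real.exp (-(c * t) ^ 2 / 2) ^ 2) * h1
  simp_rw [h]
  rw [integral_const_mul, integral_gaussian, Real.sqrt_div Real.pi_pos.le, Real.sqrt_sq hc.le]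
  have : √Real.pi ≠ 0 := by positivity
  field_simp

/-- Creation and annihilation operators are adjoint to each other: the derivative changes sign under
integration by parts. Orthonormality then follows by lowering both indices down to the Gaussian. -/
theorem integral_hermFn_mul_succ (hc : 0 < c) (m n : ℕ) :
    √(2 * (n + 1)) * ∫ t, hermFn c m t * hermFn c (n + 1) t
      = √(2 * m) * ∫ t, hermFn c (m - 1) t * hermFn c n t := by
  have hI := integrable_hermFn_mul_hermFn hc
  have h1 : ∀ m n, Integrable fun t => hermFn c m t * deriv (hermFn c n) t := by
    intro m n
    refine ((((hI m (n - 1)).const_mul √(2 * n)).sub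
      ((hI m (n + 1)).const_mul √(2 * (n + 1)))).const_mul (c / 2)).congr
        (Eventually.of_forall fun t => ?_)
    simp only [deriv_hermFn_eq hc, Pi.sub_apply]
    ring
  have h1' : ∀ m n, Integrable fun t => deriv (hermFn c m) t * hermFn c n t := by
    intro m n
    simpa only [mul_comm] using h1 n m
  have h2 : ∀ m n, Integrable fun t => c * t * (hermFn c m t * hermFn c n t) := by
    intro m n
    refine ((((hI m (n - 1)).const_mul √(2 * n)).add
      ((hI m (n + 1)).const_mul √(2 * (n + 1)))).const_mul (1 / 2)).congr
        (Eventually.of_forall fun t => ?_)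
    have := mul_hermFn hc n t
    simp only [Pi.add_apply]
    linear_combination -hermFn c m t * this
  have hd : ∀ n t, HasDerivAt (hermFn c n) (deriv (hermFn c n) t) t := fun n t =>
    (hasDerivAt_hermFn c n t).differentiableAt.hasDerivAt
  have hp := integral_mul_deriv_eq_deriv_mul_of_integrable (u := hermFn c m) (v := hermFn c n)
    (u' := deriv (hermFn c m)) (v' := deriv (hermFn c n)) (fun t _ => hd m t) (fun t _ => hd n t)
    (h1 m n) (h1' m n) (hI m n)
  calc √(2 * (n + 1)) * ∫ t, hermFn c m t * hermFn c (n + 1) t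
      = ∫ t, (c * t * (hermFn c m t * hermFn c n t)
        - hermFn c m t * deriv (hermFn c n) t / c) := by
        rw [← integral_const_mul]
        refine integral_congr_ae (Eventually.of_forall fun t => ?_)
        have := hermFn_creation hc n t
        simp only
        linear_combination hermFn c m t * this
    _ = ∫ t, (c * t * (hermFn c m t * hermFn c n t)
        + deriv (hermFn c m) t * hermFn c n t / c) := by
        rw [integral_sub (h2 m n) ((h1 m n).div_const c),
          integral_add (h2 m n) ((h1' m n).div_const c), integral_div, integral_div, hp]
        ring
    _ = √(2 * m) * ∫ t, hermFn c (m - 1) t * hermFn c n t := by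
        rw [← integral_const_mul]
        refine integral_congr_ae (Eventually.of_forall fun t => ?_)
        have := hermFn_annihilation hc m t
        simp only
        linear_combination -hermFn c n t * this

theorem integral_hermFn_mul (hc : 0 < c) (m n : ℕ) :
    ∫ t, hermFn c m t * hermFn c n t = if m = n then 1 else 0 := by
  induction n generalizing m with
  | zero =>
    cases m with
    | zero => simpa using integral_hermFn_zero_sq hc
    | succ m =>
      have h := integral_hermFn_mul_succ hc 0 m
      simp only [CharP.cast_eq_zero, mul_zero, Real.sqrt_zero, zero_mul] at h
      have h2 := (mul_eq_zero.1 h).resolve_left (sqrt_two_mul_succ_pos m).ne'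
      simpa [mul_comm] using h2
  | succ n ih =>
    have h := integral_hermFn_mul_succ hc m n
    rw [ih] at h
    refine mul_left_cancel₀ (sqrt_two_mul_succ_pos n).ne' (h.trans ?_)
    cases m with
    | zero => simp
    | succ m => by_cases hmn : m = n <;> simp [hmn]

theorem memLp_hermFn (hc : 0 < c) (n : ℕ) :
    MemLp (fun t => (hermFn c n t : ℂ)) 2 (volume : Measure ℝ) := by
  have hm : Continuous fun t => (hermFn c n t : ℂ) :=
    Complex.continuous_ofReal.comp (continuous_hermFn c n)
  refine (memLp_two_iff_integrable_sq_norm hm.aestronglyMeasurable).2 ?_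
  refine (integrable_hermFn_mul_hermFn hc n n).congr (Eventually.of_forall fun t => ?_)
  simp [pow_two]

/-- The Hermite functions as elements of `L²(ℝ)`. -/
def hermLp (hc : 0 < c) (n : ℕ) : Lp ℂ 2 (volume : Measure ℝ) := (memLp_hermFn hc n).toLp _

theorem coeFn_hermLp (hc : 0 < c) (n : ℕ) :
    hermLp hc n =ᵐ[volume] fun t => (hermFn c n t : ℂ) := (memLp_hermFn hc n).coeFn_toLp

theorem inner_hermLp (hc : 0 < c) (m n : ℕ) :
    inner ℂ (hermLp hc m) (hermLp hc n) = if m = n then 1 else 0 := by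
  rw [L2.inner_def]
  have h := congrArg (fun r : ℝ => (r : ℂ)) (integral_hermFn_mul hc m n)
  simp only [← integral_complex_ofReal] at h
  rw [show ((if m = n then (1 : ℝ) else 0 : ℝ) : ℂ) = if m = n then 1 else 0 by
    split_ifs <;> simp] at h
  rw [← h]
  refine integral_congr_ae ?_
  filter_upwards [coeFn_hermLp hc m, coeFn_hermLp hc n] with t h1 h2
  simp [h1, h2, RCLike.inner_apply, mul_comm]

end Hermite

end

/-! ### Diagonalisation: the Landau levels, their completeness and the kernel of their coefficients.
-/

noncomputable section

open scoped FourierTransform SchwartzMap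

/-! ### Coordinates -/

/-- The measure of `ℝ × (ℝ × ℝ)`. -/
abbrev prodVol : Measure (ℝ × (ℝ × ℝ)) :=
  (volume : Measure ℝ).prod (volume : Measure (ℝ × ℝ))

/-- Separation of the first coordinate of `ℝ³`. -/
def coords : R3 ≃L[ℝ] ℝ × (ℝ × ℝ) :=
  LinearEquiv.toContinuousLinearEquiv
    { toFun := fun x => (x 0, (x 1, x 2))
      invFun := fun p => !₂[p.1, p.2.1, p.2.2]
      left_inv := fun x => by ext i; fin_cases i <;> rfl
      right_inv := fun p => rfl
      map_add' := fun _ _ => rfl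
      map_smul' := fun _ _ => rfl }

@[simp] theorem coords_apply (x : R3) : coords x = (x 0, (x 1, x 2)) := rfl

@[simp] theorem coords_symm_zero (p : ℝ × (ℝ × ℝ)) : coords.symm p 0 = p.1 := rfl
@[simp] theorem coords_symm_one (p : ℝ × (ℝ × ℝ)) : coords.symm p 1 = p.2.1 := rfl
@[simp] theorem coords_symm_two (p : ℝ × (ℝ × ℝ)) : coords.symm p 2 = p.2.2 := rfl

theorem measurePreserving_coords : MeasurePreserving coords volume prodVol := by
  have h1 : MeasurePreserving (fun x : R3 => (x.ofLp : Fin 3 → ℝ)) volume volume :=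
    PiLp.volume_preserving_ofLp (Fin 3)
  have h2 := volume_preserving_piFinSuccAbove (fun _ : Fin 3 => ℝ) 0
  have h3 := (MeasurePreserving.id (volume : Measure ℝ)).prod (volume_preserving_finTwoArrow ℝ)
  exact h3.comp (h2.comp h1)

theorem measurePreserving_coords_symm : MeasurePreserving coords.symm prodVol volume :=
  measurePreserving_coords.symm coords.toHomeomorph.toMeasurableEquiv

theorem inner_R3 (x y : R3) : inner ℝ x y = x 0 * y 0 + x 1 * y 1 + x 2 * y 2 := by
  rw [PiLp.inner_apply, Fin.sum_univ_three]
  simp [mul_comm]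

/-! ### The spectral representation -/

/-- The phase `exp (-i θ(ξ))` with `θ(ξ) = -4 π² ξ₁ ξ₂ / b`. -/
def landauPhase (b : ℝ) (ξ : R3) : ℂ := Complex.exp ((4 * Real.pi ^ 2 / b * ξ 0 * ξ 1 : ℝ) * Complex.I)

theorem norm_landauPhase (b : ℝ) (ξ : R3) : ‖landauPhase b ξ‖ = 1 := Complex.norm_exp_ofReal_mul_I _

theorem contDiff_landauPhase (b : ℝ) : ContDiff ℝ ∞ (landauPhase b) := by
  unfold landauPhase
  have h : ContDiff ℝ ∞ fun ξ : R3 => ((4 * Real.pi ^ 2 / b * ξ 0 * ξ 1 : ℝ) : ℂ) :=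
    Complex.ofRealCLM.contDiff.comp (f := fun ξ : R3 => 4 * Real.pi ^ 2 / b * ξ 0 * ξ 1)
      (by fun_prop)
  fun_prop

theorem bddMeas_landauPhase (b : ℝ) : BddMeas (landauPhase b) :=
  ⟨(contDiff_landauPhase b).continuous.measurable, 1, fun ξ => (norm_landauPhase b ξ).le⟩

theorem bddMeas_conj_landauPhase (b : ℝ) : BddMeas fun ξ => conj (landauPhase b ξ) :=
  ⟨(Complex.continuous_conj.comp (contDiff_landauPhase b).continuous).measurable, 1, fun ξ => by
    simpa using (norm_landauPhase b ξ).le⟩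

theorem conj_landauPhase_mul (b : ℝ) (ξ : R3) : conj (landauPhase b ξ) * landauPhase b ξ = 1 := by
  rw [Complex.conj_mul', norm_landauPhase]; simp

/-- The inverse of the spectral transform of the Landau operator. -/
def landauU (b : ℝ) : Lp ℂ 2 prodVol →L[ℂ] L2R3 :=
  ((Lp.fourierTransformₗᵢ R3 ℂ).symm.toContinuousLinearEquiv : L2R3 →L[ℂ] L2R3) ∘L
    mulOp volume (landauPhase b) (bddMeas_landauPhase b) ∘L
    (Lp.compMeasurePreservingₗᵢ ℂ coords measurePreserving_coords).toContinuousLinearMap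

theorem landauU_apply (b : ℝ) (Φ : Lp ℂ 2 prodVol) :
    landauU b Φ = 𝓕⁻ (mulOp volume (landauPhase b) (bddMeas_landauPhase b)
      (Lp.compMeasurePreserving coords measurePreserving_coords Φ)) := rfl

theorem landauU_inv (b : ℝ) (f : L2R3) :
    landauU b (Lp.compMeasurePreserving coords.symm measurePreserving_coords_symm
      (mulOp volume _ (bddMeas_conj_landauPhase b) (𝓕 f))) = f := by
  rw [landauU_apply]
  have h : Lp.compMeasurePreserving coords measurePreserving_coords
      (Lp.compMeasurePreserving coords.symm measurePreserving_coords_symm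
      (mulOp volume _ (bddMeas_conj_landauPhase b) (𝓕 f)))
      = mulOp volume _ (bddMeas_conj_landauPhase b) (𝓕 f) := by
    refine Lp.ext ?_
    filter_upwards [Lp.coeFn_compMeasurePreserving (Lp.compMeasurePreserving coords.symm
      measurePreserving_coords_symm (mulOp volume _ (bddMeas_conj_landauPhase b) (𝓕 f)))
      measurePreserving_coords, measurePreserving_coords.quasiMeasurePreserving.ae
      (Lp.coeFn_compMeasurePreserving (mulOp volume _ (bddMeas_conj_landauPhase b) (𝓕 f))
      measurePreserving_coords_symm)] with x h1 h2
    rw [h1, Function.comp_apply, h2, Function.comp_apply, ContinuousLinearEquiv.symm_apply_apply]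
  rw [h, mulOp_mulOp _ _ (bddMeas_const 1) (fun x => by
    rw [mul_comm, conj_landauPhase_mul]), mulOp_const, one_smul]
  exact FourierTransform.fourierInv_fourier_eq f

theorem norm_landauU (b : ℝ) (Φ : Lp ℂ 2 prodVol) : ‖landauU b Φ‖ = ‖Φ‖ := by
  have h1 : ‖landauU b Φ‖ = ‖mulOp volume (landauPhase b) (bddMeas_landauPhase b)
      (Lp.compMeasurePreserving coords measurePreserving_coords Φ)‖ :=
    (Lp.fourierTransformₗᵢ R3 ℂ).symm.norm_map _
  rw [h1, ← Lp.norm_compMeasurePreserving Φ measurePreserving_coords]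
  have h2 : ∀ f : L2R3, ‖mulOp volume (landauPhase b) (bddMeas_landauPhase b) f‖ₑ ^ 2
      = ‖f‖ₑ ^ 2 := fun f => by
    rw [enorm_sq_mulOp, Lp.enorm_sq_eq_lintegral]
    refine lintegral_congr fun x => ?_
    rw [← ofReal_norm (landauPhase b x), norm_landauPhase]
    simp
  have h3 := (ENNReal.pow_right_strictMono two_ne_zero).injective
    (h2 (Lp.compMeasurePreserving coords measurePreserving_coords Φ))
  simpa using congrArg ENNReal.toReal h3

theorem inner_landauU (b : ℝ) (Φ Φ' : Lp ℂ 2 prodVol) :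
    inner ℂ (landauU b Φ) (landauU b Φ') = inner ℂ Φ Φ' :=
  (LinearMap.norm_map_iff_inner_map_map (landauU b)).1 (norm_landauU b) Φ Φ'

/-! ### Landau levels -/

/-- The inverse length scale of the Hermite functions in Fourier space. -/
def hermScale (b : ℝ) : ℝ := 2 * Real.pi / √b

theorem hermScale_pos {b : ℝ} (hb : 0 < b) : 0 < hermScale b := by
  unfold hermScale; positivity

variable {b : ℝ}

/-- The embedding of the `n`-th Landau level: `u ↦ U (h_n ⊗ u)`. -/
def landauS (hb : 0 < b) (n : ℕ) : Lp ℂ 2 (volume : Measure (ℝ × ℝ)) →L[ℂ] L2R3 :=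
  landauU b ∘L tensor volume volume (hermLp (hermScale_pos hb) n)

/-- The coefficients in the `n`-th Landau level. -/
def landauC (hb : 0 < b) (n : ℕ) : L2R3 →L[ℂ] Lp ℂ 2 (volume : Measure (ℝ × ℝ)) :=
  (landauS hb n).adjoint

theorem inner_landauC_right (hb : 0 < b) (n : ℕ) (u : Lp ℂ 2 (volume : Measure (ℝ × ℝ)))
    (f : L2R3) : inner ℂ u (landauC hb n f) = inner ℂ (landauS hb n u) f :=
  ContinuousLinearMap.adjoint_inner_right _ _ _

theorem inner_landauC_left (hb : 0 < b) (n : ℕ) (u : Lp ℂ 2 (volume : Measure (ℝ × ℝ)))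
    (f : L2R3) : inner ℂ (landauC hb n f) u = inner ℂ f (landauS hb n u) :=
  ContinuousLinearMap.adjoint_inner_left _ _ _

theorem inner_landauS (hb : 0 < b) (m n : ℕ) (u v : Lp ℂ 2 (volume : Measure (ℝ × ℝ))) :
    inner ℂ (landauS hb m u) (landauS hb n v) = if m = n then inner ℂ u v else 0 := by
  rw [landauS, landauS, ContinuousLinearMap.comp_apply, ContinuousLinearMap.comp_apply,
    inner_landauU, inner_tensor, inner_hermLp]
  split_ifs <;> simp

theorem landauC_landauS (hb : 0 < b) (m n : ℕ) (u : Lp ℂ 2 (volume : Measure (ℝ × ℝ))) :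
    landauC hb m (landauS hb n u) = if m = n then u else 0 := by
  refine ext_inner_left ℂ fun v => ?_
  rw [inner_landauC_right, inner_landauS]
  split_ifs <;> simp

theorem norm_landauS (hb : 0 < b) (n : ℕ) (u : Lp ℂ 2 (volume : Measure (ℝ × ℝ))) :
    ‖landauS hb n u‖ = ‖u‖ := by
  refine (LinearMap.norm_map_iff_inner_map_map (landauS hb n)).2 (fun u v => ?_) u
  simp [inner_landauS]

/-! ### Completeness of the Hermite functions -/

section Completeness

/-- The Gaussian absorbs the exponential growth; this function dominates the partial sums of the
series of exp(iat) times the Gaussian. -/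
theorem memLp_hermFn_exp {c : ℝ} (hc : 0 < c) (a : ℝ) :
    MemLp (fun t : ℝ => ((Real.exp (|a * t|) * hermFn c 0 t : ℝ) : ℂ)) 2 volume := by
  have hm : Continuous fun t : ℝ => ((Real.exp (|a * t|) * hermFn c 0 t : ℝ) : ℂ) :=
    Complex.continuous_ofReal.comp ((by fun_prop : Continuous fun t : ℝ =>
      Real.exp (|a * t|)).mul (continuous_hermFn c 0))
  refine (memLp_two_iff_integrable_sq_norm hm.aestronglyMeasurable).2 ?_
  have h1 := (integrable_exp_neg_mul_sq (b := c ^ 2 / 2) (by positivity)).const_mul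
    (Real.exp (a ^ 2 / c ^ 2) * (√c * (√√Real.pi)⁻¹)) |>.const_mul
    (Real.exp (a ^ 2 / c ^ 2) * (√c * (√√Real.pi)⁻¹))
  refine h1.mono' (hm.norm.pow 2).aestronglyMeasurable (Eventually.of_forall fun t => ?_)
  -- Completing the square with this weight spends only half of the Gaussian exponent c²t²/2, so
  -- decay is left over.
  have h2 : |a * t| ≤ a ^ 2 / c ^ 2 + c ^ 2 * t ^ 2 / 4 := by
    rw [abs_mul, ← sq_abs a, ← sq_abs t]
    have : 0 ≤ (|a| / c - c * |t| / 2) ^ 2 := sq_nonneg _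
    have h3 : (|a| / c - c * |t| / 2) ^ 2
        = |a| ^ 2 / c ^ 2 + c ^ 2 * |t| ^ 2 / 4 - |a| * |t| := by
      field_simp
      ring
    linarith
  have h4 : ‖((Real.exp (|a * t|) * hermFn c 0 t : ℝ) : ℂ)‖
      ≤ Real.exp (a ^ 2 / c ^ 2) * (√c * (√√Real.pi)⁻¹) * Real.exp (-(c ^ 2 / 4) * t ^ 2) := by
    rw [Complex.norm_real, norm_mul, Real.norm_of_nonneg (Real.exp_pos _).le, hermFn, hermPoly,
      Polynomial.eval_C, Real.norm_of_nonneg (by positivity)]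
    have h5 : Real.exp |a * t| * Real.exp (-(c * t) ^ 2 / 2)
        ≤ Real.exp (a ^ 2 / c ^ 2) * Real.exp (-(c ^ 2 / 4) * t ^ 2) := by
      rw [← Real.exp_add, ← Real.exp_add]
      refine Real.exp_le_exp.2 ?_
      nlinarith
    calc _ = (√c * (√√Real.pi)⁻¹) * (Real.exp |a * t| * Real.exp (-(c * t) ^ 2 / 2)) := by ring
      _ ≤ (√c * (√√Real.pi)⁻¹)
          * (Real.exp (a ^ 2 / c ^ 2) * Real.exp (-(c ^ 2 / 4) * t ^ 2)) := by gcongr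
      _ = _ := by ring
  rw [Real.norm_of_nonneg (by positivity)]
  refine (pow_le_pow_left₀ (norm_nonneg _) h4 2).trans (le_of_eq ?_)
  rw [mul_pow, pow_two (Real.exp (-(c ^ 2 / 4) * t ^ 2)), ← Real.exp_add]
  ring_nf

/-- `exp (z t) h_0(t)` as an element of `L²(ℝ)`, for purely imaginary `z = i s`. -/
def hermWave {c : ℝ} (hc : 0 < c) (s : ℝ) : Lp ℂ 2 (volume : Measure ℝ) :=
  mulOp volume (fun t => Complex.exp ((s * t : ℝ) * Complex.I))
    ⟨(by fun_prop : Continuous fun t : ℝ => Complex.exp ((s * t : ℝ) * Complex.I)).measurable, 1,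
      fun t => (Complex.norm_exp_ofReal_mul_I _).le⟩ (hermLp hc 0)

theorem coeFn_hermWave {c : ℝ} (hc : 0 < c) (s : ℝ) :
    hermWave hc s =ᵐ[volume] fun t => Complex.exp ((s * t : ℝ) * Complex.I) * hermFn c 0 t := by
  filter_upwards [coeFn_mulOp (μ := volume) (m := fun t => Complex.exp ((s * t : ℝ) * Complex.I))
    ⟨(by fun_prop : Continuous fun t : ℝ => Complex.exp ((s * t : ℝ) * Complex.I)).measurable, 1,
      fun t => (Complex.norm_exp_ofReal_mul_I _).le⟩ (hermLp hc 0), coeFn_hermLp hc 0] with t h1 h2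
  rw [← h2]
  exact h1

/-- Multiplication by ct couples only neighbouring Hermite functions, so the span is stable under
it. -/
theorem exists_mem_pow_mul_hermFn {c : ℝ} (hc : 0 < c) {G : Submodule ℂ (Lp ℂ 2 (volume : Measure ℝ))}
    (hG : ∀ n, hermLp hc n ∈ G) (k n : ℕ) :
    ∃ g ∈ G, g =ᵐ[volume] fun t => ((c * t) ^ k * hermFn c n t : ℂ) := by
  induction k generalizing n with
  | zero => exact ⟨_, hG n, by simpa using coeFn_hermLp hc n⟩
  | succ k ih =>
    obtain ⟨g1, hg1, h1⟩ := ih (n - 1)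
    obtain ⟨g2, hg2, h2⟩ := ih (n + 1)
    refine ⟨((√(2 * n) / 2 : ℝ) : ℂ) • g1 + ((√(2 * (n + 1)) / 2 : ℝ) : ℂ) • g2,
      G.add_mem (G.smul_mem _ hg1) (G.smul_mem _ hg2), ?_⟩
    filter_upwards [h1, h2, Lp.coeFn_add (((√(2 * n) / 2 : ℝ) : ℂ) • g1)
      (((√(2 * (n + 1)) / 2 : ℝ) : ℂ) • g2), Lp.coeFn_smul ((√(2 * n) / 2 : ℝ) : ℂ) g1,
      Lp.coeFn_smul ((√(2 * (n + 1)) / 2 : ℝ) : ℂ) g2] with t e1 e2 e3 e4 e5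
    rw [e3, Pi.add_apply, e4, e5, Pi.smul_apply, Pi.smul_apply, e1, e2]
    have h := congrArg (fun r : ℝ => (r : ℂ)) (mul_hermFn hc n t)
    push_cast at h ⊢
    rw [smul_eq_mul, smul_eq_mul]
    linear_combination -(c * t : ℂ) ^ k * h

/-- The Taylor polynomials of exp(ist) times the Gaussian are combinations of Hermite functions, and
they converge in L² to the wave. -/
theorem hermWave_mem {c : ℝ} (hc : 0 < c) {G : Submodule ℂ (Lp ℂ 2 (volume : Measure ℝ))}
    (hG : ∀ n, hermLp hc n ∈ G) (hcl : IsClosed (G : Set (Lp ℂ 2 (volume : Measure ℝ)))) (s : ℝ) :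
    hermWave hc s ∈ G := by
  -- The weight exp(-|st|) keeps the partial sums bounded by 1; the compensating factor exp(|st|) is
  -- put into the fixed L² function `f`, so `tendsto_mulOp` applies.
  let m : ℕ → ℝ → ℂ := fun N t =>
    (∑ k ∈ Finset.range N, ((s * t : ℝ) * Complex.I) ^ k / (k.factorial : ℂ))
      * (Real.exp (-|s * t|) : ℝ)
  have hm1 : ∀ N t, ‖m N t‖ ≤ 1 := fun N t => by
    have h1 : ‖∑ k ∈ Finset.range N, ((s * t : ℝ) * Complex.I) ^ k / (k.factorial : ℂ)‖
        ≤ Real.exp |s * t| := by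
      refine (norm_sum_le _ _).trans ?_
      refine le_trans (le_of_eq ?_) (Real.sum_le_exp_of_nonneg (abs_nonneg (s * t)) N)
      refine Finset.sum_congr rfl fun k _ => ?_
      rw [norm_div, norm_pow, norm_mul, Complex.norm_I, mul_one, Complex.norm_real,
        Complex.norm_natCast, Real.norm_eq_abs]
    rw [norm_mul, Complex.norm_real, Real.norm_of_nonneg (Real.exp_pos _).le, Real.exp_neg,
      ← div_eq_mul_inv, div_le_one (Real.exp_pos _)]
    exact h1
  have hm : ∀ N, BddMeas (m N) := fun N =>
    ⟨(by fun_prop : Continuous (m N)).measurable, 1, hm1 N⟩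
  let w : ℝ → ℂ := fun t => Complex.exp ((s * t : ℝ) * Complex.I) * (Real.exp (-|s * t|) : ℝ)
  have hlim : ∀ t, Tendsto (fun N => m N t) atTop (𝓝 (w t)) := fun t => by
    refine Tendsto.mul_const _ ?_
    rw [Complex.exp_eq_exp_ℂ]
    exact (NormedSpace.expSeries_div_hasSum_exp (((s * t : ℝ) : ℂ) * Complex.I)).tendsto_sum_nat
  have hw : BddMeas w := ⟨(by fun_prop : Continuous w).measurable, 1, fun t =>
    le_of_tendsto (hlim t).norm (Eventually.of_forall (hm1 · t))⟩
  set f : Lp ℂ 2 (volume : Measure ℝ) := (memLp_hermFn_exp hc s).toLp _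
  have hf : f =ᵐ[volume] fun t => ((Real.exp (|s * t|) * hermFn c 0 t : ℝ) : ℂ) :=
    (memLp_hermFn_exp hc s).coeFn_toLp
  have hexp : ∀ t, ((Real.exp (-|s * t|) : ℝ) : ℂ) * ((Real.exp (|s * t|) * hermFn c 0 t : ℝ) : ℂ)
      = hermFn c 0 t := fun t => by
    rw [← Complex.ofReal_mul, ← mul_assoc, ← Real.exp_add]; simp
  have e1 : mulOp volume w hw f = hermWave hc s := by
    refine Lp.ext ?_
    filter_upwards [coeFn_mulOp hw f, hf, coeFn_hermWave hc s] with t h1 h2 h3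
    rw [h1, h2, h3, mul_assoc, hexp]
  have e2 : ∀ N, mulOp volume (m N) (hm N) f ∈ G := fun N => by
    choose g hgG hg using fun k => exists_mem_pow_mul_hermFn hc hG k 0
    have : mulOp volume (m N) (hm N) f
        = ∑ k ∈ Finset.range N, (((s / c : ℝ) * Complex.I) ^ k / (k.factorial : ℂ)) • g k := by
      refine Lp.ext ?_
      have h5 : ∀ᵐ t, ∀ k, g k t = ((c * t) ^ k * hermFn c 0 t : ℂ) := ae_all_iff.2 hg
      have h6 : ∀ᵐ t, ∀ k, ((((s / c : ℝ) * Complex.I) ^ k / (k.factorial : ℂ)) • g k) t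
          = ((s / c : ℝ) * Complex.I) ^ k / (k.factorial : ℂ) * g k t :=
        ae_all_iff.2 fun k => Lp.coeFn_smul _ _
      filter_upwards [coeFn_mulOp (hm N) f, hf, h5, h6, Lp.coeFn_finsetSum (Finset.range N)
        fun k => (((s / c : ℝ) * Complex.I) ^ k / (k.factorial : ℂ)) • g k] with t h1 h2 h3 h4 h7
      rw [h1, h2, mul_assoc, hexp, h7, Finset.sum_mul, Finset.sum_apply]
      refine Finset.sum_congr rfl fun k _ => ?_
      have h8 : ((s * t : ℝ) : ℂ) * Complex.I = (s / c : ℝ) * Complex.I * (c * t) := by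
        have : (c : ℂ) ≠ 0 := by exact_mod_cast hc.ne'
        push_cast
        field_simp
      rw [h4, h3, h8, mul_pow]
      ring
    rw [this]
    exact G.sum_mem fun k _ => G.smul_mem _ (hgG k)
  rw [← e1]
  exact hcl.mem_of_tendsto (tendsto_mulOp hm hw hm1 hlim f) (Eventually.of_forall e2)

end Completeness

end

noncomputable section

open scoped FourierTransform SchwartzMap

/-! ### The Landau levels are complete -/

variable {b : ℝ}

theorem hermFn_zero_pos {c : ℝ} (hc : 0 < c) (t : ℝ) : 0 < hermFn c 0 t := by
  simp only [hermFn, hermPoly, Polynomial.eval_C]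
  positivity

/-- These inner products are the values of the Fourier transform of Φ times a Gaussian. That product
is integrable, hence zero almost everywhere, and the Gaussian has no zeros. -/
theorem eq_zero_of_inner_hermWave {c : ℝ} (hc : 0 < c) (Φ : Lp ℂ 2 prodVol)
    (h : ∀ s₀ s₁ s₂, inner ℂ (tensor volume volume (hermWave hc s₀)
      (tensor volume volume (hermWave hc s₁) (hermWave hc s₂))) Φ = 0) : Φ = 0 := by
  let W : ℝ → ℝ → ℝ → Lp ℂ 2 prodVol := fun s₀ s₁ s₂ =>
    tensor volume volume (hermWave hc s₀) (tensor volume volume (hermWave hc s₁) (hermWave hc s₂))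
  have hW : ∀ s₀ s₁ s₂, ∀ᵐ x : R3, inner ℂ (W s₀ s₁ s₂ (coords x)) (Φ (coords x))
      = Complex.exp (((-(s₀ * x 0 + s₁ * x 1 + s₂ * x 2) : ℝ) : ℂ) * Complex.I)
        * ((hermFn c 0 (x 0) * hermFn c 0 (x 1) * hermFn c 0 (x 2) : ℝ) * Φ (coords x)) := by
    intro s₀ s₁ s₂
    have h1 : ∀ᵐ p ∂prodVol, W s₀ s₁ s₂ p
        = (Complex.exp ((s₀ * p.1 : ℝ) * Complex.I) * hermFn c 0 p.1)
          * ((Complex.exp ((s₁ * p.2.1 : ℝ) * Complex.I) * hermFn c 0 p.2.1)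
          * (Complex.exp ((s₂ * p.2.2 : ℝ) * Complex.I) * hermFn c 0 p.2.2)) := by
      have e2 : ∀ᵐ q : ℝ × ℝ, tensor volume volume (hermWave hc s₁) (hermWave hc s₂) q
          = (Complex.exp ((s₁ * q.1 : ℝ) * Complex.I) * hermFn c 0 q.1)
          * (Complex.exp ((s₂ * q.2 : ℝ) * Complex.I) * hermFn c 0 q.2) := by
        filter_upwards [coeFn_tensor (hermWave hc s₁) (hermWave hc s₂),
          Measure.quasiMeasurePreserving_fst.ae (coeFn_hermWave hc s₁),
          Measure.quasiMeasurePreserving_snd.ae (coeFn_hermWave hc s₂)] with q h1 h2 h3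
        rw [h1, h2, h3]
      filter_upwards [coeFn_tensor (hermWave hc s₀)
          (tensor volume volume (hermWave hc s₁) (hermWave hc s₂)),
          Measure.quasiMeasurePreserving_fst.ae (coeFn_hermWave hc s₀),
          Measure.quasiMeasurePreserving_snd.ae e2] with p h1 h2 h3
      rw [← h2, ← h3]
      exact h1
    filter_upwards [measurePreserving_coords.quasiMeasurePreserving.ae h1] with x hx
    rw [hx, RCLike.inner_apply]
    simp only [coords_apply, map_mul, Complex.conj_ofReal, ← Complex.exp_conj, Complex.conj_I]
    have e : Complex.exp (((-(s₀ * x 0 + s₁ * x 1 + s₂ * x 2) : ℝ) : ℂ) * Complex.I)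
        = Complex.exp ((s₀ * x 0 : ℝ) * -Complex.I) * (Complex.exp ((s₁ * x 1 : ℝ) * -Complex.I)
          * Complex.exp ((s₂ * x 2 : ℝ) * -Complex.I)) := by
      rw [← Complex.exp_add, ← Complex.exp_add]
      congr 1
      push_cast
      ring
    rw [e]
    push_cast
    ring
  let F : R3 → ℂ := fun x =>
    (hermFn c 0 (x 0) * hermFn c 0 (x 1) * hermFn c 0 (x 2) : ℝ) * Φ (coords x)
  have hemb : MeasurableEmbedding coords := coords.toHomeomorph.measurableEmbedding
  have hF : Integrable F := by
    have h1 : Integrable (fun x => inner ℂ (W 0 0 0 (coords x)) (Φ (coords x))) :=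
      (measurePreserving_coords.integrable_comp_emb hemb).2 (L2.integrable_inner (W 0 0 0) Φ)
    refine h1.congr ?_
    filter_upwards [hW 0 0 0] with x hx
    rw [hx]
    simp [F]
  have hF0 : F =ᵐ[volume] 0 := by
    refine ae_eq_zero_of_fourier_eq_zero hF fun ξ => ?_
    have h2 := h (2 * Real.pi * ξ 0) (2 * Real.pi * ξ 1) (2 * Real.pi * ξ 2)
    rw [L2.inner_def, ← measurePreserving_coords.integral_comp hemb] at h2
    rw [Real.fourier_eq', ← h2]
    refine integral_congr_ae ?_
    filter_upwards [hW (2 * Real.pi * ξ 0) (2 * Real.pi * ξ 1) (2 * Real.pi * ξ 2)] with x hx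
    refine Eq.trans ?_ hx.symm
    rw [smul_eq_mul, inner_R3]
    congr 4
    ring
  refine Lp.ext ?_
  have h3 : ∀ᵐ p ∂prodVol, F (coords.symm p) = 0 :=
    measurePreserving_coords_symm.quasiMeasurePreserving.ae hF0
  filter_upwards [h3, Lp.coeFn_zero ℂ 2 prodVol] with p hp h0
  rw [h0]
  simp only [F, ContinuousLinearEquiv.apply_symm_apply, mul_eq_zero] at hp
  refine hp.resolve_left ?_
  have h1 := hermFn_zero_pos hc (coords.symm p 0)
  have h2 := hermFn_zero_pos hc (coords.symm p 1)
  have h3 := hermFn_zero_pos hc (coords.symm p 2)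
  exact_mod_cast (mul_pos (mul_pos h1 h2) h3).ne'

/-- The functions g such that g ⊗ u is orthogonal to Φ for all u form a closed subspace. It contains
the Hermite functions, hence all waves; the other two tensor factors are arbitrary, so they may be
taken to be waves too. -/
theorem eq_zero_of_landauC (hb : 0 < b) (f : L2R3) (h : ∀ n, landauC hb n f = 0) : f = 0 := by
  obtain ⟨Φ, rfl⟩ : ∃ Φ, landauU b Φ = f := ⟨_, landauU_inv b f⟩
  have h1 : ∀ n u, inner ℂ (tensor volume volume (hermLp (hermScale_pos hb) n) u) Φ = 0 := by
    intro n u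
    rw [← inner_landauU b]
    have := inner_landauC_right hb n u (landauU b Φ)
    rw [h n, inner_zero_right] at this
    exact this.symm
  let G : Submodule ℂ (Lp ℂ 2 (volume : Measure ℝ)) :=
    { carrier := {g | ∀ u, inner ℂ (tensor volume (volume : Measure (ℝ × ℝ)) g u) Φ = 0}
      add_mem' := fun {f g} hf hg u => by
        rw [map_add, add_apply, inner_add_left, hf u, hg u, add_zero]
      zero_mem' := fun u => by simp
      smul_mem' := fun c g hg u => by
        rw [map_smul, smul_apply, inner_smul_left, hg u, mul_zero] }
  have hcl : IsClosed (G : Set (Lp ℂ 2 (volume : Measure ℝ))) := by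
    have : (G : Set (Lp ℂ 2 (volume : Measure ℝ)))
        = ⋂ u, {g | inner ℂ (tensor volume (volume : Measure (ℝ × ℝ)) g u) Φ = 0} := by
      ext g; simp [G]
    rw [this]
    refine isClosed_iInter fun u => isClosed_eq ?_ continuous_const
    fun_prop
  rw [eq_zero_of_inner_hermWave (hermScale_pos hb) Φ fun s₀ s₁ s₂ =>
    hermWave_mem (hermScale_pos hb) (G := G) (fun n u => h1 n u) hcl s₀ _, map_zero]

theorem landauC_injective (hb : 0 < b) {f g : L2R3} (h : ∀ n, landauC hb n f = landauC hb n g) :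
    f = g :=
  sub_eq_zero.1 (eq_zero_of_landauC hb _ fun n => by rw [map_sub, h, sub_self])

/-- The Landau levels as isometric embeddings. -/
def landauIsometry (hb : 0 < b) (n : ℕ) :
    Lp ℂ 2 (volume : Measure (ℝ × ℝ)) →ₗᵢ[ℂ] L2R3 :=
  ⟨landauS hb n, norm_landauS hb n⟩

theorem isHilbertSum_landau (hb : 0 < b) :
    IsHilbertSum ℂ (fun _ : ℕ => Lp ℂ 2 (volume : Measure (ℝ × ℝ))) (landauIsometry hb) := by
  refine IsHilbertSum.mk (fun m n hmn u v => ?_) ?_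
  · exact (inner_landauS hb m n u v).trans (if_neg hmn)
  · refine le_of_eq (Eq.symm ?_)
    rw [Submodule.topologicalClosure_eq_top_iff, Submodule.eq_bot_iff]
    intro f hf
    refine eq_zero_of_landauC hb f fun n => ext_inner_left ℂ fun u => ?_
    rw [inner_landauC_right, inner_zero_right]
    refine (Submodule.mem_orthogonal _ f).1 hf _ (Submodule.mem_iSup_of_mem n ?_)
    exact ⟨u, rfl⟩

/-- Parseval for the Hilbert sum; the work is to identify `landauC` with the abstract components. -/
theorem hasSum_norm_landauC_sq (hb : 0 < b) (f : L2R3) :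
    HasSum (fun n => ‖landauC hb n f‖ ^ 2) (‖f‖ ^ 2) := by
  set c := (isHilbertSum_landau hb).linearIsometryEquiv f
  have hc : ∀ n, landauC hb n f = c n := fun n => by
    have h1 : f = (isHilbertSum_landau hb).linearIsometryEquiv.symm c := by simp [c]
    have h2 := (isHilbertSum_landau hb).hasSum_linearIsometryEquiv_symm c
    rw [← h1] at h2
    have h3 := h2.mapL (landauC hb n)
    have h4 : ∀ m, landauC hb n (landauIsometry hb m (c m)) = if m = n then c m else 0 := fun m => by
      refine (landauC_landauS hb n m (c m)).trans ?_
      simp only [eq_comm]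
    simp only [h4] at h3
    refine h3.unique ?_
    convert hasSum_ite_eq n (c n) using 2 with m
    split_ifs with h
    · rw [h]
    · rfl
  have h5 : ‖f‖ = ‖c‖ := ((isHilbertSum_landau hb).linearIsometryEquiv.norm_map f).symm
  simp_rw [hc, h5]
  have := lp.hasSum_norm (p := 2) (by norm_num) c
  simpa using this

theorem tsum_enorm_landauC_sq (hb : 0 < b) (f : L2R3) :
    ∑' n, ‖landauC hb n f‖ₑ ^ 2 = ‖f‖ₑ ^ 2 := by
  have h2 := hasSum_norm_landauC_sq hb f
  have h3 : ∀ {E : Type} [NormedAddCommGroup E] (z : E), ‖z‖ₑ ^ 2 = ENNReal.ofReal (‖z‖ ^ 2) :=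
    fun z => by rw [ENNReal.ofReal_pow (norm_nonneg _), ofReal_norm]
  simp_rw [h3]
  rw [← ENNReal.ofReal_tsum_of_nonneg (fun _ => by positivity) h2.summable, h2.tsum_eq]

/-! ### The integral kernel -/

/-- Both sides have the same integral over every set of finite measure: pair with h ⊗ 1ₛ and apply
Fubini. -/
theorem adjoint_tensor_ae_eq {X Y : Type*} [MeasurableSpace X] [MeasurableSpace Y] {μ : Measure X}
    {ν : Measure Y} [SigmaFinite μ] [SigmaFinite ν] (h : Lp ℂ 2 μ) (Φ : Lp ℂ 2 (μ.prod ν)) :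
    (tensor μ ν h).adjoint Φ =ᵐ[ν] fun y => ∫ x, conj (h x) * Φ (x, y) ∂μ := by
  have key : ∀ s (hs : MeasurableSet s) (hνs : ν s < ⊤),
      Integrable (fun p : X × Y => s.indicator (fun _ => conj (h p.1) * Φ p) p.2) (μ.prod ν) ∧
      ∫ p, s.indicator (fun _ => conj (h p.1) * Φ p) p.2 ∂(μ.prod ν)
        = inner ℂ (tensor μ ν h (indicatorConstLp 2 hs hνs.ne 1)) Φ := by
    intro s hs hνs
    have e : (fun p : X × Y => s.indicator (fun _ => conj (h p.1) * Φ p) p.2)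
        =ᵐ[μ.prod ν] fun p => inner ℂ (tensor μ ν h (indicatorConstLp 2 hs hνs.ne 1) p) (Φ p) := by
      filter_upwards [coeFn_tensor h (indicatorConstLp 2 hs hνs.ne (1 : ℂ)),
        Measure.quasiMeasurePreserving_snd.ae
          (indicatorConstLp_coeFn (p := 2) (hs := hs) (hμs := hνs.ne) (c := (1 : ℂ)))] with p h1 h2
      rw [h1, h2, RCLike.inner_apply]
      by_cases hp : p.2 ∈ s <;> simp [hp, mul_comm]
    exact ⟨(L2.integrable_inner _ Φ).congr e.symm, by rw [integral_congr_ae e, L2.inner_def]⟩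
  have hI : ∀ s, MeasurableSet s → ν s < ⊤ →
      IntegrableOn (fun y => ∫ x, conj (h x) * Φ (x, y) ∂μ) s ν ∧
      ∫ y in s, ∫ x, conj (h x) * Φ (x, y) ∂μ ∂ν
        = ∫ p, s.indicator (fun _ => conj (h p.1) * Φ p) p.2 ∂(μ.prod ν) := by
    intro s hs hνs
    have e : ∀ y, ∫ x, s.indicator (fun _ => conj (h x) * Φ (x, y)) y ∂μ
        = s.indicator (fun y => ∫ x, conj (h x) * Φ (x, y) ∂μ) y := fun y => by
      by_cases hy : y ∈ s <;> simp [hy]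
    have hi := (key s hs hνs).1
    refine ⟨?_, ?_⟩
    · rw [← integrable_indicator_iff hs]
      exact hi.integral_prod_right.congr (Eventually.of_forall e)
    · rw [integral_prod_symm _ hi, ← integral_indicator hs]
      exact integral_congr_ae (Eventually.of_forall fun y => (e y).symm)
  refine ae_eq_of_forall_setIntegral_eq_of_sigmaFinite (fun s hs hνs => ?_)
    (fun s hs hνs => (hI s hs hνs).1) (fun s hs hνs => ?_)
  · exact integrableOn_Lp_of_measure_ne_top _ (by norm_num) hνs.ne
  · rw [(hI s hs hνs).2, (key s hs hνs).2, ← ContinuousLinearMap.adjoint_inner_right,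
      L2.inner_indicatorConstLp_one]

/-- The Fourier transform of the Hermite functions. -/
def hermFourier (b : ℝ) (n : ℕ) : ℝ → ℂ := 𝓕 fun t : ℝ => (hermFn (hermScale b) n t : ℂ)

theorem integrable_ofReal_hermFn (hb : 0 < b) (n : ℕ) :
    Integrable fun t : ℝ => (hermFn (hermScale b) n t : ℂ) :=
  (integrable_hermFn (hermScale_pos hb) n).ofReal

theorem continuous_hermFourier (hb : 0 < b) (n : ℕ) : Continuous (hermFourier b n) :=
  VectorFourier.fourierIntegral_continuous Real.continuous_fourierChar continuous_inner
    (integrable_ofReal_hermFn hb n)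

/-- The integral kernel of the `n`-th Landau coefficients. -/
def landauKernel (b : ℝ) (n : ℕ) (y : ℝ × ℝ) (x : R3) : ℂ :=
  Complex.exp ((-(2 * Real.pi * (x 1 * y.1 + x 2 * y.2)) : ℝ) * Complex.I)
    * hermFourier b n (x 0 + 2 * Real.pi * y.1 / b)

theorem continuous_landauKernel (hb : 0 < b) (n : ℕ) :
    Continuous fun p : (ℝ × ℝ) × R3 => landauKernel b n p.1 p.2 := by
  unfold landauKernel
  have h := continuous_hermFourier hb n
  have h1 : Continuous fun p : (ℝ × ℝ) × R3 =>
      ((-(2 * Real.pi * (p.2 1 * p.1.1 + p.2 2 * p.1.2)) : ℝ) : ℂ) :=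
    Complex.continuous_ofReal.comp (by fun_prop)
  exact ((h1.mul continuous_const).cexp).mul (h.comp (by fun_prop))

theorem landauC_landauU (hb : 0 < b) (n : ℕ) (Φ : Lp ℂ 2 prodVol) :
    landauC hb n (landauU b Φ)
      = (tensor volume volume (hermLp (hermScale_pos hb) n)).adjoint Φ := by
  refine ext_inner_left ℂ fun u => ?_
  rw [inner_landauC_right, ContinuousLinearMap.adjoint_inner_right]
  exact inner_landauU b _ _

/-- For integrable f the Fourier integral is explicit, and Fubini lets the oscillator variable t be
integrated first. The phase turns into a shift of x₁ by 2πy₁/b, so what remains is the Fourier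
transform of a Hermite function. -/
theorem landauC_ae_eq (hb : 0 < b) (n : ℕ) (f : L2R3) (hf : Integrable f) :
    landauC hb n f =ᵐ[volume] fun y => ∫ x, landauKernel b n y x * f x := by
  set h := hermFn (hermScale b) n with hdef
  set Φ := Lp.compMeasurePreserving coords.symm measurePreserving_coords_symm
      (mulOp volume _ (bddMeas_conj_landauPhase b) (𝓕 f)) with hΦ
  have h0 : landauC hb n f = (tensor volume volume (hermLp (hermScale_pos hb) n)).adjoint Φ :=
    (congrArg (landauC hb n) (landauU_inv b f)).symm.trans (landauC_landauU hb n Φ)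
  rw [h0]
  have h1 : ∀ᵐ p ∂prodVol, Φ p = conj (landauPhase b (coords.symm p))
      * 𝓕 (f : R3 → ℂ) (coords.symm p) := by
    filter_upwards [Lp.coeFn_compMeasurePreserving
      (mulOp volume _ (bddMeas_conj_landauPhase b) (𝓕 f)) measurePreserving_coords_symm,
      measurePreserving_coords_symm.quasiMeasurePreserving.ae
        (coeFn_mulOp (bddMeas_conj_landauPhase b) (𝓕 f)),
      measurePreserving_coords_symm.quasiMeasurePreserving.ae (Lp.fourier_ae_eq f hf)]
      with p e1 e2 e3
    rw [hΦ, e1, Function.comp_apply, e2, e3]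
  have h2 : ∀ᵐ y : ℝ × ℝ, ∀ᵐ t : ℝ, Φ (t, y) = conj (landauPhase b (coords.symm (t, y)))
      * 𝓕 (f : R3 → ℂ) (coords.symm (t, y)) := by
    have := Measure.ae_ae_of_ae_prod (Measure.measurePreserving_swap.quasiMeasurePreserving.ae h1)
    exact this
  filter_upwards [adjoint_tensor_ae_eq (hermLp (hermScale_pos hb) n) Φ, h2] with y e1 e2
  rw [e1]
  -- The Fourier character and the conjugate phase combined; its modulus is 1, so integrability on
  -- the product reduces to that of h ⊗ f.
  let e : ℝ → R3 → ℂ := fun t x => Complex.exp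
    ((-(2 * Real.pi * (x 1 * y.1 + x 2 * y.2)) : ℝ) * Complex.I)
      * Complex.exp ((-(2 * Real.pi * (t * (x 0 + 2 * Real.pi * y.1 / b))) : ℝ) * Complex.I)
  have he : ∀ t x, ‖e t x‖ = 1 := fun t x => by
    simp only [e, norm_mul, Complex.norm_exp_ofReal_mul_I, mul_one]
  have hec : Continuous fun p : ℝ × R3 => e p.1 p.2 := by
    have c1 : Continuous fun p : ℝ × R3 =>
        ((-(2 * Real.pi * (p.2 1 * y.1 + p.2 2 * y.2)) : ℝ) : ℂ) :=
      Complex.continuous_ofReal.comp (by fun_prop)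
    have c2 : Continuous fun p : ℝ × R3 =>
        ((-(2 * Real.pi * (p.1 * (p.2 0 + 2 * Real.pi * y.1 / b))) : ℝ) : ℂ) :=
      Complex.continuous_ofReal.comp (by fun_prop)
    exact ((c1.mul continuous_const).cexp).mul ((c2.mul continuous_const).cexp)
  have hint : Integrable (fun p : ℝ × R3 => e p.1 p.2 * ((h p.1 : ℂ) * f p.2))
      ((volume : Measure ℝ).prod volume) := by
    have := (integrable_ofReal_hermFn hb n).mul_prod hf
    refine this.mono (hec.aestronglyMeasurable.mul this.aestronglyMeasurable)
      (Eventually.of_forall fun p => ?_)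
    rw [norm_mul, he, one_mul]
  calc ∫ t, conj (hermLp (hermScale_pos hb) n t) * Φ (t, y)
      = ∫ t, ∫ x, e t x * ((h t : ℂ) * f x) := by
        refine integral_congr_ae ?_
        filter_upwards [e2, coeFn_hermLp (hermScale_pos hb) n] with t k1 k2
        rw [k1, k2, Complex.conj_ofReal, ← mul_assoc, Real.fourier_eq', ← integral_const_mul]
        refine integral_congr_ae (Eventually.of_forall fun x => ?_)
        simp only [landauPhase, ← Complex.exp_conj, map_mul, Complex.conj_ofReal, Complex.conj_I,
          inner_R3, coords_symm_zero, coords_symm_one, coords_symm_two, e, smul_eq_mul]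
        have : Complex.exp (((4 * Real.pi ^ 2 / b * t * y.1 : ℝ) : ℂ) * -Complex.I)
            * Complex.exp (((-2 * Real.pi * (x 0 * t + x 1 * y.1 + x 2 * y.2) : ℝ) : ℂ)
              * Complex.I)
            = Complex.exp (((-(2 * Real.pi * (x 1 * y.1 + x 2 * y.2)) : ℝ) : ℂ) * Complex.I)
      * Complex.exp (((-(2 * Real.pi * (t * (x 0 + 2 * Real.pi * y.1 / b))) : ℝ) : ℂ)
        * Complex.I) := by
          rw [← Complex.exp_add, ← Complex.exp_add]
          congr 1
          push_cast
          ring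
        rw [← this]
        ring
    _ = ∫ x, ∫ t, e t x * ((h t : ℂ) * f x) := integral_integral_swap hint
    _ = ∫ x, landauKernel b n y x * f x := by
        refine integral_congr_ae (Eventually.of_forall fun x => ?_)
        simp only [landauKernel, hermFourier, Real.fourier_eq', ← hdef]
        rw [← integral_const_mul, ← integral_mul_const]
        refine integral_congr_ae (Eventually.of_forall fun t => ?_)
        simp only [e, smul_eq_mul, RCLike.inner_apply, conj_trivial]
        have : (-(2 * Real.pi * (t * (x 0 + 2 * Real.pi * y.1 / b))) : ℝ)
          = -2 * Real.pi * ((x 0 + 2 * Real.pi * y.1 / b) * t) := by ring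
        rw [this]
        ring

theorem lintegral_hermFourier_sq (hb : 0 < b) (n : ℕ) :
    ∫⁻ t, ‖hermFourier b n t‖ₑ ^ 2 = 1 := by
  have h1 := coeFn_hermLp (hermScale_pos hb) n
  have h2 := Lp.fourier_ae_eq (hermLp (hermScale_pos hb) n)
    ((integrable_ofReal_hermFn hb n).congr h1.symm)
  have h3 : ‖(𝓕 (hermLp (hermScale_pos hb) n) : Lp ℂ 2 (volume : Measure ℝ))‖ₑ ^ 2 = 1 := by
    have h4 : ‖hermLp (hermScale_pos hb) n‖ = 1 := by
      have h5 : ‖hermLp (hermScale_pos hb) n‖ ^ 2 = 1 := by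
        rw [← @inner_self_eq_norm_sq ℂ, inner_hermLp, if_pos rfl, RCLike.one_re]
      exact (pow_eq_one_iff_of_nonneg (norm_nonneg _) two_ne_zero).1 h5
    rw [← ofReal_norm, Lp.norm_fourier_eq, h4]
    simp
  rw [← h3, Lp.enorm_sq_eq_lintegral]
  refine lintegral_congr_ae ?_
  filter_upwards [h2] with t ht
  rw [ht, Real.fourier_congr_ae h1]
  rfl

end

/-! ### From distributional magnetic momenta to ladder relations and the spectral form of the
energy. -/

noncomputable section

open scoped FourierTransform SchwartzMap LineDeriv

variable {b : ℝ}

/-! ### The magnetic momenta on Schwartz functions -/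

theorem hasTemperateGrowth_vectorPotential (b : ℝ) (j : Fin 3) :
    Function.HasTemperateGrowth fun x : R3 => (vectorPotential b x j : ℂ) := by
  have h0 : Function.HasTemperateGrowth fun _ : R3 => (0 : ℂ) := Function.HasTemperateGrowth.const 0
  have h1 : Function.HasTemperateGrowth fun x : R3 => ((b * x 0 : ℝ) : ℂ) := by
    have : Function.HasTemperateGrowth
        (Complex.ofRealCLM ∘L (b • (EuclideanSpace.proj 0 : R3 →L[ℝ] ℝ))) :=
      ContinuousLinearMap.hasTemperateGrowth _
    exact this
  fin_cases j
  · convert h0 using 2; simp [vectorPotential]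
  · exact h1
  · convert h0 using 2; simp [vectorPotential]

/-- `(p_j + a_j) φ` for a Schwartz function `φ`. -/
def schwartzMomentum (b : ℝ) (j : Fin 3) (φ : 𝓢(R3, ℂ)) : 𝓢(R3, ℂ) :=
  -Complex.I • ∂_{(EuclideanSpace.single j 1 : R3)} φ
    + SchwartzMap.smulLeftCLM ℂ (fun x : R3 => (vectorPotential b x j : ℂ)) φ

theorem schwartzMomentum_apply (b : ℝ) (j : Fin 3) (φ : 𝓢(R3, ℂ)) (x : R3) :
    schwartzMomentum b j φ x = magMomentum b j φ x := by
  simp only [schwartzMomentum, magMomentum, add_apply, smul_apply,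
    SchwartzMap.lineDerivOp_apply_eq_fderiv, smul_eq_mul,
    SchwartzMap.smulLeftCLM_apply_apply (hasTemperateGrowth_vectorPotential b j)]

theorem magMomentum_cutoff (b : ℝ) (j : Fin 3) (φ : 𝓢(R3, ℂ)) (k : ℕ) (x : R3) :
    magMomentum b j (fun x => (cutoff R3 k x : ℂ) * φ x) x
      = cutoff R3 k x * schwartzMomentum b j φ x
        + -Complex.I * (fderiv ℝ (cutoff R3 k) x (EuclideanSpace.single j 1) * φ x) := by
  rw [schwartzMomentum_apply, magMomentum, magMomentum]
  have h1 : HasFDerivAt (fun x => (cutoff R3 k x : ℂ))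
      (Complex.ofRealCLM ∘L fderiv ℝ (cutoff R3 k) x) x :=
    Complex.ofRealCLM.hasFDerivAt.comp x
      ((contDiff_cutoff R3 k).differentiable (by simp) x).hasFDerivAt
  have h2 : fderiv ℝ (fun x => (cutoff R3 k x : ℂ) * φ x) x = _ := (h1.mul (φ.hasFDerivAt x)).fderiv
  rw [h2]
  simp only [add_apply, smul_apply, ContinuousLinearMap.comp_apply, Complex.ofRealCLM_apply,
    smul_eq_mul]
  ring

/-- Test functions will be chosen compactly supported in Fourier space, hence only Schwartz in
position space. Cutoffs bridge the gap: the term with the derivative of the cutoff tends to 0 in L².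
-/
theorem IsWeakMagMomentum.inner_schwartz {j : Fin 3} {ψ g : L2R3}
    (h : IsWeakMagMomentum b j ψ g) (φ : 𝓢(R3, ℂ)) :
    inner ℂ ((schwartzMomentum b j φ).toLp 2 volume) ψ = inner ℂ (φ.toLp 2 volume) g := by
  have key : ∀ k, inner ℂ (mulOp volume _ (bddMeas_cutoff R3 k)
      ((schwartzMomentum b j φ).toLp 2 volume)
      + -Complex.I • mulOp volume _ (bddMeas_fderiv_cutoff R3 k (EuclideanSpace.single j 1))
        (φ.toLp 2 volume)) ψ
      = inner ℂ (mulOp volume _ (bddMeas_cutoff R3 k) (φ.toLp 2 volume)) g := by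
    intro k
    have hk := h (fun x => (cutoff R3 k x : ℂ) * φ x)
      ((Complex.ofRealCLM.contDiff.comp (contDiff_cutoff R3 k)).mul (φ.smooth ⊤))
      (HasCompactSupport.mul_right
        ((hasCompactSupport_cutoff R3 k).comp_left (g := Complex.ofReal) rfl))
    rw [L2.inner_def, L2.inner_def]
    refine Eq.trans ?_ (hk.trans ?_)
    · refine integral_congr_ae ?_
      filter_upwards [Lp.coeFn_add (mulOp volume _ (bddMeas_cutoff R3 k)
        ((schwartzMomentum b j φ).toLp 2 volume))
        (-Complex.I • mulOp volume _ (bddMeas_fderiv_cutoff R3 k (EuclideanSpace.single j 1))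
        (φ.toLp 2 volume)), Lp.coeFn_smul (-Complex.I) (mulOp volume _
        (bddMeas_fderiv_cutoff R3 k (EuclideanSpace.single j 1)) (φ.toLp 2 volume)),
        coeFn_mulOp (bddMeas_cutoff R3 k) ((schwartzMomentum b j φ).toLp 2 volume),
        coeFn_mulOp (bddMeas_fderiv_cutoff R3 k (EuclideanSpace.single j 1)) (φ.toLp 2 volume),
        φ.coeFn_toLp 2 volume, (schwartzMomentum b j φ).coeFn_toLp 2 volume] with x e1 e2 e3 e4 e5 e6
      rw [RCLike.inner_apply, mul_comm, magMomentum_cutoff, e1, Pi.add_apply, e2, Pi.smul_apply, e3,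
        e4, e5, e6, smul_eq_mul]
    · refine integral_congr_ae ?_
      filter_upwards [coeFn_mulOp (bddMeas_cutoff R3 k) (φ.toLp 2 volume),
        φ.coeFn_toLp 2 volume] with x e1 e2
      rw [RCLike.inner_apply, mul_comm, e1, e2]
  have l1 := ((tendsto_mulOp_cutoff R3 ((schwartzMomentum b j φ).toLp 2 volume)).add
    ((tendsto_mulOp_fderiv_cutoff R3 (EuclideanSpace.single j 1)
      (φ.toLp 2 volume)).const_smul (-Complex.I))).inner (tendsto_const_nhds (x := ψ)) (𝕜 := ℂ)
  have l2 := (tendsto_mulOp_cutoff R3 (φ.toLp 2 volume)).inner (tendsto_const_nhds (x := g))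
    (𝕜 := ℂ)
  rw [smul_zero, add_zero] at l1
  exact tendsto_nhds_unique (l1.congr key) l2

/-- Integration by parts. This makes the ladder relations available for Schwartz functions, from
which weak momenta of other vectors are obtained by duality. -/
theorem isWeakMagMomentum_schwartz (b : ℝ) (j : Fin 3) (φ : 𝓢(R3, ℂ)) :
    IsWeakMagMomentum b j (φ.toLp 2 volume) ((schwartzMomentum b j φ).toLp 2 volume) := by
  intro η hη hs
  set e : R3 := EuclideanSpace.single j 1
  let η' : 𝓢(R3, ℂ) := HasCompactSupport.toSchwartzMap (f := fun x => conj (η x))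
    (hs.comp_left (map_zero _)) (Complex.conjCLE.contDiff.comp hη)
  have hη' : ∀ x, ∂_{e} η' x = conj (fderiv ℝ η x e) := fun x => by
    rw [SchwartzMap.lineDerivOp_apply_eq_fderiv]
    have h1 : HasFDerivAt (fun x => conj (η x)) ((Complex.conjCLE : ℂ →L[ℝ] ℂ) ∘L fderiv ℝ η x) x :=
      Complex.conjCLE.hasFDerivAt.comp x (hη.differentiable (by simp) x).hasFDerivAt
    have h2 : fderiv ℝ (⇑η') x = _ := h1.fderiv
    rw [h2]
    rfl
  have hp := SchwartzMap.integral_mul_lineDerivOp_right_eq_neg_left (μ := volume) η' φ e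
  set A : 𝓢(R3, ℂ) := SchwartzMap.smulLeftCLM ℂ (fun x : R3 => (vectorPotential b x j : ℂ)) φ
  have hA : ∀ x, A x = (vectorPotential b x j : ℂ) * φ x := fun x => by
    simp only [A, SchwartzMap.smulLeftCLM_apply_apply (hasTemperateGrowth_vectorPotential b j),
      smul_eq_mul]
  have hi : ∀ f g : 𝓢(R3, ℂ), Integrable fun x => f x * g x := fun f g =>
    (SchwartzMap.pairing (ContinuousLinearMap.mul ℂ ℂ) f g).integrable
  calc ∫ x, conj (magMomentum b j η x) * (φ.toLp 2 volume : L2R3) x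
      = ∫ x, (Complex.I * (∂_{e} η' x * φ x) + η' x * A x) := by
        refine integral_congr_ae ?_
        filter_upwards [φ.coeFn_toLp 2 volume] with x hx
        rw [hx, hη', hA, magMomentum]
        simp only [map_add, map_mul, map_neg, Complex.conj_I, Complex.conj_ofReal]
        change _ = _ + conj (η x) * _
        ring
    _ = ∫ x, (-Complex.I * (η' x * ∂_{e} φ x) + η' x * A x) := by
        rw [integral_add ((hi _ _).const_mul _) (hi _ _),
          integral_add ((hi _ _).const_mul _) (hi _ _), integral_const_mul, integral_const_mul, hp]
        ring
    _ = ∫ x, conj (η x) * ((schwartzMomentum b j φ).toLp 2 volume : L2R3) x := by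
        refine integral_congr_ae ?_
        filter_upwards [(schwartzMomentum b j φ).coeFn_toLp 2 volume] with x hx
        rw [hx, schwartzMomentum, add_apply, smul_apply, smul_eq_mul]
        change _ * (conj (η x) * _) + conj (η x) * _ = _
        ring

/-! ### Test functions in the spectral representation -/

theorem contDiff_test {v : ℝ → ℝ} {u : ℝ × ℝ → ℝ} (hv : ContDiff ℝ ∞ v) (hu : ContDiff ℝ ∞ u) :
    ContDiff ℝ ∞ fun ξ : R3 => landauPhase b ξ * ((v (ξ 0) * u (ξ 1, ξ 2) : ℝ) : ℂ) := by
  refine (contDiff_landauPhase b).mul (Complex.ofRealCLM.contDiff.comp ?_)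
  exact (hv.comp (by fun_prop)).mul (hu.comp (by fun_prop))

theorem hasCompactSupport_test {v : ℝ → ℝ} {u : ℝ × ℝ → ℝ} (hv : HasCompactSupport v)
    (hu : HasCompactSupport u) :
    HasCompactSupport fun ξ : R3 => landauPhase b ξ * ((v (ξ 0) * u (ξ 1, ξ 2) : ℝ) : ℂ) := by
  refine HasCompactSupport.mul_left (HasCompactSupport.comp_left (g := Complex.ofReal) ?_ rfl)
  have h : HasCompactSupport fun p : ℝ × (ℝ × ℝ) => v p.1 * u p.2 := by
    refine HasCompactSupport.of_support_subset_isCompact (hv.isCompact.prod hu.isCompact) ?_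
    intro p hp
    rw [Function.mem_support] at hp
    exact ⟨subset_tsupport _ (left_ne_zero_of_mul hp), subset_tsupport _ (right_ne_zero_of_mul hp)⟩
  exact h.comp_homeomorph coords.toHomeomorph

/-- The function `exp (-i θ) v ⊗ u` as a Schwartz function. -/
def testFn (b : ℝ) {v : ℝ → ℝ} {u : ℝ × ℝ → ℝ} (hv : ContDiff ℝ ∞ v) (hv' : HasCompactSupport v)
    (hu : ContDiff ℝ ∞ u) (hu' : HasCompactSupport u) : 𝓢(R3, ℂ) :=
  (hasCompactSupport_test (b := b) hv' hu').toSchwartzMap (contDiff_test hv hu)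

theorem testFn_apply {v : ℝ → ℝ} {u : ℝ × ℝ → ℝ} (hv : ContDiff ℝ ∞ v) (hv' : HasCompactSupport v)
    (hu : ContDiff ℝ ∞ u) (hu' : HasCompactSupport u) (ξ : R3) :
    testFn b hv hv' hu hu' ξ = landauPhase b ξ * ((v (ξ 0) * u (ξ 1, ξ 2) : ℝ) : ℂ) := rfl

theorem toLp_fourierInv_eq_landauU (s : 𝓢(R3, ℂ)) (c : ℂ) (f : Lp ℂ 2 (volume : Measure ℝ))
    (u : Lp ℂ 2 (volume : Measure (ℝ × ℝ))) {v : ℝ → ℂ} {w : ℝ × ℝ → ℂ}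
    (hs : ∀ ξ, s ξ = c * (landauPhase b ξ * (v (ξ 0) * w (ξ 1, ξ 2))))
    (hf : f =ᵐ[volume] v) (hu : u =ᵐ[volume] w) :
    (𝓕⁻ s).toLp 2 volume = c • landauU b (tensor volume volume f u) := by
  rw [← SchwartzMap.toLp_fourierInv_eq, ← map_smul, landauU_apply]
  congr 1
  refine Lp.ext ?_
  have h1 : ∀ᵐ p ∂prodVol, tensor volume volume f u p = v p.1 * w p.2 := by
    filter_upwards [coeFn_tensor f u, Measure.quasiMeasurePreserving_fst.ae hf,
      Measure.quasiMeasurePreserving_snd.ae hu] with p e1 e2 e3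
    rw [← e2, ← e3]
    exact e1
  filter_upwards [s.coeFn_toLp 2 volume, coeFn_mulOp (bddMeas_landauPhase b)
    (Lp.compMeasurePreserving coords measurePreserving_coords (c • tensor volume volume f u)),
    Lp.coeFn_compMeasurePreserving (c • tensor volume volume f u) measurePreserving_coords,
    measurePreserving_coords.quasiMeasurePreserving.ae (Lp.coeFn_smul c (tensor volume volume f u)),
    measurePreserving_coords.quasiMeasurePreserving.ae h1] with ξ e1 e2 e3 e4 e5
  rw [e1, e2, e3, Function.comp_apply, e4, Pi.smul_apply, e5, hs, smul_eq_mul, coords_apply]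
  ring

theorem hasTemperateGrowth_inner_single (j : Fin 3) :
    Function.HasTemperateGrowth fun ξ : R3 => inner ℝ ξ (EuclideanSpace.single j 1 : R3) := by
  fun_prop

theorem inner_single (ξ : R3) (j : Fin 3) :
    inner ℝ ξ (EuclideanSpace.single j 1 : R3) = ξ j := by
  simp [EuclideanSpace.inner_single_right]

theorem lineDeriv_fourierInv (s : 𝓢(R3, ℂ)) (j : Fin 3) :
    -Complex.I • ∂_{(EuclideanSpace.single j 1 : R3)} (𝓕⁻ s)
      = 𝓕⁻ ((2 * Real.pi : ℂ) • SchwartzMap.smulLeftCLM ℂ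
        (fun ξ : R3 => inner ℝ ξ (EuclideanSpace.single j 1 : R3)) s) := by
  rw [SchwartzMap.lineDerivOp_fourierInv_eq, ← FourierTransform.fourierInv_smul, smul_smul]
  congr 2
  linear_combination -(2 * Real.pi : ℂ) * Complex.I_sq

theorem schwartzMomentum_zero_fourierInv (s : 𝓢(R3, ℂ)) :
    schwartzMomentum b 0 (𝓕⁻ s) = 𝓕⁻ ((2 * Real.pi : ℂ) • SchwartzMap.smulLeftCLM ℂ
        (fun ξ : R3 => inner ℝ ξ (EuclideanSpace.single 0 1 : R3)) s) := by
  rw [schwartzMomentum, lineDeriv_fourierInv]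
  refine SchwartzMap.ext fun x => ?_
  rw [add_apply, SchwartzMap.smulLeftCLM_apply_apply (hasTemperateGrowth_vectorPotential b 0)]
  simp [vectorPotential]

theorem schwartzMomentum_two_fourierInv (s : 𝓢(R3, ℂ)) :
    schwartzMomentum b 2 (𝓕⁻ s) = 𝓕⁻ ((2 * Real.pi : ℂ) • SchwartzMap.smulLeftCLM ℂ
        (fun ξ : R3 => inner ℝ ξ (EuclideanSpace.single 2 1 : R3)) s) := by
  rw [schwartzMomentum, lineDeriv_fourierInv]
  refine SchwartzMap.ext fun x => ?_
  rw [add_apply, SchwartzMap.smulLeftCLM_apply_apply (hasTemperateGrowth_vectorPotential b 2)]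
  simp [vectorPotential]

/-- Multiplication by x₁ corresponds to (i/2π)∂ in the first frequency, which explains the
coefficient of the derivative. -/
theorem schwartzMomentum_one_fourierInv (s : 𝓢(R3, ℂ)) :
    schwartzMomentum b 1 (𝓕⁻ s) = 𝓕⁻ ((2 * Real.pi : ℂ) • SchwartzMap.smulLeftCLM ℂ
        (fun ξ : R3 => inner ℝ ξ (EuclideanSpace.single 1 1 : R3)) s
        + (b * Complex.I / (2 * Real.pi) : ℂ) • ∂_{(EuclideanSpace.single 0 1 : R3)} s) := by
  rw [schwartzMomentum, lineDeriv_fourierInv, FourierTransform.fourierInv_add,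
    FourierTransform.fourierInv_smul (b * Complex.I / (2 * Real.pi) : ℂ),
    SchwartzMap.fourierInv_lineDerivOp_eq]
  congr 1
  refine SchwartzMap.ext fun x => ?_
  rw [smul_apply, smul_apply,
    SchwartzMap.smulLeftCLM_apply_apply (hasTemperateGrowth_vectorPotential b 1),
    SchwartzMap.smulLeftCLM_apply_apply (hasTemperateGrowth_inner_single 0), inner_single]
  have hpi : (Real.pi : ℂ) ≠ 0 := by exact_mod_cast Real.pi_ne_zero
  simp only [vectorPotential, Matrix.cons_val_one, Matrix.cons_val_zero, smul_eq_mul,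
    Complex.real_smul]
  push_cast
  field_simp
  linear_combination ((b : ℂ) * x 0 * 𝓕⁻ s x) * Complex.I_sq

end

noncomputable section

open scoped FourierTransform SchwartzMap LineDeriv

variable {b : ℝ}

/-! ### Ladder relations for the Landau coefficients -/

/-- The last term comes from the phase. Multiplied by bi/(2π) it equals -2πξ₂ times the test
function and cancels the other part of the second momentum; this fixes the constant in
`landauPhase`. -/
theorem lineDeriv_testFn {v : ℝ → ℝ} {u : ℝ × ℝ → ℝ} (hv : ContDiff ℝ ∞ v)
    (hv' : HasCompactSupport v) (hu : ContDiff ℝ ∞ u) (hu' : HasCompactSupport u) (ξ : R3) :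
    ∂_{(EuclideanSpace.single 0 1 : R3)} (testFn b hv hv' hu hu') ξ
      = landauPhase b ξ * ((deriv v (ξ 0) * u (ξ 1, ξ 2) : ℝ) : ℂ)
        + (4 * Real.pi ^ 2 / b * ξ 1 : ℝ) * Complex.I * testFn b hv hv' hu hu' ξ := by
  rw [SchwartzMap.lineDerivOp_apply, lineDeriv]
  have e : ∀ t : ℝ, testFn b hv hv' hu hu' (ξ + t • (EuclideanSpace.single 0 1 : R3))
      = Complex.exp (((4 * Real.pi ^ 2 / b * (ξ 0 + t) * ξ 1 : ℝ) : ℂ) * Complex.I)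
        * ((v (ξ 0 + t) * u (ξ 1, ξ 2) : ℝ) : ℂ) := fun t => by
    simp [testFn_apply, landauPhase]
  simp_rw [e]
  have h0 : HasDerivAt (fun t : ℝ => ξ 0 + t) 1 0 := by
    simpa using (hasDerivAt_id (0 : ℝ)).const_add (ξ 0)
  have h1 : HasDerivAt (fun t : ℝ => ((4 * Real.pi ^ 2 / b * (ξ 0 + t) * ξ 1 : ℝ) : ℂ) * Complex.I)
      (((4 * Real.pi ^ 2 / b * ξ 1 : ℝ) : ℂ) * Complex.I) 0 := by
    refine HasDerivAt.mul_const (HasDerivAt.ofReal_comp ?_) _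
    refine ((h0.const_mul (4 * Real.pi ^ 2 / b)).mul_const (ξ 1)).congr_deriv ?_
    ring
  have h2 : HasDerivAt v (deriv v (ξ 0)) (ξ 0 + 0) := by
    rw [add_zero]; exact (hv.differentiable (by simp) _).hasDerivAt
  have h3 : HasDerivAt (fun t : ℝ => ((v (ξ 0 + t) * u (ξ 1, ξ 2) : ℝ) : ℂ))
      ((deriv v (ξ 0) * u (ξ 1, ξ 2) : ℝ) : ℂ) 0 := by
    refine HasDerivAt.ofReal_comp ?_
    simpa using (h2.comp 0 h0).mul_const (u (ξ 1, ξ 2))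
  refine (h1.cexp.mul h3).deriv.trans ?_
  rw [testFn_apply, landauPhase]
  simp only [add_zero]
  ring

section Test

variable {v : ℝ → ℝ} {u : ℝ × ℝ → ℝ} {ψ g : L2R3}
  {vL fL : Lp ℂ 2 (volume : Measure ℝ)} {uL wL : Lp ℂ 2 (volume : Measure (ℝ × ℝ))}

theorem toLp_fourierInv_testFn (hv : ContDiff ℝ ∞ v) (hv' : HasCompactSupport v)
    (hu : ContDiff ℝ ∞ u) (hu' : HasCompactSupport u)
    (hvL : vL =ᵐ[volume] fun t => (v t : ℂ)) (huL : uL =ᵐ[volume] fun y => (u y : ℂ)) :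
    (𝓕⁻ (testFn b hv hv' hu hu')).toLp 2 volume = landauU b (tensor volume volume vL uL) := by
  rw [toLp_fourierInv_eq_landauU (b := b) _ 1 vL uL (fun ξ => ?_) hvL huL, one_smul]
  rw [testFn_apply, one_mul]
  push_cast
  rfl

theorem IsWeakMagMomentum.inner_test_zero (h : IsWeakMagMomentum b 0 ψ g)
    (hv : ContDiff ℝ ∞ v) (hv' : HasCompactSupport v)
    (hu : ContDiff ℝ ∞ u) (hu' : HasCompactSupport u)
    (hvL : vL =ᵐ[volume] fun t => (v t : ℂ)) (huL : uL =ᵐ[volume] fun y => (u y : ℂ))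
    (hfL : fL =ᵐ[volume] fun t => (t * v t : ℂ)) :
    inner ℂ ((2 * Real.pi : ℂ) • landauU b (tensor volume volume fL uL)) ψ
      = inner ℂ (landauU b (tensor volume volume vL uL)) g := by
  have h1 := h.inner_schwartz (𝓕⁻ (testFn b hv hv' hu hu'))
  rw [schwartzMomentum_zero_fourierInv, toLp_fourierInv_testFn hv hv' hu hu' hvL huL] at h1
  rw [← h1, toLp_fourierInv_eq_landauU (b := b) _ (2 * Real.pi) fL uL (fun ξ => ?_) hfL huL]
  rw [smul_apply, SchwartzMap.smulLeftCLM_apply_apply (hasTemperateGrowth_inner_single 0),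
    inner_single, testFn_apply, Complex.real_smul, smul_eq_mul]
  push_cast
  ring

theorem IsWeakMagMomentum.inner_test_one (hb : 0 < b) (h : IsWeakMagMomentum b 1 ψ g)
    (hv : ContDiff ℝ ∞ v) (hv' : HasCompactSupport v)
    (hu : ContDiff ℝ ∞ u) (hu' : HasCompactSupport u)
    (hvL : vL =ᵐ[volume] fun t => (v t : ℂ)) (huL : uL =ᵐ[volume] fun y => (u y : ℂ))
    (hfL : fL =ᵐ[volume] fun t => ((deriv v t : ℝ) : ℂ)) :
    inner ℂ ((b * Complex.I / (2 * Real.pi) : ℂ) • landauU b (tensor volume volume fL uL)) ψ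
      = inner ℂ (landauU b (tensor volume volume vL uL)) g := by
  have h1 := h.inner_schwartz (𝓕⁻ (testFn b hv hv' hu hu'))
  rw [schwartzMomentum_one_fourierInv, toLp_fourierInv_testFn hv hv' hu hu' hvL huL] at h1
  rw [← h1, toLp_fourierInv_eq_landauU (b := b) _ (b * Complex.I / (2 * Real.pi)) fL uL
    (fun ξ => ?_) hfL huL]
  rw [add_apply, smul_apply, smul_apply,
    SchwartzMap.smulLeftCLM_apply_apply (hasTemperateGrowth_inner_single 1),
    inner_single, lineDeriv_testFn, testFn_apply, Complex.real_smul, smul_eq_mul, smul_eq_mul]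
  have hpi : (Real.pi : ℂ) ≠ 0 := by exact_mod_cast Real.pi_ne_zero
  have hbc : (b : ℂ) ≠ 0 := by exact_mod_cast hb.ne'
  push_cast
  field_simp
  linear_combination (landauPhase b ξ * 4 * Real.pi ^ 2 * ξ 1 * v (ξ 0) * u (ξ 1, ξ 2) : ℂ)
    * Complex.I_sq

theorem IsWeakMagMomentum.inner_test_two (h : IsWeakMagMomentum b 2 ψ g)
    (hv : ContDiff ℝ ∞ v) (hv' : HasCompactSupport v)
    (hu : ContDiff ℝ ∞ u) (hu' : HasCompactSupport u)
    (hvL : vL =ᵐ[volume] fun t => (v t : ℂ)) (huL : uL =ᵐ[volume] fun y => (u y : ℂ))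
    (hwL : wL =ᵐ[volume] fun y => (y.2 * u y : ℂ)) :
    inner ℂ ((2 * Real.pi : ℂ) • landauU b (tensor volume volume vL wL)) ψ
      = inner ℂ (landauU b (tensor volume volume vL uL)) g := by
  have h1 := h.inner_schwartz (𝓕⁻ (testFn b hv hv' hu hu'))
  rw [schwartzMomentum_two_fourierInv, toLp_fourierInv_testFn hv hv' hu hu' hvL huL] at h1
  rw [← h1, toLp_fourierInv_eq_landauU (b := b) _ (2 * Real.pi) vL wL (fun ξ => ?_) hvL hwL]
  rw [smul_apply, SchwartzMap.smulLeftCLM_apply_apply (hasTemperateGrowth_inner_single 2),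
    inner_single, testFn_apply, Complex.real_smul, smul_eq_mul]
  push_cast
  ring

end Test

/-! ### The limit of Hermite functions -/

theorem contDiff_cutoff_hermFn (c : ℝ) (n k : ℕ) :
    ContDiff ℝ ∞ fun t => cutoff ℝ k t * hermFn c n t :=
  (contDiff_cutoff ℝ k).mul (contDiff_hermFn c n)

theorem hasCompactSupport_cutoff_hermFn (c : ℝ) (n k : ℕ) :
    HasCompactSupport fun t => cutoff ℝ k t * hermFn c n t :=
  (hasCompactSupport_cutoff ℝ k).mul_right

theorem mulOp_cutoff_ae_eq {f : ℝ → ℝ} {fL : Lp ℂ 2 (volume : Measure ℝ)}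
    (hf : fL =ᵐ[volume] fun t => (f t : ℂ)) (k : ℕ) :
    mulOp volume _ (bddMeas_cutoff ℝ k) fL =ᵐ[volume] fun t => ((cutoff ℝ k t * f t : ℝ) : ℂ) := by
  filter_upwards [coeFn_mulOp (bddMeas_cutoff ℝ k) fL, hf] with t h1 h2
  rw [h1, h2, Complex.ofReal_mul]

/-- Half of `√(2n) h_{n-1} + s √(2(n+1)) h_{n+1}` in `L²(ℝ)`. -/
def hermNbr {c : ℝ} (hc : 0 < c) (s : ℂ) (n : ℕ) : Lp ℂ 2 (volume : Measure ℝ) :=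
  (√(2 * n) / 2 : ℂ) • hermLp hc (n - 1) + (s * √(2 * (n + 1)) / 2 : ℂ) • hermLp hc (n + 1)

theorem coeFn_hermNbr {c : ℝ} (hc : 0 < c) (s : ℂ) (n : ℕ) :
    hermNbr hc s n =ᵐ[volume] fun t => (√(2 * n) / 2 : ℂ) * hermFn c (n - 1) t
      + (s * √(2 * (n + 1)) / 2 : ℂ) * hermFn c (n + 1) t := by
  filter_upwards [coeFn_hermLp hc (n - 1), coeFn_hermLp hc (n + 1),
    Lp.coeFn_smul (√(2 * n) / 2 : ℂ) (hermLp hc (n - 1)),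
    Lp.coeFn_smul (s * √(2 * (n + 1)) / 2 : ℂ) (hermLp hc (n + 1)),
    Lp.coeFn_add ((√(2 * n) / 2 : ℂ) • hermLp hc (n - 1))
      ((s * √(2 * (n + 1)) / 2 : ℂ) • hermLp hc (n + 1))] with t h1 h2 h3 h4 h5
  rw [hermNbr, h5, Pi.add_apply, h3, h4, Pi.smul_apply, Pi.smul_apply, h1, h2]
  simp only [smul_eq_mul]

theorem two_pi_eq_sqrt_mul_hermScale (hb : 0 < b) : 2 * Real.pi = √b * hermScale b := by
  have : √b ≠ 0 := by positivity
  rw [hermScale]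
  field_simp

theorem tendsto_inner_tensor {vL : ℕ → Lp ℂ 2 (volume : Measure ℝ)}
    {v : Lp ℂ 2 (volume : Measure ℝ)} (h : Tendsto vL atTop (𝓝 v)) (c : ℂ)
    (u : Lp ℂ 2 (volume : Measure (ℝ × ℝ))) (ψ : L2R3) :
    Tendsto (fun k => inner ℂ (c • landauU b (tensor volume volume (vL k) u)) ψ) atTop
      (𝓝 (inner ℂ (c • landauU b (tensor volume volume v u)) ψ)) := by
  have hc : Continuous fun w : Lp ℂ 2 (volume : Measure ℝ) =>
      inner ℂ (c • landauU b (tensor volume volume w u)) ψ := by fun_prop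
  exact hc.continuousAt.tendsto.comp h

theorem Lp.eq_of_inner_test {F G : Lp ℂ 2 (volume : Measure (ℝ × ℝ))}
    (h : ∀ (u : ℝ × ℝ → ℝ) (hu : ContDiff ℝ ∞ u) (hu' : HasCompactSupport u),
      inner ℂ ((schwartzOfReal u hu hu').toLp 2 volume) F
        = inner ℂ ((schwartzOfReal u hu hu').toLp 2 volume) G) : F = G := by
  refine Lp.ext (ae_eq_of_integral_contDiff_smul_eq
    ((Lp.memLp F).locallyIntegrable (by norm_num)) ((Lp.memLp G).locallyIntegrable (by norm_num))
    fun u hu hu' => ?_)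
  have e : ∀ F : Lp ℂ 2 (volume : Measure (ℝ × ℝ)), ∫ y, u y • F y
      = inner ℂ ((schwartzOfReal u hu hu').toLp 2 volume) F := fun F => by
    rw [L2.inner_def]
    refine integral_congr_ae ?_
    filter_upwards [(schwartzOfReal u hu hu').coeFn_toLp 2 volume] with y hy
    rw [hy, RCLike.inner_apply, schwartzOfReal_apply, Complex.conj_ofReal, Complex.real_smul,
      mul_comm]
  rw [e, e, h u hu hu']

theorem inner_landauU_hermNbr (hb : 0 < b) (c s : ℂ) (n : ℕ)
    (u : Lp ℂ 2 (volume : Measure (ℝ × ℝ))) (ψ : L2R3) :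
    inner ℂ (c • landauU b (tensor volume volume (hermNbr (hermScale_pos hb) s n) u)) ψ
      = inner ℂ u (conj c • ((√(2 * n) / 2 : ℂ) • landauC hb (n - 1) ψ
        + (conj s * √(2 * (n + 1)) / 2 : ℂ) • landauC hb (n + 1) ψ)) := by
  have h : landauU b (tensor volume volume (hermNbr (hermScale_pos hb) s n) u)
      = (√(2 * n) / 2 : ℂ) • landauS hb (n - 1) u
        + (s * √(2 * (n + 1)) / 2 : ℂ) • landauS hb (n + 1) u := by
    simp only [hermNbr, map_add, map_smul, add_apply, smul_apply]
    rfl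
  rw [h, inner_smul_left, inner_add_left, inner_smul_left, inner_smul_left, inner_smul_right,
    inner_add_right, inner_smul_right, inner_smul_right, inner_landauC_right, inner_landauC_right]
  have h2 : conj (2 : ℂ) = 2 := map_ofNat _ 2
  simp only [map_div₀, map_mul, Complex.conj_ofReal, h2]

/-- In the spectral representation the first momentum is multiplication by 2πt = √b · ct, with c the
Hermite scale, and the three-term recurrence gives the neighbours. Hermite functions are not
compactly supported, so they are cut off and the limit is taken on both sides. -/
theorem IsWeakMagMomentum.landauC_zero (hb : 0 < b) {ψ g : L2R3} (h : IsWeakMagMomentum b 0 ψ g)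
    (n : ℕ) : landauC hb n g = (√b : ℂ) • ((√(2 * n) / 2 : ℂ) • landauC hb (n - 1) ψ
      + (√(2 * (n + 1)) / 2 : ℂ) • landauC hb (n + 1) ψ) := by
  have hc := hermScale_pos hb
  refine Lp.eq_of_inner_test fun u hu hu' => ?_
  set uL := (schwartzOfReal u hu hu').toLp 2 volume
  have huL : uL =ᵐ[volume] fun y => (u y : ℂ) := (schwartzOfReal u hu hu').coeFn_toLp 2 volume
  have key : ∀ k, inner ℂ ((√b : ℂ) • landauU b (tensor volume volume
      (mulOp volume _ (bddMeas_cutoff ℝ k) (hermNbr hc 1 n)) uL)) ψ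
      = inner ℂ ((1 : ℂ) • landauU b (tensor volume volume
        (mulOp volume _ (bddMeas_cutoff ℝ k) (hermLp hc n)) uL)) g := by
    intro k
    -- The test lemma wants t times the function while the recurrence produces ct times it, hence
    -- the factor c⁻¹.
    have h1 := h.inner_test_zero (fL := (hermScale b : ℂ)⁻¹ •
        mulOp volume _ (bddMeas_cutoff ℝ k) (hermNbr hc 1 n))
      (contDiff_cutoff_hermFn (hermScale b) n k)
      (hasCompactSupport_cutoff_hermFn (hermScale b) n k) hu hu'
      (mulOp_cutoff_ae_eq (coeFn_hermLp hc n) k) huL (by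
        filter_upwards [Lp.coeFn_smul (hermScale b : ℂ)⁻¹
          (mulOp volume _ (bddMeas_cutoff ℝ k) (hermNbr hc 1 n)),
          coeFn_mulOp (bddMeas_cutoff ℝ k) (hermNbr hc 1 n), coeFn_hermNbr hc 1 n] with t e1 e2 e3
        rw [e1, Pi.smul_apply, e2, e3]
        have h4 := congrArg (fun r : ℝ => (r : ℂ)) (mul_hermFn hc n t)
        have h5 : (hermScale b : ℂ) ≠ 0 := by exact_mod_cast hc.ne'
        push_cast at h4 ⊢
        rw [smul_eq_mul, inv_mul_eq_iff_eq_mul₀ h5]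
        linear_combination -(cutoff ℝ k t : ℂ) * h4)
    rw [one_smul, ← h1]
    congr 1
    rw [map_smul, smul_apply, map_smul, smul_smul]
    congr 1
    have h5 : (hermScale b : ℂ) ≠ 0 := by exact_mod_cast hc.ne'
    rw [eq_mul_inv_iff_mul_eq₀ h5]
    exact_mod_cast (two_pi_eq_sqrt_mul_hermScale hb).symm
  have l1 := tendsto_inner_tensor (b := b) (tendsto_mulOp_cutoff ℝ (hermNbr hc 1 n)) (√b : ℂ) uL ψ
  have l2 := tendsto_inner_tensor (b := b) (tendsto_mulOp_cutoff ℝ (hermLp hc n)) 1 uL g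
  have e := tendsto_nhds_unique (l1.congr key) l2
  rw [inner_landauU_hermNbr hb, one_smul] at e
  rw [inner_landauC_right]
  refine Eq.trans e.symm ?_
  simp

theorem deriv_cutoff_hermFn (c : ℝ) (n k : ℕ) (t : ℝ) :
    deriv (fun t => cutoff ℝ k t * hermFn c n t) t
      = cutoff ℝ k t * deriv (hermFn c n) t + fderiv ℝ (cutoff ℝ k) t 1 * hermFn c n t := by
  have h1 : DifferentiableAt ℝ (cutoff ℝ k) t := (contDiff_cutoff ℝ k).differentiable (by simp) t
  have h2 : DifferentiableAt ℝ (hermFn c n) t := (hasDerivAt_hermFn c n t).differentiableAt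
  rw [fderiv_eq_smul_deriv, one_smul]
  refine (h1.hasDerivAt.mul h2.hasDerivAt).deriv.trans ?_
  ring

/-- Here the second momentum acts as (ib/2π)∂ₜ on Hermite functions, whose derivative is a
difference of neighbours. -/
theorem IsWeakMagMomentum.landauC_one (hb : 0 < b) {ψ g : L2R3} (h : IsWeakMagMomentum b 1 ψ g)
    (n : ℕ) : landauC hb n g = (-Complex.I * √b : ℂ) •
      ((√(2 * n) / 2 : ℂ) • landauC hb (n - 1) ψ
      - (√(2 * (n + 1)) / 2 : ℂ) • landauC hb (n + 1) ψ) := by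
  have hc := hermScale_pos hb
  refine Lp.eq_of_inner_test fun u hu hu' => ?_
  set uL := (schwartzOfReal u hu hu').toLp 2 volume
  have huL : uL =ᵐ[volume] fun y => (u y : ℂ) := (schwartzOfReal u hu hu').coeFn_toLp 2 volume
  -- The derivative of the cut-off Hermite function by the product rule; the second summand vanishes
  -- in the limit.
  set fL : ℕ → Lp ℂ 2 (volume : Measure ℝ) := fun k =>
    mulOp volume _ (bddMeas_cutoff ℝ k) ((hermScale b : ℂ) • hermNbr hc (-1) n)
      + mulOp volume _ (bddMeas_fderiv_cutoff ℝ k 1) (hermLp hc n)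
  have hfL : Tendsto fL atTop (𝓝 ((hermScale b : ℂ) • hermNbr hc (-1) n)) := by
    have := (tendsto_mulOp_cutoff ℝ ((hermScale b : ℂ) • hermNbr hc (-1) n)).add
      (tendsto_mulOp_fderiv_cutoff ℝ 1 (hermLp hc n))
    rwa [add_zero] at this
  have key : ∀ k, inner ℂ ((b * Complex.I / (2 * Real.pi) : ℂ) • landauU b (tensor volume volume
      (fL k) uL)) ψ
      = inner ℂ ((1 : ℂ) • landauU b (tensor volume volume
        (mulOp volume _ (bddMeas_cutoff ℝ k) (hermLp hc n)) uL)) g := by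
    intro k
    rw [one_smul]
    refine h.inner_test_one hb (contDiff_cutoff_hermFn (hermScale b) n k)
      (hasCompactSupport_cutoff_hermFn (hermScale b) n k) hu hu'
      (mulOp_cutoff_ae_eq (coeFn_hermLp hc n) k) huL ?_
    filter_upwards [Lp.coeFn_add (mulOp volume _ (bddMeas_cutoff ℝ k)
        ((hermScale b : ℂ) • hermNbr hc (-1) n))
      (mulOp volume _ (bddMeas_fderiv_cutoff ℝ k 1) (hermLp hc n)),
      coeFn_mulOp (bddMeas_cutoff ℝ k) ((hermScale b : ℂ) • hermNbr hc (-1) n),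
      coeFn_mulOp (bddMeas_fderiv_cutoff ℝ k 1) (hermLp hc n),
      Lp.coeFn_smul (hermScale b : ℂ) (hermNbr hc (-1) n), coeFn_hermNbr hc (-1) n,
      coeFn_hermLp hc n] with t e1 e2 e3 e4 e5 e6
    rw [e1, Pi.add_apply, e2, e3, e4, Pi.smul_apply, e5, e6, deriv_cutoff_hermFn,
      deriv_hermFn_eq hc]
    push_cast
    rw [smul_eq_mul]
    ring
  have l1 := tendsto_inner_tensor (b := b) hfL (b * Complex.I / (2 * Real.pi)) uL ψ
  have l2 := tendsto_inner_tensor (b := b) (tendsto_mulOp_cutoff ℝ (hermLp hc n)) 1 uL g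
  have e := tendsto_nhds_unique (l1.congr key) l2
  have h5 : (b * Complex.I / (2 * Real.pi) : ℂ) * hermScale b = Complex.I * √b := by
    have h6 : (hermScale b : ℂ) ≠ 0 := by exact_mod_cast hc.ne'
    have h7 : (2 * Real.pi : ℂ) = √b * hermScale b := by
      exact_mod_cast two_pi_eq_sqrt_mul_hermScale hb
    have h8 : (b : ℂ) = √b * √b := by exact_mod_cast (Real.mul_self_sqrt hb.le).symm
    have h9 : (√b : ℂ) ≠ 0 := by
      have : √b ≠ 0 := by positivity
      exact_mod_cast this
    rw [h7, div_mul_eq_mul_div, div_eq_iff (mul_ne_zero h9 h6)]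
    linear_combination (Complex.I * hermScale b) * h8
  rw [map_smul, smul_apply, map_smul, smul_smul, h5, inner_landauU_hermNbr hb, one_smul] at e
  rw [inner_landauC_right]
  refine Eq.trans e.symm ?_
  simp only [map_mul, map_neg, map_one, Complex.conj_I, Complex.conj_ofReal]
  congr 2
  rw [sub_eq_add_neg, ← neg_smul]
  congr 2
  ring

theorem IsWeakMagMomentum.landauC_two (hb : 0 < b) {ψ g : L2R3} (h : IsWeakMagMomentum b 2 ψ g)
    (n : ℕ) : landauC hb n g =ᵐ[volume] fun y => (2 * Real.pi * y.2 : ℂ) * landauC hb n ψ y := by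
  have hc := hermScale_pos hb
  have hloc : LocallyIntegrable (landauC hb n ψ) volume :=
    (Lp.memLp (landauC hb n ψ)).locallyIntegrable (by norm_num)
  refine ae_eq_of_integral_contDiff_smul_eq
    ((Lp.memLp (landauC hb n g)).locallyIntegrable (by norm_num))
    (hloc.continuous_mul (g := fun y : ℝ × ℝ => (2 * Real.pi * y.2 : ℂ)) (by fun_prop))
    fun u hu hu' => ?_
  set uL := (schwartzOfReal u hu hu').toLp 2 volume
  have huL : uL =ᵐ[volume] fun y => (u y : ℂ) := (schwartzOfReal u hu hu').coeFn_toLp 2 volume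
  set wL := (schwartzOfReal (fun y => y.2 * u y) (contDiff_snd.mul hu) hu'.mul_left).toLp 2 volume
  have hwL : wL =ᵐ[volume] fun y => (y.2 * u y : ℂ) := by
    filter_upwards [(schwartzOfReal (fun y : ℝ × ℝ => y.2 * u y) (contDiff_snd.mul hu)
      hu'.mul_left).coeFn_toLp 2 volume] with y hy
    rw [hy, schwartzOfReal_apply, Complex.ofReal_mul]
  have key : ∀ k, inner ℂ ((2 * Real.pi : ℂ) • landauU b (tensor volume volume
      (mulOp volume _ (bddMeas_cutoff ℝ k) (hermLp hc n)) wL)) ψ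
      = inner ℂ ((1 : ℂ) • landauU b (tensor volume volume
        (mulOp volume _ (bddMeas_cutoff ℝ k) (hermLp hc n)) uL)) g := by
    intro k
    rw [one_smul]
    exact h.inner_test_two (contDiff_cutoff_hermFn (hermScale b) n k)
      (hasCompactSupport_cutoff_hermFn (hermScale b) n k) hu hu'
      (mulOp_cutoff_ae_eq (coeFn_hermLp hc n) k) huL hwL
  have l1 := tendsto_inner_tensor (b := b) (tendsto_mulOp_cutoff ℝ (hermLp hc n))
    (2 * Real.pi) wL ψ
  have l2 := tendsto_inner_tensor (b := b) (tendsto_mulOp_cutoff ℝ (hermLp hc n)) 1 uL g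
  have e := tendsto_nhds_unique (l1.congr key) l2
  rw [one_smul, inner_smul_left] at e
  have e1 : inner ℂ uL (landauC hb n g) = conj (2 * Real.pi : ℂ) * inner ℂ wL (landauC hb n ψ) := by
    rw [inner_landauC_right, inner_landauC_right]
    exact e.symm
  rw [L2.inner_def, L2.inner_def, ← integral_const_mul] at e1
  refine Eq.trans (integral_congr_ae ?_) (e1.trans (integral_congr_ae ?_))
  · filter_upwards [huL] with y hy
    rw [hy, RCLike.inner_apply, Complex.conj_ofReal, Complex.real_smul, mul_comm]
  · filter_upwards [hwL] with y hy
    have h2 : conj (2 : ℂ) = 2 := map_ofNat _ 2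
    rw [hy, RCLike.inner_apply, Complex.real_smul, map_mul, map_mul, Complex.conj_ofReal,
      Complex.conj_ofReal, Complex.conj_ofReal, h2]
    ring

end

noncomputable section

open scoped FourierTransform SchwartzMap LineDeriv

variable {b : ℝ}

/-! ### The Landau form in the spectral representation -/

/-- The ladder relations determine every coefficient of g from ψ. Hence the infimum defining
`magMomentumNormSq` runs over at most one element. -/
theorem IsWeakMagMomentum.unique (hb : 0 < b) {j : Fin 3} {ψ g g' : L2R3}
    (h : IsWeakMagMomentum b j ψ g) (h' : IsWeakMagMomentum b j ψ g') : g = g' := by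
  refine landauC_injective hb fun n => ?_
  fin_cases j
  · rw [h.landauC_zero hb n, h'.landauC_zero hb n]
  · rw [h.landauC_one hb n, h'.landauC_one hb n]
  · exact Lp.ext ((h.landauC_two hb n).trans (h'.landauC_two hb n).symm)

theorem IsWeakMagMomentum.magMomentumNormSq_eq (hb : 0 < b) {j : Fin 3} {ψ g : L2R3}
    (h : IsWeakMagMomentum b j ψ g) : magMomentumNormSq b j ψ = ‖g‖ₑ ^ 2 := by
  refine le_antisymm (iInf₂_le g h) (le_iInf₂ fun g' h' => ?_)
  rw [h.unique hb h']

theorem enorm_sq_add_enorm_sq_sub {H : Type*} [NormedAddCommGroup H] [InnerProductSpace ℂ H]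
    (x y : H) : ‖x + y‖ₑ ^ 2 + ‖x - y‖ₑ ^ 2 = 2 * (‖x‖ₑ ^ 2 + ‖y‖ₑ ^ 2) := by
  have h := parallelogram_law_with_norm ℂ x y
  have h2 : ‖x + y‖ ^ 2 + ‖x - y‖ ^ 2 = 2 * (‖x‖ ^ 2 + ‖y‖ ^ 2) := by simpa [sq] using h
  have h3 := congrArg ENNReal.ofReal h2
  rw [ENNReal.ofReal_add (by positivity) (by positivity), ENNReal.ofReal_mul (by positivity),
    ENNReal.ofReal_add (by positivity) (by positivity)] at h3
  simpa [ENNReal.ofReal_pow, ofReal_norm] using h3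

/-- The energy `∑ₙ ∫ (εₙ + 4 π² k²) |Cₙ ψ|²` in the spectral representation. -/
def landauEnergy (hb : 0 < b) (ψ : L2R3) : ℝ≥0∞ :=
  ∑' n, ∫⁻ y, ENNReal.ofReal (landauLevel b n + 4 * Real.pi ^ 2 * y.2 ^ 2)
    * ‖landauC hb n ψ y‖ₑ ^ 2

theorem enorm_sq_smul {H : Type*} [NormedAddCommGroup H] [InnerProductSpace ℂ H]
    (c : ℂ) (x : H) : ‖c • x‖ₑ ^ 2 = ENNReal.ofReal (‖c‖ ^ 2) * ‖x‖ₑ ^ 2 := by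
  rw [enorm_smul, mul_pow, ENNReal.ofReal_pow (norm_nonneg _), ofReal_norm]

/-- Up to factors of modulus √b, the two coefficients are x + y and x - y, with x and y carried by
the levels n - 1 and n + 1; the parallelogram law removes the cross terms. -/
theorem enorm_sq_ladder (hb : 0 < b) {ψ g₀ g₁ : L2R3} (h₀ : IsWeakMagMomentum b 0 ψ g₀)
    (h₁ : IsWeakMagMomentum b 1 ψ g₁) (n : ℕ) :
    ‖landauC hb n g₀‖ₑ ^ 2 + ‖landauC hb n g₁‖ₑ ^ 2
      = ENNReal.ofReal (b * n) * ‖landauC hb (n - 1) ψ‖ₑ ^ 2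
        + ENNReal.ofReal (b * (n + 1)) * ‖landauC hb (n + 1) ψ‖ₑ ^ 2 := by
  rw [h₀.landauC_zero hb n, h₁.landauC_one hb n, enorm_sq_smul, enorm_sq_smul]
  have e1 : ‖(√b : ℂ)‖ ^ 2 = b := by
    rw [Complex.norm_real, Real.norm_eq_abs, sq_abs, Real.sq_sqrt hb.le]
  have e2 : ‖(-Complex.I * √b : ℂ)‖ ^ 2 = b := by
    rw [norm_mul, mul_pow, e1, norm_neg, Complex.norm_I]; ring
  have e3 : ∀ r : ℝ, 0 ≤ r → ‖(√(2 * r) / 2 : ℂ)‖ ^ 2 = r / 2 := fun r hr => by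
    have : (√(2 * r) / 2 : ℂ) = ((√(2 * r) / 2 : ℝ) : ℂ) := by push_cast; ring
    rw [this, Complex.norm_real, Real.norm_eq_abs, sq_abs, div_pow, Real.sq_sqrt (by positivity)]
    ring
  have e5 : ∀ r : ℝ, ENNReal.ofReal b * (2 * ENNReal.ofReal (r / 2)) = ENNReal.ofReal (b * r) :=
    fun r => by
      rw [← ENNReal.ofReal_ofNat 2, ← ENNReal.ofReal_mul (by positivity),
        ← ENNReal.ofReal_mul hb.le]
      congr 1
      ring
  rw [e1, e2, ← mul_add, enorm_sq_add_enorm_sq_sub, enorm_sq_smul, enorm_sq_smul,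
    e3 n (by positivity), e3 (n + 1) (by positivity), mul_add, mul_add, ← e5, ← e5]
  simp only [mul_assoc]

theorem IsWeakMagMomentum.sum_enorm_sq (hb : 0 < b) {ψ g₀ g₁ g₂ : L2R3}
    (h₀ : IsWeakMagMomentum b 0 ψ g₀) (h₁ : IsWeakMagMomentum b 1 ψ g₁)
    (h₂ : IsWeakMagMomentum b 2 ψ g₂) :
    ‖g₀‖ₑ ^ 2 + ‖g₁‖ₑ ^ 2 + ‖g₂‖ₑ ^ 2 = landauEnergy hb ψ := by
  set A : ℕ → ℝ≥0∞ := fun n => ‖landauC hb n ψ‖ₑ ^ 2 with hA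
  have e1 : ‖g₀‖ₑ ^ 2 + ‖g₁‖ₑ ^ 2 = ∑' n, ENNReal.ofReal (landauLevel b n) * A n := by
    rw [← tsum_enorm_landauC_sq hb g₀, ← tsum_enorm_landauC_sq hb g₁, ← ENNReal.tsum_add]
    simp_rw [enorm_sq_ladder hb h₀ h₁]
    -- After reindexing, level n receives b(n + 1) from the level above and bn from the level below,
    -- in total b(2n + 1) = εₙ. Both boundary terms carry the factor 0.
    rw [ENNReal.tsum_add, tsum_eq_zero_add' ENNReal.summable]
    have e : ∑' n : ℕ, ENNReal.ofReal (b * (n + 1)) * A (n + 1)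
        = ∑' n : ℕ, ENNReal.ofReal (b * n) * A n := by
      rw [tsum_eq_zero_add' (f := fun n : ℕ => ENNReal.ofReal (b * n) * A n) ENNReal.summable]
      simp
    simp only [hA] at e ⊢
    rw [e]
    simp only [Nat.cast_zero, mul_zero, ENNReal.ofReal_zero, zero_mul, zero_add,
      Nat.add_sub_cancel]
    rw [← ENNReal.tsum_add]
    refine tsum_congr fun n => ?_
    rw [← add_mul, ← ENNReal.ofReal_add (by positivity) (by positivity), landauLevel]
    congr 2
    push_cast
    ring
  have e2 : ‖g₂‖ₑ ^ 2
      = ∑' n, ∫⁻ y, ENNReal.ofReal (4 * Real.pi ^ 2 * y.2 ^ 2) * ‖landauC hb n ψ y‖ₑ ^ 2 := by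
    rw [← tsum_enorm_landauC_sq hb g₂]
    refine tsum_congr fun n => ?_
    rw [Lp.enorm_sq_eq_lintegral]
    refine lintegral_congr_ae ?_
    filter_upwards [h₂.landauC_two hb n] with y hy
    rw [hy, enorm_mul, mul_pow]
    congr 1
    have : (2 * Real.pi * y.2 : ℂ) = ((2 * Real.pi * y.2 : ℝ) : ℂ) := by push_cast; ring
    rw [this, ← ofReal_norm, ← ENNReal.ofReal_pow (norm_nonneg _), Complex.norm_real,
      Real.norm_eq_abs, sq_abs]
    congr 1
    ring
  rw [e1, e2, ← ENNReal.tsum_add, landauEnergy]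
  refine tsum_congr fun n => ?_
  rw [hA]
  simp only
  rw [Lp.enorm_sq_eq_lintegral, ← lintegral_const_mul' _ _ ENNReal.ofReal_ne_top,
    ← lintegral_add_left']
  · refine lintegral_congr fun y => ?_
    rw [← add_mul, ENNReal.ofReal_add (by rw [landauLevel]; positivity) (by positivity)]
  · exact ((Lp.aestronglyMeasurable _).enorm.pow_const 2).const_mul _

theorem landauEnergy_eq (hb : 0 < b) {ψ : L2R3} {g : Fin 3 → L2R3}
    (h : ∀ j, IsWeakMagMomentum b j ψ (g j)) : landauForm b ψ = landauEnergy hb ψ := by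
  rw [← (h 0).sum_enorm_sq hb (h 1) (h 2), landauForm, Fin.sum_univ_three,
    (h 0).magMomentumNormSq_eq hb, (h 1).magMomentumNormSq_eq hb, (h 2).magMomentumNormSq_eq hb]

/-- If some weak momentum does not exist, the form is infinite. This inequality is all that the
lower bound needs. -/
theorem landauEnergy_le (hb : 0 < b) (ψ : L2R3) : landauEnergy hb ψ ≤ landauForm b ψ := by
  by_cases h : ∀ j, ∃ g, IsWeakMagMomentum b j ψ g
  · choose g hg using h
    exact (landauEnergy_eq hb hg).ge
  · push Not at h
    obtain ⟨j, hj⟩ := h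
    have h1 : magMomentumNormSq b j ψ = ⊤ := by simp [magMomentumNormSq, hj]
    have h2 : landauForm b ψ = ⊤ := ENNReal.sum_eq_top.2 ⟨j, Finset.mem_univ _, h1⟩
    rw [h2]
    exact le_top

theorem isWeakMagMomentum_iff_inner {j : Fin 3} {ψ g : L2R3} : IsWeakMagMomentum b j ψ g ↔
    ∀ φ : 𝓢(R3, ℂ), inner ℂ ((schwartzMomentum b j φ).toLp 2 volume) ψ
      = inner ℂ (φ.toLp 2 volume) g := by
  refine ⟨fun h φ => h.inner_schwartz φ, fun h φ hφ hs => ?_⟩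
  have h1 := h (hs.toSchwartzMap hφ)
  rw [L2.inner_def, L2.inner_def] at h1
  refine Eq.trans (integral_congr_ae ?_) (h1.trans (integral_congr_ae ?_))
  · filter_upwards [(schwartzMomentum b j (hs.toSchwartzMap hφ)).coeFn_toLp 2 volume] with x hx
    rw [hx, schwartzMomentum_apply, RCLike.inner_apply, mul_comm]
    rfl
  · filter_upwards [(hs.toSchwartzMap hφ).coeFn_toLp 2 volume] with x hx
    rw [hx, RCLike.inner_apply, mul_comm]
    rfl

theorem exists_isWeakMagMomentum_sum {ι : Type*} {j : Fin 3} (s : Finset ι) {ψ : ι → L2R3}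
    (h : ∀ i, ∃ g, IsWeakMagMomentum b j (ψ i) g) :
    ∃ g, IsWeakMagMomentum b j (∑ i ∈ s, ψ i) g := by
  choose g hg using h
  refine ⟨∑ i ∈ s, g i, isWeakMagMomentum_iff_inner.2 fun φ => ?_⟩
  rw [inner_sum, inner_sum]
  exact Finset.sum_congr rfl fun i _ => (hg i).inner_schwartz φ

/-- The candidates come from transposing the ladder relations for Schwartz test functions. The
existence of `w` says that u has finite third momentum. -/
theorem exists_isWeakMagMomentum_landauS (hb : 0 < b) (n : ℕ) (j : Fin 3)
    {u w : Lp ℂ 2 (volume : Measure (ℝ × ℝ))}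
    (hw : w =ᵐ[volume] fun y => (2 * Real.pi * y.2 : ℂ) * u y) :
    ∃ g, IsWeakMagMomentum b j (landauS hb n u) g := by
  have h2 : conj (2 : ℂ) = 2 := map_ofNat _ 2
  fin_cases j
  · refine ⟨(√b : ℂ) • ((√(2 * n) / 2 : ℂ) • landauS hb (n - 1) u
      + (√(2 * (n + 1)) / 2 : ℂ) • landauS hb (n + 1) u), isWeakMagMomentum_iff_inner.2 fun φ => ?_⟩
    rw [← inner_landauC_left]
    have h := (isWeakMagMomentum_schwartz b 0 φ).landauC_zero hb n
    simp only [Fin.zero_eta, h, inner_smul_left, inner_smul_right, inner_add_left, inner_add_right,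
      inner_landauC_left, map_div₀, Complex.conj_ofReal, h2]
  · refine ⟨(Complex.I * √b : ℂ) • ((√(2 * n) / 2 : ℂ) • landauS hb (n - 1) u
      - (√(2 * (n + 1)) / 2 : ℂ) • landauS hb (n + 1) u), isWeakMagMomentum_iff_inner.2 fun φ => ?_⟩
    rw [← inner_landauC_left]
    have h := (isWeakMagMomentum_schwartz b 1 φ).landauC_one hb n
    simp only [Fin.mk_one, h, inner_smul_left, inner_smul_right, inner_sub_left, inner_sub_right,
      inner_landauC_left, map_div₀, map_mul, map_neg, Complex.conj_I, Complex.conj_ofReal, h2,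
      neg_neg]
  · refine ⟨landauS hb n w, isWeakMagMomentum_iff_inner.2 fun φ => ?_⟩
    rw [← inner_landauC_left, ← inner_landauC_left, L2.inner_def, L2.inner_def]
    refine integral_congr_ae ?_
    filter_upwards [hw, (isWeakMagMomentum_schwartz b 2 φ).landauC_two hb n] with y h3 h4
    change inner ℂ ((landauC hb n ((schwartzMomentum b 2 φ).toLp 2 volume)) y) _ = _
    rw [h3, h4]
    simp only [RCLike.inner_apply, map_mul, Complex.conj_ofReal, h2]
    ring

/-! ### Functions of the Landau operator and of the third momentum -/

/-- Bounded measurable real functions on the line. -/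
structure BddMult (m : ℝ → ℝ) : Prop where
  measurable : Measurable m
  bound : ∃ C : ℝ, ∀ k, |m k| ≤ C

theorem BddMult.bddMeas {m : ℝ → ℝ} (hm : BddMult m) : BddMeas fun y : ℝ × ℝ => (m y.2 : ℂ) := by
  obtain ⟨C, hC⟩ := hm.bound
  refine ⟨Complex.measurable_ofReal.comp (hm.measurable.comp measurable_snd), C, fun y => ?_⟩
  rw [Complex.norm_real]
  exact hC _

/-- The operator `∑ₙ Sₙ mₙ(k) Cₙ`, the sum being over `n < N`. -/
def landauOp (hb : 0 < b) (N : ℕ) (m : ℕ → ℝ → ℝ) (hm : ∀ n, BddMult (m n)) : L2R3 →L[ℂ] L2R3 :=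
  ∑ n ∈ Finset.range N, landauS hb n ∘L mulOp volume _ (hm n).bddMeas ∘L landauC hb n

theorem landauOp_apply (hb : 0 < b) (N : ℕ) {m : ℕ → ℝ → ℝ} (hm : ∀ n, BddMult (m n)) (f : L2R3) :
    landauOp hb N m hm f
      = ∑ n ∈ Finset.range N, landauS hb n (mulOp volume _ (hm n).bddMeas (landauC hb n f)) := by
  simp [landauOp]

theorem landauC_landauOp (hb : 0 < b) (N : ℕ) {m : ℕ → ℝ → ℝ} (hm : ∀ n, BddMult (m n))
    (k : ℕ) (f : L2R3) : landauC hb k (landauOp hb N m hm f)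
      = if k < N then mulOp volume _ (hm k).bddMeas (landauC hb k f) else 0 := by
  rw [landauOp_apply, map_sum]
  simp only [landauC_landauS, Finset.sum_ite_eq, Finset.mem_range]

theorem landauOp_landauOp (hb : 0 < b) (N : ℕ) {m m' m'' : ℕ → ℝ → ℝ} (hm : ∀ n, BddMult (m n))
    (hm' : ∀ n, BddMult (m' n)) (hm'' : ∀ n, BddMult (m'' n))
    (h : ∀ n k, m n k * m' n k = m'' n k) (f : L2R3) :
    landauOp hb N m hm (landauOp hb N m' hm' f) = landauOp hb N m'' hm'' f := by
  refine landauC_injective hb fun n => ?_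
  rw [landauC_landauOp, landauC_landauOp, landauC_landauOp]
  split_ifs
  · exact mulOp_mulOp _ _ _ (fun y => by rw [← h, Complex.ofReal_mul]) _
  · rfl

theorem inner_landauOp_left (hb : 0 < b) (N : ℕ) {m : ℕ → ℝ → ℝ} (hm : ∀ n, BddMult (m n))
    (f g : L2R3) : inner ℂ (landauOp hb N m hm f) g = inner ℂ f (landauOp hb N m hm g) := by
  rw [landauOp_apply, landauOp_apply, sum_inner, inner_sum]
  refine Finset.sum_congr rfl fun n _ => ?_
  rw [← inner_landauC_right, inner_mulOp_left _ (hm n).bddMeas (fun y => by simp),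
    inner_landauC_left]

theorem isSelfAdjoint_landauOp (hb : 0 < b) (N : ℕ) {m : ℕ → ℝ → ℝ} (hm : ∀ n, BddMult (m n)) :
    IsSelfAdjoint (landauOp hb N m hm) :=
  ContinuousLinearMap.isSelfAdjoint_iff_isSymmetric.2 fun f g => inner_landauOp_left hb N hm f g

theorem enorm_sq_landauOp (hb : 0 < b) (N : ℕ) {m : ℕ → ℝ → ℝ} (hm : ∀ n, BddMult (m n))
    (f : L2R3) : ‖landauOp hb N m hm f‖ₑ ^ 2
      = ∑ n ∈ Finset.range N, ∫⁻ y, ENNReal.ofReal (m n y.2 ^ 2) * ‖landauC hb n f y‖ₑ ^ 2 := by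
  rw [← tsum_enorm_landauC_sq hb, tsum_eq_sum (s := Finset.range N)]
  · refine Finset.sum_congr rfl fun n hn => ?_
    rw [landauC_landauOp, if_pos (Finset.mem_range.1 hn), enorm_sq_mulOp]
    refine lintegral_congr fun y => ?_
    rw [← ofReal_norm (m n y.2 : ℂ), ← ENNReal.ofReal_pow (norm_nonneg _),
      Complex.norm_real, Real.norm_eq_abs, sq_abs]
  · intro n hn
    rw [landauC_landauOp, if_neg (by simpa using hn)]
    simp

/-- Boundedness of 2πk mₙ(k) puts the range of the operator in the form domain, where form and
spectral energy agree. -/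
theorem landauForm_landauOp (hb : 0 < b) (N : ℕ) {m m' : ℕ → ℝ → ℝ} (hm : ∀ n, BddMult (m n))
    (hmk : ∀ n, BddMult fun k => 2 * Real.pi * k * m n k) (hm' : ∀ n, BddMult (m' n))
    (h : ∀ n k, m' n k ^ 2 = (landauLevel b n + 4 * Real.pi ^ 2 * k ^ 2) * m n k ^ 2) (f : L2R3) :
    landauForm b (landauOp hb N m hm f) = ‖landauOp hb N m' hm' f‖ₑ ^ 2 := by
  have hw : ∀ j, ∃ g, IsWeakMagMomentum b j (landauOp hb N m hm f) g := fun j => by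
    rw [landauOp_apply]
    refine exists_isWeakMagMomentum_sum _ fun n => exists_isWeakMagMomentum_landauS hb n j
      (w := mulOp volume _ (hmk n).bddMeas (landauC hb n f)) ?_
    filter_upwards [coeFn_mulOp (hm n).bddMeas (landauC hb n f),
      coeFn_mulOp (hmk n).bddMeas (landauC hb n f)] with y h1 h2
    rw [h1, h2]
    push_cast
    ring
  choose g hg using hw
  rw [landauEnergy_eq hb hg, enorm_sq_landauOp, landauEnergy, tsum_eq_sum (s := Finset.range N)]
  · refine Finset.sum_congr rfl fun n hn => lintegral_congr_ae ?_
    rw [landauC_landauOp, if_pos (Finset.mem_range.1 hn)]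
    filter_upwards [coeFn_mulOp (hm n).bddMeas (landauC hb n f)] with y h1
    have h0 : 0 ≤ landauLevel b n + 4 * Real.pi ^ 2 * y.2 ^ 2 := by rw [landauLevel]; positivity
    rw [h1, enorm_mul, mul_pow, ← ofReal_norm (m n y.2 : ℂ),
      ← ENNReal.ofReal_pow (norm_nonneg _), Complex.norm_real, Real.norm_eq_abs, sq_abs,
      ← mul_assoc, ← ENNReal.ofReal_mul h0, ← h]
  · intro n hn
    rw [landauC_landauOp, if_neg (by simpa using hn)]
    rw [lintegral_eq_zero_iff' ?_]
    · filter_upwards [Lp.coeFn_zero ℂ 2 (volume : Measure (ℝ × ℝ))] with y hy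
      rw [hy]
      simp
    · refine AEMeasurable.mul (by fun_prop) ((Lp.aestronglyMeasurable _).enorm.pow_const 2)

end

/-! ### Magnetic translations, localisation to cubes and traces per unit volume. -/

noncomputable section

open scoped FourierTransform SchwartzMap LineDeriv

/-! ### Translations with a phase -/

section TranslOp

variable {G : Type*} [MeasurableSpace G] [AddGroup G] [MeasurableAdd G]
  {μ : Measure G} [μ.IsAddRightInvariant]

/-- The operator `f ↦ p(x) f(x - v)` on `L²`. -/
def translOp (μ : Measure G) [μ.IsAddRightInvariant] (p : G → ℂ) (hp : BddMeas p) (v : G) :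
    Lp ℂ 2 μ →L[ℂ] Lp ℂ 2 μ :=
  mulOp μ p hp ∘L (Lp.compMeasurePreservingₗᵢ ℂ (fun x => x - v)
    (measurePreserving_sub_right μ v)).toContinuousLinearMap

theorem coeFn_translOp {p : G → ℂ} (hp : BddMeas p) (v : G) (f : Lp ℂ 2 μ) :
    translOp μ p hp v f =ᵐ[μ] fun x => p x * f (x - v) := by
  filter_upwards [coeFn_mulOp hp (Lp.compMeasurePreserving _ (measurePreserving_sub_right μ v) f),
    Lp.coeFn_compMeasurePreserving f (measurePreserving_sub_right μ v)] with x h1 h2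
  refine Eq.trans h1 ?_
  rw [h2]
  rfl

theorem ae_comp_sub {P : G → Prop} (h : ∀ᵐ x ∂μ, P x) (v : G) : ∀ᵐ x ∂μ, P (x - v) :=
  (measurePreserving_sub_right μ v).quasiMeasurePreserving.ae h

theorem norm_translOp {p : G → ℂ} (hp : BddMeas p) (h1 : ∀ x, ‖p x‖ = 1) (v : G) (f : Lp ℂ 2 μ) :
    ‖translOp μ p hp v f‖ = ‖f‖ := by
  have h : ‖translOp μ p hp v f‖ₑ ^ 2 = ‖f‖ₑ ^ 2 := by
    rw [Lp.enorm_sq_eq_lintegral, Lp.enorm_sq_eq_lintegral]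
    rw [← lintegral_sub_right_eq_self (fun x => ‖f x‖ₑ ^ 2) v]
    refine lintegral_congr_ae ?_
    filter_upwards [coeFn_translOp hp v f] with x hx
    rw [hx, enorm_mul, ← ofReal_norm (p x), h1, ENNReal.ofReal_one, one_mul]
  have h2 := (ENNReal.pow_right_strictMono two_ne_zero).injective h
  simpa using congrArg ENNReal.toReal h2

end TranslOp

variable {b : ℝ}

/-! ### Magnetic translations -/

theorem bddMeas_magPhase (b : ℝ) (R : R3) :
    BddMeas fun x : R3 => Complex.exp (-Complex.I * (b * R 0 * x 1 : ℝ)) := by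
  refine ⟨(by fun_prop : Continuous fun x : R3 =>
    Complex.exp (-Complex.I * (b * R 0 * x 1 : ℝ))).measurable, 1, fun x => ?_⟩
  rw [Complex.norm_exp]
  simp

/-- The magnetic translation as a bounded operator. -/
def magTransl (b : ℝ) (R : R3) : L2R3 →L[ℂ] L2R3 := translOp volume _ (bddMeas_magPhase b R) R

theorem coeFn_magTransl (b : ℝ) (R : R3) (f : L2R3) : magTransl b R f =ᵐ[volume]
    fun x => Complex.exp (-Complex.I * (b * R 0 * x 1 : ℝ)) * f (x - R) :=
  coeFn_translOp _ _ _

theorem magTransl_apply (b : ℝ) (R : R3) (f : L2R3) : magTransl b R f = magTranslation b R f :=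
  Lp.ext ((coeFn_magTransl b R f).trans (memLp_magTranslation b R f).coeFn_toLp.symm)

theorem norm_magTransl (b : ℝ) (R : R3) (f : L2R3) : ‖magTransl b R f‖ = ‖f‖ :=
  norm_translOp _ (fun x => by rw [Complex.norm_exp]; simp) _ _

theorem magTransl_magTransl_neg (b : ℝ) (R : R3) (f : L2R3) :
    magTransl b R (magTransl b (-R) f) = Complex.exp (-Complex.I * (b * R 0 * R 1 : ℝ)) • f := by
  refine Lp.ext ?_
  filter_upwards [coeFn_magTransl b R (magTransl b (-R) f),
    ae_comp_sub (coeFn_magTransl b (-R) f) R, Lp.coeFn_smul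
      (Complex.exp (-Complex.I * (b * R 0 * R 1 : ℝ))) f] with x h1 h2 h3
  rw [h1, h2, h3, Pi.smul_apply, smul_eq_mul, ← mul_assoc, ← Complex.exp_add]
  congr 2
  · simp
    ring
  · simp

/-- Magnetic translations form a projective representation: the adjoint, being the inverse, is the
translation by -R up to a phase. -/
theorem adjoint_magTransl (b : ℝ) (R : R3) (f : L2R3) :
    (magTransl b R).adjoint f
      = Complex.exp (Complex.I * (b * R 0 * R 1 : ℝ)) • magTransl b (-R) f := by
  have h1 : ∀ g, (magTransl b R).adjoint (magTransl b R g) = g := fun g => by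
    have := ContinuousLinearMap.norm_map_iff_adjoint_comp_self (magTransl b R)
    have h2 := this.1 (norm_magTransl b R)
    exact DFunLike.congr_fun h2 g
  have h2 := congrArg (magTransl b R).adjoint (magTransl_magTransl_neg b R f)
  rw [h1, map_smul] at h2
  rw [h2, smul_smul, ← Complex.exp_add]
  simp

/-! ### Magnetic translations in the spectral representation -/

theorem bddMeas_coeffPhase (b : ℝ) (R : R3) : BddMeas fun y : ℝ × ℝ =>
    Complex.exp (-Complex.I * (2 * Real.pi * (R 1 * y.1 + R 2 * y.2) + b * R 0 * R 1 : ℝ)) := by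
  refine ⟨(by fun_prop : Continuous fun y : ℝ × ℝ => Complex.exp (-Complex.I *
    (2 * Real.pi * (R 1 * y.1 + R 2 * y.2) + b * R 0 * R 1 : ℝ))).measurable, 1, fun x => ?_⟩
  rw [Complex.norm_exp]
  simp

/-- The action of a magnetic translation on the Landau coefficients. -/
def coeffTransl (b : ℝ) (R : R3) :
    Lp ℂ 2 (volume : Measure (ℝ × ℝ)) →L[ℂ] Lp ℂ 2 (volume : Measure (ℝ × ℝ)) :=
  translOp volume _ (bddMeas_coeffPhase b R) (-(b * R 0 / (2 * Real.pi)), 0)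

theorem coeFn_coeffTransl (b : ℝ) (R : R3) (u : Lp ℂ 2 (volume : Measure (ℝ × ℝ))) :
    coeffTransl b R u =ᵐ[volume] fun y =>
      Complex.exp (-Complex.I * (2 * Real.pi * (R 1 * y.1 + R 2 * y.2) + b * R 0 * R 1 : ℝ))
        * u (y - (-(b * R 0 / (2 * Real.pi)), 0)) :=
  coeFn_translOp _ _ _

/-- The shift moves only the first variable of `y`, and the multiplier depends only on the second.
-/
theorem coeffTransl_mulOp (b : ℝ) (R : R3) {m : ℝ → ℝ} (hm : BddMult m)
    (u : Lp ℂ 2 (volume : Measure (ℝ × ℝ))) :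
    coeffTransl b R (mulOp volume _ hm.bddMeas u) = mulOp volume _ hm.bddMeas (coeffTransl b R u) := by
  refine Lp.ext ?_
  filter_upwards [coeFn_coeffTransl b R (mulOp volume _ hm.bddMeas u),
    ae_comp_sub (coeFn_mulOp hm.bddMeas u) (-(b * R 0 / (2 * Real.pi)), 0),
    coeFn_mulOp hm.bddMeas (coeffTransl b R u), coeFn_coeffTransl b R u] with y h1 h2 h3 h4
  rw [h1, h2, h3, h4]
  simp only [Prod.snd_sub, sub_zero]
  ring

theorem landauKernel_add (hb : 0 < b) (n : ℕ) (y : ℝ × ℝ) (x R : R3) :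
    landauKernel b n y (x + R) * Complex.exp (-Complex.I * (b * R 0 * (x + R) 1 : ℝ))
      = Complex.exp (-Complex.I * (2 * Real.pi * (R 1 * y.1 + R 2 * y.2) + b * R 0 * R 1 : ℝ))
        * landauKernel b n (y - (-(b * R 0 / (2 * Real.pi)), 0)) x := by
  have hpi := Real.pi_ne_zero
  have e1 : (x + R) 0 + 2 * Real.pi * y.1 / b
      = x 0 + 2 * Real.pi * (y.1 - -(b * R 0 / (2 * Real.pi))) / b := by
    simp only [PiLp.add_apply]
    field_simp
    ring
  rw [landauKernel, landauKernel, e1]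
  simp only [Prod.fst_sub, Prod.snd_sub, PiLp.add_apply, sub_zero]
  rw [mul_right_comm, ← Complex.exp_add, ← mul_assoc, ← Complex.exp_add]
  congr 2
  have hpi' : (Real.pi : ℂ) ≠ 0 := by exact_mod_cast hpi
  push_cast
  field_simp
  ring

/-- On Schwartz functions the kernel formula holds and the claim is its covariance
`landauKernel_add` after the substitution x ↦ x + R; density does the rest. -/
theorem landauC_magTransl (hb : 0 < b) (n : ℕ) (R : R3) (f : L2R3) :
    landauC hb n (magTransl b R f) = coeffTransl b R (landauC hb n f) := by
  refine congrFun ((SchwartzMap.denseRange_toLpCLM (E := R3) (F := ℂ) (p := 2) (μ := volume)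
    (by simp)).equalizer (g := fun f => landauC hb n (magTransl b R f))
    (h := fun f => coeffTransl b R (landauC hb n f)) (by fun_prop) (by fun_prop) ?_) f
  funext φ
  simp only [Function.comp_apply, SchwartzMap.toLpCLM_apply]
  set f : L2R3 := φ.toLp 2 volume
  have hf : Integrable f := φ.integrable.congr (φ.coeFn_toLp 2 volume).symm
  have hf' : Integrable (magTransl b R f) := by
    refine Integrable.congr ?_ (coeFn_magTransl b R f).symm
    refine (hf.comp_sub_right R).bdd_mul (c := 1)
      (bddMeas_magPhase b R).measurable.aestronglyMeasurable (Eventually.of_forall fun x => ?_)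
    rw [Complex.norm_exp]
    simp
  refine Lp.ext ?_
  filter_upwards [landauC_ae_eq hb n _ hf', coeFn_coeffTransl b R (landauC hb n f),
    ae_comp_sub (landauC_ae_eq hb n f hf) (-(b * R 0 / (2 * Real.pi)), 0)] with y h1 h2 h3
  rw [h1, h2, h3, ← integral_const_mul, integral_congr_ae ((coeFn_magTransl b R f).mono fun x hx =>
    congrArg (landauKernel b n y x * ·) hx), ← integral_add_right_eq_self _ R]
  refine integral_congr_ae (Eventually.of_forall fun x => ?_)
  simp only
  rw [← mul_assoc, landauKernel_add hb, add_sub_cancel_right, mul_assoc]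

theorem landauOp_magTransl (hb : 0 < b) (N : ℕ) {m : ℕ → ℝ → ℝ} (hm : ∀ n, BddMult (m n)) (R : R3)
    (f : L2R3) :
    landauOp hb N m hm (magTransl b R f) = magTransl b R (landauOp hb N m hm f) := by
  refine landauC_injective hb fun n => ?_
  rw [landauC_landauOp, landauC_magTransl, landauC_magTransl, landauC_landauOp]
  split_ifs
  · rw [coeffTransl_mulOp b R (hm n)]
  · rw [map_zero]

/-! ### Localisation to cubes -/

theorem bddMeas_indicator_cube (L : ℝ) : BddMeas ((cube L).indicator fun _ => (1 : ℂ)) := by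
  refine ⟨measurable_const.indicator (measurableSet_cube L), 1, fun x => ?_⟩
  refine (norm_indicator_le_norm_self _ _).trans ?_
  simp

/-- The restriction to the cube `Γ_L` as a bounded operator. -/
def cubeOp (L : ℝ) : L2R3 →L[ℂ] L2R3 := mulOp volume _ (bddMeas_indicator_cube L)

theorem coeFn_cubeOp (L : ℝ) (f : L2R3) : cubeOp L f =ᵐ[volume] (cube L).indicator f := by
  filter_upwards [coeFn_mulOp (bddMeas_indicator_cube L) f] with x hx
  refine hx.trans ?_
  by_cases h : x ∈ cube L <;> simp [h]

theorem cubeOp_apply (L : ℝ) (f : L2R3) : cubeOp L f = cubeProj L f :=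
  Lp.ext ((coeFn_cubeOp L f).trans
    ((Lp.memLp f).indicator (measurableSet_cube L)).coeFn_toLp.symm)

theorem adjoint_cubeOp (L : ℝ) : (cubeOp L).adjoint = cubeOp L := by
  refine (ContinuousLinearMap.eq_adjoint_iff _ _).2 (fun f g => ?_) |>.symm
  refine inner_mulOp_left _ _ (fun x => ?_) f g
  by_cases h : x ∈ cube L <;> simp [h]

theorem enorm_sq_cubeOp (L : ℝ) (f : L2R3) :
    ‖cubeOp L f‖ₑ ^ 2 = ∫⁻ x in cube L, ‖f x‖ₑ ^ 2 := by
  rw [Lp.enorm_sq_eq_lintegral, ← lintegral_indicator (measurableSet_cube L)]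
  refine lintegral_congr_ae ?_
  filter_upwards [coeFn_cubeOp L f] with x hx
  rw [hx]
  by_cases h : x ∈ cube L <;> simp [h]

theorem enorm_sq_cubeOp_magTransl (b L : ℝ) (R : R3) (f : L2R3) :
    ‖cubeOp L (magTransl b R f)‖ₑ ^ 2 = ∫⁻ x in cube L, ‖f (x - R)‖ₑ ^ 2 := by
  rw [enorm_sq_cubeOp]
  refine lintegral_congr_ae (ae_restrict_of_ae ?_)
  filter_upwards [coeFn_magTransl b R f] with x hx
  rw [hx, enorm_mul, ← ofReal_norm (Complex.exp _), Complex.norm_exp]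
  simp

theorem measurable_enorm_sq_sub (f : L2R3) :
    Measurable fun p : R3 × R3 => ‖f (p.2 - p.1)‖ₑ ^ 2 :=
  (((Lp.stronglyMeasurable f).measurable.comp
    (measurable_snd.sub measurable_fst)).enorm).pow_const 2

theorem measurable_enorm_sq_cubeOp_magTransl (b L : ℝ) (f : L2R3) :
    Measurable fun R : R3 => ‖cubeOp L (magTransl b R f)‖ₑ ^ 2 := by
  simp_rw [enorm_sq_cubeOp_magTransl]
  exact (measurable_enorm_sq_sub f).lintegral_prod_right'

/-- By Tonelli: for each fixed x in the cube, averaging |f(x - R)|² over R gives the whole norm of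
f. -/
theorem lintegral_enorm_sq_cubeOp_magTransl (b L : ℝ) (f : L2R3) :
    ∫⁻ R, ‖cubeOp L (magTransl b R f)‖ₑ ^ 2 = volume (cube L) * ‖f‖ₑ ^ 2 := by
  simp_rw [enorm_sq_cubeOp_magTransl]
  rw [lintegral_lintegral_swap (measurable_enorm_sq_sub f).aemeasurable]
  have h : ∀ x : R3, ∫⁻ R, ‖f (x - R)‖ₑ ^ 2 = ‖f‖ₑ ^ 2 := fun x => by
    rw [Lp.enorm_sq_eq_lintegral]
    exact lintegral_sub_left_eq_self (fun x => ‖f x‖ₑ ^ 2) x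
  simp_rw [h]
  rw [setLIntegral_const, mul_comm]

theorem volume_cube {L : ℝ} (hL : 0 ≤ L) : volume (cube L) = ENNReal.ofReal (L ^ 3) := by
  have h := (EuclideanSpace.volume_preserving_symm_measurableEquiv_toLp (Fin 3)).measure_preimage
    (s := Set.Icc (fun _ => -(L / 2)) fun _ => L / 2) measurableSet_Icc.nullMeasurableSet
  have e : cube L = ⇑(MeasurableEquiv.toLp 2 (Fin 3 → ℝ)).symm ⁻¹'
      (Set.Icc (fun _ => -(L / 2)) fun _ => L / 2) := by
    ext x
    simp [cube, Pi.le_def, forall_and]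
  rw [e, h, Real.volume_Icc_pi]
  simp [ENNReal.ofReal_pow hL]

/-- Cyclicity of the trace per unit volume. -/
theorem hsSq_comp_cubeOp_eq_adjoint {A : L2R3 →L[ℂ] L2R3}
    (hA : ∀ R f, A (magTransl b R f) = magTransl b R (A f)) {L : ℝ} (hL : 0 < L) :
    hsSq (A ∘L cubeOp L) = hsSq (A.adjoint ∘L cubeOp L) := by
  have : Fact ((2 : ℝ≥0∞) ≠ ⊤) := ⟨by simp⟩
  obtain ⟨w, e, hw⟩ := exists_countable_hilbertBasis (H := L2R3)
  -- Averaging over all translations removes the outer localisation, at the price of the volume of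
  -- the cube.
  have h1 : ∀ B : L2R3 →L[ℂ] L2R3, ∫⁻ R, hsSq (cubeOp L ∘L magTransl b R ∘L B)
      = volume (cube L) * hsSq B := fun B => by
    simp_rw [hsSq_eq_tsum _ e, ContinuousLinearMap.comp_apply]
    rw [lintegral_tsum fun j => (measurable_enorm_sq_cubeOp_magTransl b L _).aemeasurable]
    simp_rw [lintegral_enorm_sq_cubeOp_magTransl]
    rw [ENNReal.tsum_mul_left]
  -- The adjoint translations give the same average, since they are the translations by -R up to a
  -- phase.
  have h2 : ∀ B : L2R3 →L[ℂ] L2R3, ∫⁻ R, hsSq (cubeOp L ∘L (magTransl b R).adjoint ∘L B)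
      = volume (cube L) * hsSq B := fun B => by
    rw [← h1, ← lintegral_neg_eq_self]
    refine lintegral_congr fun R => ?_
    rw [hsSq_eq_tsum _ e, hsSq_eq_tsum _ e]
    refine tsum_congr fun j => ?_
    simp only [ContinuousLinearMap.comp_apply]
    rw [adjoint_magTransl, map_smul, enorm_sq_smul, neg_neg, Complex.norm_exp]
    simp
  -- Commute A past the translation and take adjoints; the localisation on both sides of the
  -- operator makes the expression symmetric. Integrating over R and cancelling the finite positive
  -- volume proves the claim.
  have h3 : ∀ R, hsSq (cubeOp L ∘L magTransl b R ∘L A ∘L cubeOp L)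
      = hsSq (cubeOp L ∘L (magTransl b R).adjoint ∘L A.adjoint ∘L cubeOp L) := fun R => by
    have e1 : cubeOp L ∘L magTransl b R ∘L A ∘L cubeOp L
        = cubeOp L ∘L A ∘L magTransl b R ∘L cubeOp L := by
      ext1 f
      simp only [ContinuousLinearMap.comp_apply, hA]
    rw [e1, ← hsSq_adjoint]
    simp only [ContinuousLinearMap.adjoint_comp, adjoint_cubeOp, ContinuousLinearMap.comp_assoc]
  have h4 := h1 (A ∘L cubeOp L)
  simp_rw [h3] at h4
  rw [h2 (A.adjoint ∘L cubeOp L), volume_cube hL.le] at h4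
  refine ((ENNReal.mul_right_inj ?_ ENNReal.ofReal_ne_top).1 h4).symm
  exact (ENNReal.ofReal_pos.2 (by positivity)).ne'

end

noncomputable section

open scoped FourierTransform SchwartzMap LineDeriv

variable {b : ℝ}

/-! ### Traces per unit volume -/

theorem norm_hermFourier_le (b : ℝ) (n : ℕ) (t : ℝ) :
    ‖hermFourier b n t‖ ≤ ∫ s, ‖(hermFn (hermScale b) n s : ℂ)‖ :=
  VectorFourier.norm_fourierIntegral_le_integral_norm _ _ _ _ _

theorem norm_landauKernel (b : ℝ) (n : ℕ) (y : ℝ × ℝ) (x : R3) :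
    ‖landauKernel b n y x‖ = ‖hermFourier b n (x 0 + 2 * Real.pi * y.1 / b)‖ := by
  rw [landauKernel, norm_mul, Complex.norm_exp_ofReal_mul_I, one_mul]

theorem memLp_landauKernel (hb : 0 < b) (n : ℕ) (y : ℝ × ℝ) {L : ℝ} (hL : 0 ≤ L) :
    MemLp ((cube L).indicator fun x => conj (landauKernel b n y x)) 2 volume := by
  rw [memLp_indicator_iff_restrict (measurableSet_cube L)]
  have : IsFiniteMeasure ((volume : Measure R3).restrict (cube L)) :=
    ⟨by rw [Measure.restrict_apply_univ, volume_cube hL]; exact ENNReal.ofReal_lt_top⟩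
  have hc : Continuous fun x => landauKernel b n y x :=
    (continuous_landauKernel hb n).comp (by fun_prop : Continuous fun x : R3 => (y, x))
  refine MemLp.of_bound (Complex.continuous_conj.comp hc).aestronglyMeasurable
    (∫ s, ‖(hermFn (hermScale b) n s : ℂ)‖) (Eventually.of_forall fun x => ?_)
  rw [RCLike.norm_conj, norm_landauKernel]
  exact norm_hermFourier_le b n _

theorem integrable_cubeOp {L : ℝ} (hL : 0 ≤ L) (f : L2R3) : Integrable (cubeOp L f) := by
  refine Integrable.congr ?_ (coeFn_cubeOp L f).symm
  rw [integrable_indicator_iff (measurableSet_cube L)]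
  have : IsFiniteMeasure ((volume : Measure R3).restrict (cube L)) :=
    ⟨by rw [Measure.restrict_apply_univ, volume_cube hL]; exact ENNReal.ofReal_lt_top⟩
  exact ((Lp.memLp f).restrict (cube L)).integrable (by norm_num)

theorem landauC_cubeOp (hb : 0 < b) (n : ℕ) {L : ℝ} (hL : 0 ≤ L) (f : L2R3) :
    landauC hb n (cubeOp L f) =ᵐ[volume] fun y => inner ℂ ((memLp_landauKernel hb n y hL).toLp _) f := by
  filter_upwards [landauC_ae_eq hb n _ (integrable_cubeOp hL f)] with y hy
  rw [hy, L2.inner_def]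
  refine integral_congr_ae ?_
  filter_upwards [coeFn_cubeOp L f, (memLp_landauKernel hb n y hL).coeFn_toLp] with x h1 h2
  rw [h1, h2, RCLike.inner_apply]
  by_cases h : x ∈ cube L <;> simp [h, mul_comm]

/-- For fixed y, evaluating the localised coefficient is pairing with a vector of L², so Parseval
gives the squared norm of the kernel on the cube. Its modulus does not involve `y.2`. -/
theorem tsum_enorm_landauC_cubeOp (hb : 0 < b) (n : ℕ) {L : ℝ} (hL : 0 ≤ L) {ι : Type*} [Countable ι]
    (e : HilbertBasis ι ℂ L2R3) : ∀ᵐ y, ∑' j, ‖landauC hb n (cubeOp L (e j)) y‖ₑ ^ 2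
      = ∫⁻ x in cube L, ‖hermFourier b n (x 0 + 2 * Real.pi * y.1 / b)‖ₑ ^ 2 := by
  filter_upwards [ae_all_iff.2 fun j => landauC_cubeOp hb n hL (e j)] with y hy
  simp_rw [hy]
  set κ := (memLp_landauKernel hb n y hL).toLp _ with hκ
  have h1 : ∑' j, ‖inner ℂ κ (e j)‖ₑ ^ 2 = ‖κ‖ₑ ^ 2 := by
    rw [← e.tsum_enorm_inner_sq κ]
    refine tsum_congr fun j => ?_
    rw [← inner_conj_symm, ← ofReal_norm, RCLike.norm_conj, ofReal_norm]
  rw [h1, Lp.enorm_sq_eq_lintegral, ← lintegral_indicator (measurableSet_cube L)]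
  refine lintegral_congr_ae ?_
  filter_upwards [(memLp_landauKernel hb n y hL).coeFn_toLp] with x hx
  rw [hκ, hx]
  by_cases h : x ∈ cube L
  · simp only [h, Set.indicator_of_mem]
    rw [← ofReal_norm, RCLike.norm_conj, norm_landauKernel, ofReal_norm]
  · simp [h]

/-- Plancherel and the Jacobian of t ↦ 2πt/b; the result is the degeneracy of a level per unit area.
-/
theorem lintegral_hermFourier_affine (hb : 0 < b) (n : ℕ) (s : ℝ) :
    ∫⁻ t, ‖hermFourier b n (s + 2 * Real.pi * t / b)‖ₑ ^ 2 = ENNReal.ofReal (b / (2 * Real.pi)) := by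
  have hc : (b / (2 * Real.pi)) ≠ 0 := by positivity
  have hm : Measurable fun t => ‖hermFourier b n t‖ₑ ^ 2 :=
    (continuous_hermFourier hb n).measurable.enorm.pow_const 2
  have h1 := Real.map_volume_mul_left (a := 2 * Real.pi / b) (by positivity)
  have h2 := congrArg (fun μ => ∫⁻ t, ‖hermFourier b n (s + t)‖ₑ ^ 2 ∂μ) h1
  have hm' : Measurable fun t => ‖hermFourier b n (s + t)‖ₑ ^ 2 := hm.comp (measurable_const_add s)
  rw [lintegral_map hm' (measurable_const_mul _),
    lintegral_smul_measure, lintegral_add_left_eq_self (fun t => ‖hermFourier b n t‖ₑ ^ 2),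
    lintegral_hermFourier_sq hb, smul_eq_mul, mul_one, abs_of_pos (by positivity), inv_div] at h2
  rw [← h2]
  refine lintegral_congr fun t => ?_
  congr 4
  ring

/-- The kernel norm depends on the first frequency and the multiplier on the second, so the integral
factorises; each point of the cube then contributes b/2π, independently of its position and of n. -/
theorem hsSq_landauOp_cubeOp (hb : 0 < b) (N : ℕ) {m : ℕ → ℝ → ℝ} (hm : ∀ n, BddMult (m n))
    {L : ℝ} (hL : 0 ≤ L) : hsSq (landauOp hb N m hm ∘L cubeOp L)
      = ENNReal.ofReal (L ^ 3) * (ENNReal.ofReal (b / (2 * Real.pi)) *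
        ∑ n ∈ Finset.range N, ∫⁻ k, ENNReal.ofReal (m n k ^ 2)) := by
  have : Fact ((2 : ℝ≥0∞) ≠ ⊤) := ⟨by simp⟩
  obtain ⟨w, e, hw⟩ := exists_countable_hilbertBasis (H := L2R3)
  rw [hsSq_eq_tsum _ e]
  simp_rw [ContinuousLinearMap.comp_apply, enorm_sq_landauOp]
  rw [Summable.tsum_finsetSum fun _ _ => ENNReal.summable, Finset.mul_sum, Finset.mul_sum]
  refine Finset.sum_congr rfl fun n _ => ?_
  have hmn : Measurable fun k => ENNReal.ofReal (m n k ^ 2) :=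
    ((hm n).measurable.pow_const 2).ennreal_ofReal
  have hj : ∀ j, AEMeasurable (fun y : ℝ × ℝ => ENNReal.ofReal (m n y.2 ^ 2)
      * ‖landauC hb n (cubeOp L (e j)) y‖ₑ ^ 2) volume := fun j =>
    (hmn.comp measurable_snd).aemeasurable.mul ((Lp.aestronglyMeasurable _).enorm.pow_const 2)
  rw [← lintegral_tsum hj]
  simp_rw [ENNReal.tsum_mul_left]
  have hF : Measurable fun p : R3 × ℝ => ‖hermFourier b n (p.1 0 + 2 * Real.pi * p.2 / b)‖ₑ ^ 2 :=
    ((continuous_hermFourier hb n).comp (by fun_prop :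
      Continuous fun p : R3 × ℝ => p.1 0 + 2 * Real.pi * p.2 / b)).measurable.enorm.pow_const 2
  calc ∫⁻ y : ℝ × ℝ, ENNReal.ofReal (m n y.2 ^ 2)
        * ∑' j, ‖landauC hb n (cubeOp L (e j)) y‖ₑ ^ 2
      = ∫⁻ y : ℝ × ℝ, (∫⁻ x in cube L, ‖hermFourier b n (x 0 + 2 * Real.pi * y.1 / b)‖ₑ ^ 2)
        * ENNReal.ofReal (m n y.2 ^ 2) := by
        refine lintegral_congr_ae ?_
        filter_upwards [tsum_enorm_landauC_cubeOp hb n hL e] with y hy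
        rw [hy, mul_comm]
    _ = (∫⁻ t, ∫⁻ x in cube L, ‖hermFourier b n (x 0 + 2 * Real.pi * t / b)‖ₑ ^ 2)
        * ∫⁻ k, ENNReal.ofReal (m n k ^ 2) := by
        rw [Measure.volume_eq_prod]
        exact lintegral_prod_mul hF.lintegral_prod_left'.aemeasurable hmn.aemeasurable
    _ = _ := by
        have hF' : Measurable (Function.uncurry fun (t : ℝ) (x : R3) =>
          ‖hermFourier b n (x 0 + 2 * Real.pi * t / b)‖ₑ ^ 2) :=
          ((continuous_hermFourier hb n).comp (by fun_prop : Continuous fun p : ℝ × R3 =>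
            p.2 0 + 2 * Real.pi * p.1 / b)).measurable.enorm.pow_const 2
        rw [lintegral_lintegral_swap hF'.aemeasurable]
        simp_rw [lintegral_hermFourier_affine hb]
        rw [setLIntegral_const, volume_cube hL]
        exact (congrArg (· * _) (mul_comm _ _)).trans (mul_assoc _ _ _)

theorem cubeTrace_eq_hsSq {q : L2R3 → ℝ≥0∞} {A : L2R3 →L[ℂ] L2R3} (h : ∀ f, q f = ‖A f‖ₑ ^ 2)
    (L : ℝ) : cubeTrace q L = hsSq (A ∘L cubeOp L) := by
  simp_rw [cubeTrace, hsSq, h, ContinuousLinearMap.comp_apply, cubeOp_apply]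

theorem hasTracePerVolume_of_eq {q : L2R3 → ℝ≥0∞} {t : ℝ≥0∞}
    (h : ∀ L > 0, cubeTrace q L = ENNReal.ofReal (L ^ 3) * t) : HasTracePerVolume q t := by
  refine tendsto_const_nhds.congr' ?_
  filter_upwards [eventually_gt_atTop 0] with L hL
  have h1 : ENNReal.ofReal (L ^ 3) ≠ 0 := (ENNReal.ofReal_pos.2 (by positivity)).ne'
  rw [h L hL, mul_comm, ENNReal.mul_div_cancel_right h1 ENNReal.ofReal_ne_top]

end

/-! ### The variational problem: Fermi level, lower bound and Fermi projection. -/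

noncomputable section

variable {b : ℝ}

/-! ### Square roots of states -/

section Sqrt

variable {H : Type*} [NormedAddCommGroup H] [InnerProductSpace ℂ H] [CompleteSpace H]
  {γ : H →L[ℂ] H}

theorem opSqrt_mul_self (h : 0 ≤ γ) : opSqrt γ * opSqrt γ = γ := CFC.sqrt_mul_sqrt_self γ h

theorem isSelfAdjoint_opSqrt (γ : H →L[ℂ] H) : IsSelfAdjoint (opSqrt γ) :=
  IsSelfAdjoint.of_nonneg (CFC.sqrt_nonneg γ)

theorem IsStarProjection.opSqrt_eq (h : IsStarProjection γ) : opSqrt γ = γ :=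
  CFC.sqrt_unique h.isIdempotentElem h.nonneg

theorem Commute.opSqrt_left {T : H →L[ℂ] H} (h : Commute γ T) : Commute (opSqrt γ) T :=
  h.cfcₙ_nnreal NNReal.sqrt

theorem re_inner_eq_norm_opSqrt_sq (h : 0 ≤ γ) (f : H) :
    RCLike.re (inner ℂ f (γ f)) = ‖opSqrt γ f‖ ^ 2 := by
  conv_lhs => rw [← opSqrt_mul_self h]
  have h1 : inner ℂ f ((opSqrt γ * opSqrt γ) f) = inner ℂ (opSqrt γ f) (opSqrt γ f) :=
    ((ContinuousLinearMap.isSelfAdjoint_iff_isSymmetric.1 (isSelfAdjoint_opSqrt γ)) _ _).symm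
  rw [h1, inner_self_eq_norm_sq]

theorem norm_opSqrt_le (h : 0 ≤ γ) (h1 : γ ≤ 1) (f : H) : ‖opSqrt γ f‖ ≤ ‖f‖ := by
  have h2 := ((ContinuousLinearMap.le_def _ _).1 h1).re_inner_nonneg_right f
  rw [sub_apply, inner_sub_right, map_sub, re_inner_eq_norm_opSqrt_sq h,
    one_apply_eq_self, inner_self_eq_norm_sq] at h2
  exact le_of_sq_le_sq (by linarith) (norm_nonneg _)

end Sqrt

section State

variable {γ : L2R3 →L[ℂ] L2R3}

theorem densityForm_eq (h : 0 ≤ γ) (f : L2R3) : densityForm γ f = ‖opSqrt γ f‖ₑ ^ 2 := by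
  rw [densityForm, re_inner_eq_norm_opSqrt_sq h, ENNReal.ofReal_pow (norm_nonneg _), ofReal_norm]

/-- The functional calculus preserves commutation, so γ^{1/2} inherits the symmetry of γ. -/
theorem opSqrt_magTransl (h : ∀ (R : R3) (f : L2R3), γ (magTranslation b R f)
    = magTranslation b R (γ f)) (R : R3) (f : L2R3) :
    opSqrt γ (magTransl b R f) = magTransl b R (opSqrt γ f) := by
  have h1 : Commute γ (magTransl b R) := by
    ext1 f
    simp only [mul_apply_eq_comp, magTransl_apply, h]
  exact DFunLike.congr_fun h1.opSqrt_left f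

end State

/-! ### Multipliers -/

theorem lintegral_ofReal_parabola {a c r : ℝ} (hr : 0 ≤ r)
    (h : ∀ k ∈ Set.Icc (-r) r, 0 ≤ a + c * k ^ 2) {g : ℝ → ℝ}
    (hg : ∀ k, g k = (Set.Icc (-r) r).indicator (fun k => a + c * k ^ 2) k) :
    ∫⁻ k, ENNReal.ofReal (g k) = ENNReal.ofReal (2 * a * r + 2 * c * r ^ 3 / 3) := by
  have hi : IntegrableOn (fun k : ℝ => a + c * k ^ 2) (Set.Icc (-r) r) :=
    (by fun_prop : Continuous fun k : ℝ => a + c * k ^ 2).continuousOn.integrableOn_Icc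
  have e : g = (Set.Icc (-r) r).indicator (fun k => a + c * k ^ 2) := funext hg
  rw [← ofReal_integral_eq_lintegral_ofReal]
  · rw [e, integral_indicator measurableSet_Icc, integral_Icc_eq_integral_Ioc,
      ← intervalIntegral.integral_of_le (by linarith)]
    congr 1
    rw [intervalIntegral.integral_add (by simp) (by
      exact (by fun_prop : Continuous fun k : ℝ => c * k ^ 2).intervalIntegrable _ _)]
    simp
    ring
  · rw [e]
    exact hi.integrable_indicator measurableSet_Icc
  · refine Eventually.of_forall fun k => ?_
    rw [hg]
    exact Set.indicator_nonneg h k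

theorem bddMult_indicator_Icc {g : ℝ → ℝ} (hg : Continuous g) (r : ℝ) :
    BddMult ((Set.Icc (-r) r).indicator g) := by
  refine ⟨hg.measurable.indicator measurableSet_Icc, ?_⟩
  obtain ⟨C, hC⟩ := (isCompact_Icc (a := -r) (b := r)).exists_bound_of_continuousOn hg.continuousOn
  refine ⟨max C 0, fun k => ?_⟩
  by_cases hk : k ∈ Set.Icc (-r) r
  · rw [Set.indicator_of_mem hk]
    exact (hC k hk).trans (le_max_left _ _)
  · rw [Set.indicator_of_notMem hk]
    simp

/-! ### The Fermi level -/

/-- The Fermi momentum `(δ - εₙ)₊^{1/2}` of the `n`-th Landau level. -/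
def fermiMomentum (b δ : ℝ) (n : ℕ) : ℝ := √(max (δ - landauLevel b n) 0)

theorem fermiMomentum_nonneg (b δ : ℝ) (n : ℕ) : 0 ≤ fermiMomentum b δ n := Real.sqrt_nonneg _

theorem fermiMomentum_sq (b δ : ℝ) (n : ℕ) :
    fermiMomentum b δ n ^ 2 = max (δ - landauLevel b n) 0 := Real.sq_sqrt (le_max_right _ _)

/-- No positive part is needed on the right: below the level the remaining factor is already zero.
-/
theorem fermiMomentum_cube (b δ : ℝ) (n : ℕ) :
    fermiMomentum b δ n ^ 3 = (δ - landauLevel b n) * fermiMomentum b δ n := by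
  rw [pow_succ, fermiMomentum_sq]
  rcases le_total 0 (δ - landauLevel b n) with h | h
  · rw [max_eq_left h]
  · rw [fermiMomentum, max_eq_right h]
    simp

theorem landauLevel_mono (hb : 0 < b) : Monotone (landauLevel b) := fun m n h => by
  have : (m : ℝ) ≤ n := by exact_mod_cast h
  rw [landauLevel, landauLevel]
  nlinarith

theorem exists_le_landauLevel (hb : 0 < b) (δ : ℝ) : ∃ N, δ ≤ landauLevel b N := by
  obtain ⟨N, hN⟩ := exists_nat_ge (δ / b)
  refine ⟨N, ?_⟩
  rw [div_le_iff₀ hb] at hN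
  rw [landauLevel]
  nlinarith [(Nat.cast_nonneg N : (0 : ℝ) ≤ N)]

theorem fermiMomentum_eq_zero (hb : 0 < b) {δ : ℝ} {N n : ℕ} (hN : δ ≤ landauLevel b N)
    (hn : n ∉ Finset.range N) : fermiMomentum b δ n = 0 := by
  have h1 := landauLevel_mono hb (not_lt.1 fun h => hn (Finset.mem_range.2 h))
  rw [fermiMomentum, max_eq_right (by linarith), Real.sqrt_zero]

/-- Intermediate values between δ = b, where the sum vanishes, and δ = b + T², where the lowest
level alone contributes T. On this interval all levels from `N` on are empty, so a finite sum
suffices. -/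
theorem exists_hasSum_fermiMomentum (hb : 0 < b) {T : ℝ} (hT : 0 < T) :
    ∃ δ, 0 < δ ∧ HasSum (fermiMomentum b δ) T := by
  obtain ⟨N, hN⟩ := exists_le_landauLevel hb (b + T ^ 2)
  have hc : Continuous fun δ => ∑ n ∈ Finset.range (N + 1), fermiMomentum b δ n := by
    simp only [fermiMomentum]
    fun_prop
  have h0 : ∑ n ∈ Finset.range (N + 1), fermiMomentum b b n = 0 := by
    refine Finset.sum_eq_zero fun n _ => fermiMomentum_eq_zero (N := 0) hb ?_ (by simp)
    simp [landauLevel]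
  have h1 : T ≤ ∑ n ∈ Finset.range (N + 1), fermiMomentum b (b + T ^ 2) n := by
    refine le_trans ?_ (Finset.single_le_sum (f := fermiMomentum b (b + T ^ 2))
      (fun n _ => fermiMomentum_nonneg _ _ _) (Finset.mem_range.2 N.succ_pos))
    refine Real.le_sqrt_of_sq_le (le_trans (le_of_eq ?_) (le_max_left _ _))
    simp [landauLevel]
  obtain ⟨δ, hδ, hδT⟩ := intermediate_value_Icc (by nlinarith : b ≤ b + T ^ 2) hc.continuousOn
    (⟨h0.le.trans hT.le, h1⟩ : T ∈ Set.Icc _ _)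
  refine ⟨δ, hb.trans_le hδ.1, ?_⟩
  simp only at hδT
  rw [← hδT]
  refine hasSum_sum_of_ne_finset_zero fun n hn => fermiMomentum_eq_zero hb ?_ hn
  exact hδ.2.trans (hN.trans (landauLevel_mono hb N.le_succ))

/-- The sum is strictly increasing only above the lowest level, and T > 0 forces δ to lie there; the
term n = 0 then gives strictness. -/
theorem fermiLevel_lt_of_lt (hb : 0 < b) {δ δ' T T' : ℝ} (hT : 0 < T)
    (h : HasSum (fermiMomentum b δ) T) (h' : HasSum (fermiMomentum b δ') T') (hδ : δ < δ') :
    T < T' := by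
  have h0 : landauLevel b 0 < δ := by
    by_contra! h0
    have : T = 0 := h.unique (by
      have : fermiMomentum b δ = fun _ => 0 :=
        funext fun n => fermiMomentum_eq_zero hb h0 (by simp)
      rw [this]
      exact hasSum_zero)
    linarith
  refine hasSum_lt (i := 0) (fun n => Real.sqrt_le_sqrt (max_le_max (by linarith) le_rfl)) ?_ h h'
  refine Real.sqrt_lt_sqrt (le_max_right _ _) ?_
  rw [max_eq_left (by linarith), max_eq_left (by linarith)]
  linarith

/-! ### The lower bound -/

/-- The multipliers `((δ - εₙ)₊ - 4 π² k²)₊^{1/2}`. -/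
def gapMult (b δ : ℝ) (n : ℕ) (k : ℝ) : ℝ :=
  √(max (fermiMomentum b δ n ^ 2 - 4 * Real.pi ^ 2 * k ^ 2) 0)

theorem bddMult_gapMult (b δ : ℝ) (n : ℕ) : BddMult (gapMult b δ n) := by
  refine ⟨(by unfold gapMult; fun_prop : Continuous (gapMult b δ n)).measurable,
    fermiMomentum b δ n, fun k => ?_⟩
  rw [gapMult, abs_of_nonneg (Real.sqrt_nonneg _)]
  refine Real.sqrt_le_iff.2 ⟨fermiMomentum_nonneg _ _ _, max_le ?_ (sq_nonneg _)⟩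
  nlinarith [sq_nonneg (2 * Real.pi * k)]

theorem gapMult_sq (b δ : ℝ) (n : ℕ) (k : ℝ) : gapMult b δ n k ^ 2
    = max (fermiMomentum b δ n ^ 2 - 4 * Real.pi ^ 2 * k ^ 2) 0 := Real.sq_sqrt (le_max_right _ _)

theorem abs_le_fermiRadius_iff {s k : ℝ} (hs : 0 ≤ s) :
    k ∈ Set.Icc (-(s / (2 * Real.pi))) (s / (2 * Real.pi)) ↔ 4 * Real.pi ^ 2 * k ^ 2 ≤ s ^ 2 := by
  rw [Set.mem_Icc, ← abs_le, le_div_iff₀ (by positivity), ← abs_of_nonneg hs,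
    ← abs_of_pos Real.two_pi_pos, ← abs_mul, ← sq_le_sq, abs_of_nonneg hs]
  ring_nf

theorem lintegral_gapMult_sq (b δ : ℝ) (n : ℕ) : ∫⁻ k, ENNReal.ofReal (gapMult b δ n k ^ 2)
    = ENNReal.ofReal (2 * fermiMomentum b δ n ^ 3 / (3 * Real.pi)) := by
  set s := fermiMomentum b δ n with hs
  have hs0 : 0 ≤ s := fermiMomentum_nonneg _ _ _
  rw [lintegral_ofReal_parabola (a := s ^ 2) (c := -(4 * Real.pi ^ 2)) (r := s / (2 * Real.pi))
    (by positivity) (fun k hk => ?_) (fun k => ?_)]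
  · congr 1
    have := Real.pi_ne_zero
    field_simp
    ring
  · have := (abs_le_fermiRadius_iff hs0).1 hk
    linarith
  · rw [gapMult_sq]
    by_cases hk : k ∈ Set.Icc (-(s / (2 * Real.pi))) (s / (2 * Real.pi))
    · rw [Set.indicator_of_mem hk]
      have := (abs_le_fermiRadius_iff hs0).1 hk
      rw [max_eq_left (by linarith)]
      ring
    · rw [Set.indicator_of_notMem hk]
      rw [abs_le_fermiRadius_iff hs0] at hk
      exact max_eq_right (by linarith)

/-- The scalar form of δ ≤ E + (δ - E)₊ at the energy E = εₙ + 4π²k². -/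
theorem level_le_energy_add_gap (b δ : ℝ) (n : ℕ) (k : ℝ) :
    δ ≤ landauLevel b n + 4 * Real.pi ^ 2 * k ^ 2 + gapMult b δ n k ^ 2 := by
  rw [gapMult_sq, fermiMomentum_sq]
  have h1 := le_max_left (max (δ - landauLevel b n) 0 - 4 * Real.pi ^ 2 * k ^ 2) 0
  have h2 := le_max_left (δ - landauLevel b n) 0
  linarith

/-- The scalar inequality integrated against the spectral density of ψ. Truncation at `N` loses
nothing, since the gap multiplier vanishes on all higher levels. -/
theorem ofReal_mul_enorm_sq_le (hb : 0 < b) {δ : ℝ} {N : ℕ} (hN : δ ≤ landauLevel b N) (ψ : L2R3) :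
    ENNReal.ofReal δ * ‖ψ‖ₑ ^ 2
      ≤ landauForm b ψ + ‖landauOp hb N _ (bddMult_gapMult b δ) ψ‖ₑ ^ 2 := by
  refine le_trans ?_ (add_le_add_left (landauEnergy_le hb ψ) _)
  have e : ‖landauOp hb N _ (bddMult_gapMult b δ) ψ‖ₑ ^ 2
      = ∑' n, ∫⁻ y, ENNReal.ofReal (gapMult b δ n y.2 ^ 2) * ‖landauC hb n ψ y‖ₑ ^ 2 := by
    rw [enorm_sq_landauOp, tsum_eq_sum]
    intro n hn
    have h : ∀ k, gapMult b δ n k = 0 := fun k => by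
      rw [gapMult, fermiMomentum_eq_zero hb hN hn, max_eq_right, Real.sqrt_zero]
      nlinarith [sq_nonneg (2 * Real.pi * k)]
    simp [h]
  rw [e, landauEnergy, ← tsum_enorm_landauC_sq hb ψ, ← ENNReal.tsum_mul_left, ← ENNReal.tsum_add]
  refine ENNReal.tsum_le_tsum fun n => ?_
  rw [Lp.enorm_sq_eq_lintegral, ← lintegral_const_mul' _ _ ENNReal.ofReal_ne_top,
    ← lintegral_add_left']
  · refine lintegral_mono fun y => ?_
    rw [← add_mul, ← ENNReal.ofReal_add (by rw [landauLevel]; positivity) (sq_nonneg _)]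
    gcongr
    exact level_le_energy_add_gap b δ n y.2
  · exact AEMeasurable.mul (by fun_prop) ((Lp.aestronglyMeasurable _).enorm.pow_const 2)

/-- The inequality δ ≤ H + (δ - H)₊ is applied to γ^{1/2} f for f localised in a cube; the last term
is bounded by cyclicity and by γ ≤ 1. -/
theorem mul_trace_le (hb : 0 < b) {δ ρ : ℝ} {N : ℕ} (hN : δ ≤ landauLevel b N)
    {γ : L2R3 →L[ℂ] L2R3} {t : ℝ≥0∞} (hγ : IsHomogeneousState b ρ γ)
    (ht : HasTracePerVolume (kineticForm b γ) t) :
    ENNReal.ofReal δ * ENNReal.ofReal ρ ≤ t + ENNReal.ofReal (b / (2 * Real.pi)) *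
      ∑ n ∈ Finset.range N, ∫⁻ k, ENNReal.ofReal (gapMult b δ n k ^ 2) := by
  set C := ENNReal.ofReal (b / (2 * Real.pi)) *
      ∑ n ∈ Finset.range N, ∫⁻ k, ENNReal.ofReal (gapMult b δ n k ^ 2) with hC
  set Y := landauOp hb N _ (bddMult_gapMult b δ) with hY
  set S := opSqrt γ with hS
  -- Cyclicity replaces `Y ∘L S` by its adjoint `S ∘L Y`, in which the contraction `S` stands on the
  -- left and can be dropped.
  have hYS : ∀ L > 0, hsSq (Y ∘L S ∘L cubeOp L) ≤ ENNReal.ofReal (L ^ 3) * C := fun L hL => by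
    have h1 := hsSq_comp_cubeOp_eq_adjoint (b := b) (A := Y ∘L S) (fun R f => by
      simp only [ContinuousLinearMap.comp_apply, hS, opSqrt_magTransl hγ.commute, hY,
        landauOp_magTransl]) hL
    have e1 : (Y ∘L S).adjoint = S ∘L Y := by
      rw [ContinuousLinearMap.adjoint_comp, (isSelfAdjoint_opSqrt γ).adjoint_eq,
        (isSelfAdjoint_landauOp hb N (bddMult_gapMult b δ)).adjoint_eq]
    rw [e1, ContinuousLinearMap.comp_assoc, ContinuousLinearMap.comp_assoc] at h1
    rw [h1, hC, ← hsSq_landauOp_cubeOp hb N (bddMult_gapMult b δ) hL.le]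
    exact hsSq_comp_le S (norm_opSqrt_le hγ.nonneg hγ.le_one) _
  have key : ∀ L > 0, ENNReal.ofReal δ * cubeTrace (densityForm γ) L
      ≤ cubeTrace (kineticForm b γ) L + ENNReal.ofReal (L ^ 3) * C := fun L hL => by
    refine le_trans ?_ (add_le_add_right (hYS L hL) _)
    simp_rw [cubeTrace, ENNReal.mul_iSup, Finset.mul_sum]
    refine iSup_le fun n => iSup_le fun e => iSup_le fun he => ?_
    calc ∑ i, ENNReal.ofReal δ * densityForm γ (cubeProj L (e i))
        ≤ ∑ i, (kineticForm b γ (cubeProj L (e i)) + ‖(Y ∘L S ∘L cubeOp L) (e i)‖ₑ ^ 2) := by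
          refine Finset.sum_le_sum fun i _ => ?_
          rw [densityForm_eq hγ.nonneg, kineticForm, ContinuousLinearMap.comp_apply,
            ContinuousLinearMap.comp_apply, cubeOp_apply]
          exact ofReal_mul_enorm_sq_le hb hN _
      _ ≤ _ := by
          rw [Finset.sum_add_distrib]
          refine add_le_add ?_ ?_
          · exact le_iSup_of_le n (le_iSup_of_le e (le_iSup_of_le he le_rfl))
          · rw [hsSq]
            exact le_iSup_of_le n (le_iSup_of_le e (le_iSup_of_le he le_rfl))
  -- The bound holds for each cube, with an error term exactly proportional to L³, so dividing by L³
  -- and letting L → ∞ gives the claim.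
  refine le_of_tendsto_of_tendsto
    (ENNReal.Tendsto.const_mul hγ.trace (Or.inr ENNReal.ofReal_ne_top))
    (ht.add (tendsto_const_nhds (x := C))) ?_
  filter_upwards [eventually_gt_atTop 0] with L hL
  have h1 : ENNReal.ofReal (L ^ 3) ≠ 0 := (ENNReal.ofReal_pos.2 (by positivity)).ne'
  rw [← mul_div_assoc]
  refine (ENNReal.div_le_div_right (key L hL) _).trans ?_
  rw [ENNReal.add_div, mul_comm _ C, ENNReal.mul_div_cancel_right h1 ENNReal.ofReal_ne_top]

/-! ### The ground state -/

/-- The radius of the Fermi interval of the `n`-th Landau level. -/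
def fermiRadius (b δ : ℝ) (n : ℕ) : ℝ := fermiMomentum b δ n / (2 * Real.pi)

theorem fermiRadius_nonneg (b δ : ℝ) (n : ℕ) : 0 ≤ fermiRadius b δ n :=
  div_nonneg (fermiMomentum_nonneg _ _ _) Real.two_pi_pos.le

/-- The indicator functions of the Fermi intervals. -/
def fermiMult (b δ : ℝ) (n : ℕ) : ℝ → ℝ :=
  (Set.Icc (-fermiRadius b δ n) (fermiRadius b δ n)).indicator fun _ => 1

theorem bddMult_fermiMult (b δ : ℝ) (n : ℕ) : BddMult (fermiMult b δ n) :=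
  bddMult_indicator_Icc continuous_const _

/-- The square roots of the kinetic energy on the Fermi intervals. -/
def fermiEnergyMult (b δ : ℝ) (n : ℕ) : ℝ → ℝ :=
  (Set.Icc (-fermiRadius b δ n) (fermiRadius b δ n)).indicator
    fun k => √(landauLevel b n + 4 * Real.pi ^ 2 * k ^ 2)

theorem bddMult_fermiEnergyMult (b δ : ℝ) (n : ℕ) : BddMult (fermiEnergyMult b δ n) :=
  bddMult_indicator_Icc (by fun_prop) _

theorem bddMult_mul_fermiMult (b δ : ℝ) (n : ℕ) :
    BddMult fun k => 2 * Real.pi * k * fermiMult b δ n k := by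
  have h := bddMult_indicator_Icc (g := fun k => 2 * Real.pi * k) (by fun_prop) (fermiRadius b δ n)
  refine cast (congrArg BddMult (funext fun k => ?_)) h
  rw [fermiMult]
  by_cases hk : k ∈ Set.Icc (-fermiRadius b δ n) (fermiRadius b δ n) <;> simp [hk]

theorem lintegral_fermiMult_sq (b δ : ℝ) (n : ℕ) :
    ∫⁻ k, ENNReal.ofReal (fermiMult b δ n k ^ 2)
      = ENNReal.ofReal (fermiMomentum b δ n / Real.pi) := by
  rw [lintegral_ofReal_parabola (a := 1) (c := 0) (fermiRadius_nonneg b δ n) (fun k _ => by simp)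
    (fun k => ?_)]
  · congr 1
    rw [fermiRadius]
    have := Real.pi_ne_zero
    field_simp
    ring
  · rw [fermiMult]
    by_cases hk : k ∈ Set.Icc (-fermiRadius b δ n) (fermiRadius b δ n) <;> simp [hk]

theorem lintegral_fermiEnergyMult_sq (hb : 0 < b) (δ : ℝ) (n : ℕ) :
    ∫⁻ k, ENNReal.ofReal (fermiEnergyMult b δ n k ^ 2)
      = ENNReal.ofReal (landauLevel b n * fermiMomentum b δ n / Real.pi
        + fermiMomentum b δ n ^ 3 / (3 * Real.pi)) := by
  have h0 : ∀ k : ℝ, 0 ≤ landauLevel b n + 4 * Real.pi ^ 2 * k ^ 2 := fun k => by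
    rw [landauLevel]; positivity
  rw [lintegral_ofReal_parabola (a := landauLevel b n) (c := 4 * Real.pi ^ 2)
    (fermiRadius_nonneg b δ n) (fun k _ => h0 k) (fun k => ?_)]
  · congr 1
    rw [fermiRadius]
    have := Real.pi_ne_zero
    field_simp
    ring
  · rw [fermiEnergyMult]
    by_cases hk : k ∈ Set.Icc (-fermiRadius b δ n) (fermiRadius b δ n)
    · rw [Set.indicator_of_mem hk, Set.indicator_of_mem hk, Real.sq_sqrt (h0 k)]
    · rw [Set.indicator_of_notMem hk, Set.indicator_of_notMem hk, zero_pow two_ne_zero]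

/-- The spectral projection of the Landau operator below the level `δ`. -/
def fermiState (hb : 0 < b) (N : ℕ) (δ : ℝ) : L2R3 →L[ℂ] L2R3 :=
  landauOp hb N _ (bddMult_fermiMult b δ)

theorem isStarProjection_fermiState (hb : 0 < b) (N : ℕ) (δ : ℝ) :
    IsStarProjection (fermiState hb N δ) := by
  refine ⟨?_, isSelfAdjoint_landauOp hb N _⟩
  ext1 f
  refine landauOp_landauOp hb N _ _ _ (fun n k => ?_) f
  rw [fermiMult]
  by_cases hk : k ∈ Set.Icc (-fermiRadius b δ n) (fermiRadius b δ n) <;> simp [hk]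

theorem opSqrt_fermiState (hb : 0 < b) (N : ℕ) (δ : ℝ) :
    opSqrt (fermiState hb N δ) = fermiState hb N δ :=
  (isStarProjection_fermiState hb N δ).opSqrt_eq

theorem isHomogeneousState_fermiState (hb : 0 < b) (N : ℕ) (δ : ℝ) {ρ : ℝ}
    (hρ : ρ = b / (2 * Real.pi) * ∑ n ∈ Finset.range N, fermiMomentum b δ n / Real.pi) :
    IsHomogeneousState b ρ (fermiState hb N δ) where
  isSelfAdjoint := (isStarProjection_fermiState hb N δ).isSelfAdjoint
  nonneg := (isStarProjection_fermiState hb N δ).nonneg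
  le_one := (isStarProjection_fermiState hb N δ).le_one
  commute R f := by
    rw [← magTransl_apply, ← magTransl_apply]
    exact landauOp_magTransl hb N _ R f
  trace := by
    refine hasTracePerVolume_of_eq fun L hL => ?_
    rw [cubeTrace_eq_hsSq (densityForm_eq (isStarProjection_fermiState hb N δ).nonneg),
      opSqrt_fermiState, fermiState, hsSq_landauOp_cubeOp hb N _ hL.le, hρ]
    simp_rw [lintegral_fermiMult_sq]
    rw [ENNReal.ofReal_mul (by positivity), ENNReal.ofReal_sum_of_nonneg fun n _ =>
      div_nonneg (fermiMomentum_nonneg _ _ _) Real.pi_pos.le]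

/-- A projection is its own square root, so the kinetic form is the squared norm of the operator
whose multiplier is the square root of the energy on the Fermi intervals. -/
theorem hasTracePerVolume_fermiState (hb : 0 < b) (N : ℕ) (δ : ℝ) :
    HasTracePerVolume (kineticForm b (fermiState hb N δ)) (ENNReal.ofReal (b / (2 * Real.pi) *
      ∑ n ∈ Finset.range N, (landauLevel b n * fermiMomentum b δ n / Real.pi
        + fermiMomentum b δ n ^ 3 / (3 * Real.pi)))) := by
  refine hasTracePerVolume_of_eq fun L hL => ?_
  rw [cubeTrace_eq_hsSq (A := landauOp hb N _ (bddMult_fermiEnergyMult b δ)) fun f => ?_,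
    hsSq_landauOp_cubeOp hb N _ hL.le]
  · simp_rw [lintegral_fermiEnergyMult_sq hb]
    rw [ENNReal.ofReal_mul (by positivity), ENNReal.ofReal_sum_of_nonneg fun n _ => ?_]
    have := fermiMomentum_nonneg b δ n
    have : 0 ≤ landauLevel b n := by rw [landauLevel]; positivity
    positivity
  · rw [kineticForm, opSqrt_fermiState]
    refine landauForm_landauOp hb N _ (bddMult_mul_fermiMult b δ) _ (fun n k => ?_) f
    rw [fermiEnergyMult, fermiMult]
    have h0 : 0 ≤ landauLevel b n + 4 * Real.pi ^ 2 * k ^ 2 := by rw [landauLevel]; positivity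
    by_cases hk : k ∈ Set.Icc (-fermiRadius b δ n) (fermiRadius b δ n)
    · rw [Set.indicator_of_mem hk, Set.indicator_of_mem hk, Real.sq_sqrt h0]
      ring
    · rw [Set.indicator_of_notMem hk, Set.indicator_of_notMem hk]
      ring

end

/-! ### Conclusion: existence and uniqueness of the Fermi level, and the matching bounds. -/

theorem mainTheorem5 (b ρ : ℝ) (hb : 0 < b) (hρ : 0 < ρ) :
    ∃ δ : ℝ, 0 < δ ∧
      HasSum (fun n : ℕ => √(max (δ - landauLevel b n) 0)) (2 * Real.pi ^ 2 * ρ / b) ∧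
      (∀ δ' : ℝ,
        HasSum (fun n : ℕ => √(max (δ' - landauLevel b n) 0)) (2 * Real.pi ^ 2 * ρ / b) →
          δ' = δ) ∧
      Summable (fun n : ℕ => landauLevel b n * √(max (δ - landauLevel b n) 0)) ∧
      kineticEnergyDensity b ρ = ENNReal.ofReal
        (δ * ρ / 6 + b / (6 * Real.pi ^ 2) *
          ∑' n : ℕ, landauLevel b n * √(max (δ - landauLevel b n) 0)) := by
  have hT : 0 < 2 * Real.pi ^ 2 * ρ / b := by positivity
  obtain ⟨δ, hδ, hs⟩ := exists_hasSum_fermiMomentum hb hT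
  obtain ⟨N, hN⟩ := exists_le_landauLevel hb δ
  have hz : ∀ n ∉ Finset.range N, landauLevel b n * fermiMomentum b δ n = 0 := fun n hn => by
    rw [fermiMomentum_eq_zero hb hN hn, mul_zero]
  have hsum : HasSum (fun n => landauLevel b n * fermiMomentum b δ n)
      (∑ n ∈ Finset.range N, landauLevel b n * fermiMomentum b δ n) :=
    hasSum_sum_of_ne_finset_zero hz
  refine ⟨δ, hδ, hs, fun δ' hs' => ?_, hsum.summable, ?_⟩
  · rcases lt_trichotomy δ' δ with h | h | h
    · exact absurd (fermiLevel_lt_of_lt hb hT hs' hs h) (lt_irrefl _)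
    · exact h
    · exact absurd (fermiLevel_lt_of_lt hb hT hs hs' h) (lt_irrefl _)
  have hpi := Real.pi_ne_zero
  have hA : ∑ n ∈ Finset.range N, fermiMomentum b δ n = 2 * Real.pi ^ 2 * ρ / b :=
    (hasSum_sum_of_ne_finset_zero fun n hn => fermiMomentum_eq_zero hb hN hn).unique hs
  set B := ∑ n ∈ Finset.range N, landauLevel b n * fermiMomentum b δ n with hB
  -- Writing sₙ for the Fermi momenta, sₙ³ = δsₙ - εₙsₙ and ∑ sₙ is prescribed; this reduces both
  -- bounds to δρ and `B`.
  have hcube : ∑ n ∈ Finset.range N, fermiMomentum b δ n ^ 3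
      = δ * (2 * Real.pi ^ 2 * ρ / b) - B := by
    rw [← hA, Finset.mul_sum, hB, ← Finset.sum_sub_distrib]
    exact Finset.sum_congr rfl fun n _ => by rw [fermiMomentum_cube, sub_mul]
  change _ = ENNReal.ofReal (δ * ρ / 6 + b / (6 * Real.pi ^ 2) *
    ∑' n : ℕ, landauLevel b n * fermiMomentum b δ n)
  rw [hsum.tsum_eq, kineticEnergyDensity]
  refine le_antisymm (sInf_le ?_) (le_sInf ?_)
  · refine ⟨fermiState hb N δ, _, isHomogeneousState_fermiState hb N δ ?_,
      hasTracePerVolume_fermiState hb N δ, ?_⟩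
    · rw [← Finset.sum_div, hA]
      field_simp
    -- The energy of the Fermi projection is (b/2π²)(B + ∑ sₙ³/3); half of it simplifies to the
    -- claimed value.
    · rw [← ENNReal.ofReal_ofNat 2, ← ENNReal.ofReal_div_of_pos two_pos, Finset.sum_add_distrib,
        ← Finset.sum_div, ← Finset.sum_div, hcube]
      congr 1
      field_simp
      ring
  · rintro E ⟨γ, t, hγ, ht, rfl⟩
    have h := mul_trace_le hb hN hγ ht
    simp_rw [lintegral_gapMult_sq] at h
    rw [← ENNReal.ofReal_sum_of_nonneg fun n _ => by
        have := fermiMomentum_nonneg b δ n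
        positivity,
      ← ENNReal.ofReal_mul hδ.le, ← ENNReal.ofReal_mul (by positivity), ← Finset.sum_div,
      ← Finset.mul_sum, hcube] at h
    rw [ENNReal.le_div_iff_mul_le (by simp) (by simp), ← ENNReal.ofReal_ofNat 2,
      ← ENNReal.ofReal_mul' (by norm_num)]
    -- Now t ≥ δρ - (b/3π²) ∑ sₙ³. The subtracted quantity is nonnegative, so the subtraction in [0,
    -- ∞] may be done inside `ENNReal.ofReal`; its value is twice the claimed energy.
    rw [← tsub_le_iff_right, ← ENNReal.ofReal_sub _ ?_] at h
    · refine le_trans (ENNReal.ofReal_le_ofReal (le_of_eq ?_)) h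
      field_simp
      ring
    · rw [← hcube]
      have : 0 ≤ ∑ n ∈ Finset.range N, fermiMomentum b δ n ^ 3 :=
        Finset.sum_nonneg fun n _ => pow_nonneg (fermiMomentum_nonneg b δ n) 3
      positivity
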